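/- Let $n\ge 1$. A $(2n+1)$-round public-coin interactive proof $\Pi$ with finite non-empty instance set $\mathcal X$, message set $\mathcal M$ and challenge set $\mathcal C$ is given by a predicate $V$: the prover sends an instance $x\in\mathcal X$ and $a_1\in\mathcal M$, receives a uniformly random $c_1\in\mathcal C$, sends $a_2$, receives $c_2$, …, receives $c_n$, and finally sends a (possibly quantum) message $z$; the verifier $\mathcal V$ accepts iff $V(x,a_1,c_1,\dots,a_n,c_n,z)$ holds (for quantum $z$, $V(x,a_1,c_1,\dots,a_n,c_n,\cdot)$ is an orthogonal projection, measured on $z$). In the Fiat–Shamir transform $\mathsf{FS}[\Pi]$ with respect to a hash function $H$ with range $\mathcal C$, a proof for $x$ is $\pi=(a_1,\dots,a_n,z)$, and $V^H_{FS}(x,\pi)$ means that $V(x,a_1,c_1,\dots,a_n,c_n,z)$ holds for $c_1=H(0,x,a_1)$ and $c_i=H(i-1,c_{i-1},a_i)$, $2\le i\le n$. There are an $(n+1)$-stage quantum algorithm $\mathcal S$ with black-box access to an oracle quantum algorithm $\mathcal A$, and a polynomial $p$, such that the following holds for all finite non-empty sets $\mathcal X,\mathcal M,\mathcal C$ (each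 represented by an initial segment of the natural numbers), every $q\ge 0$ and every adversary $\mathcal A$ that makes $q$ (controlled) quantum queries to $H$ and outputs some $x\in\mathcal X$ together with $\pi=(a_1,\dots,a_n,z)$. On input $q,|\mathcal X|,|\mathcal M|,|\mathcal C|$, the algorithm $\mathcal S^{\mathcal A}$ runs in time at most $p(q+\ell(|\mathcal X|)+\ell(|\mathcal M|)+\ell(|\mathcal C|))$, where $\ell$ is the bit length and each application of one of the operators of $\mathcal A$ counts as one step. It outputs $x$ and $a_1$ in its first stage and $a_{i+1}$ in stage $i+1$ on input $c_i$ (for $1\le i<n$), and in its last stage, on input $c_n$, it outputs $z$. Moreover, there are $\epsilon_{x}\ge 0$ $(x\in\mathcal X)$ with $\sum_{x\in\mathcal X}\epsilon_{x}=\frac{n!}{|\mathcal C|}$ such that for every $(2n+1)$-round public-coin interactive proof $\Pi$ with these sets and every $x^\circ\in\mathcal X$, $$\Pr\bigl[x=x^\circ\wedge v=\mathrm{accept}:(x,v)\leftarrow\langle\mathcal S^{\mathcal A},\mathcal V\rangle\bigr]\;\ge\;\frac{n!}{(2q+n+1)^{2n}}\Pr_H\bigl[x=x^\circ\wedge V^H_{FS}(x,\pi):(x,\pi)\leftarrow\mathcal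 A^H\bigr]-\epsilon_{x^\circ},$$ where $H$ is uniformly random and the left-hand probability is over the challenges of $\mathcal V$ and the computation of $\mathcal S^{\mathcal A}$. -/

import Mathlib

open scoped Matrix

noncomputable section

namespace MultiRoundFS

/-! ## Public-coin interactive proofs and the multi-round Fiat–Shamir verifier

A finite non-empty set is represented by `{0, …, N - 1}`, where `N` is its size. -/

/-- Sizes of the instance set `𝒳`, the message set (from which `a₁, …, aₙ` are taken) and the
challenge set `𝒞`; dimensions of the register `Z` of the last message and of the adversary's
private register `E`. -/
structure Sizes where
  inst : ℕ
  msg : ℕ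
  chal : ℕ
  zdim : ℕ
  edim : ℕ

/-- A `(2n+1)`-round public-coin interactive proof, given by the verification predicate
`V(x, a₁, c₁, …, aₙ, cₙ, z)`. The last message `z` may be quantum, so that the predicate is a
family of orthogonal projections on the register `Z`; a predicate of a classical `z` is the case
of diagonal projections. (The honest prover and the language are irrelevant here.) -/
structure PCIP (n : ℕ) (d : Sizes) where
  V : Fin d.inst → (Fin n → Fin d.msg) → (Fin n → Fin d.chal) → Matrix (Fin d.zdim) (Fin d.zdim) ℂ
  isProj : ∀ x a c, IsStarProjection (V x a c)

/-- Hash inputs `(i, x, a)` (with `i = 0` in an honest evaluation) and `(i, c, a)`. -/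
abbrev Dom (n : ℕ) (d : Sizes) : Type := Fin n × (Fin d.inst ⊕ Fin d.chal) × Fin d.msg

/-- The hash functions. -/
abbrev Hash (n : ℕ) (d : Sizes) : Type := Dom n d → Fin d.chal

variable {n : ℕ} {d : Sizes} {q : ℕ}

def chainAux (H : Hash n d) (x : Fin d.inst) (a : Fin n → Fin d.msg) :
    (i : ℕ) → i < n → Fin d.chal
  | 0, h => H (⟨0, h⟩, Sum.inl x, a ⟨0, h⟩)
  | i + 1, h => H (⟨i + 1, h⟩, Sum.inr (chainAux H x a i (Nat.lt_of_succ_lt h)), a ⟨i + 1, h⟩)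

/-- The challenges `c₁ = H(0, x, a₁)`, `cᵢ = H(i - 1, cᵢ₋₁, aᵢ)`. -/
def chain (H : Hash n d) (x : Fin d.inst) (a : Fin n → Fin d.msg) (i : Fin n) : Fin d.chal :=
  chainAux H x a i i.isLt

/-! ## Oracle quantum algorithms -/

/-- The response register: bit strings (as numbers) long enough for the elements of `𝒞`. -/
abbrev Resp (d : Sizes) : Type := Fin (2 ^ Nat.clog 2 d.chal)

/-- The work registers: the output registers for `x`, for `a₁, …, aₙ` and for `z`,
and the private register. -/
abbrev Work (n : ℕ) (d : Sizes) : Type :=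
  Fin d.inst × (Fin n → Fin d.msg) × Fin d.zdim × Fin d.edim

/-- The computational basis of the adversary's space: control bit, query input, response
register, work registers. -/
abbrev Basis (n : ℕ) (d : Sizes) : Type := Bool × Dom n d × Resp d × Work n d

/-- Bitwise exclusive or with (the last bits of) `v`. -/
def xorResp (y : Resp d) (v : ℕ) : Resp d :=
  ⟨(y.val ^^^ v) % 2 ^ Nat.clog 2 d.chal, Nat.mod_lt _ (by positivity)⟩

/-- `|c⟩|x⟩|y⟩ ↦ |c⟩|x⟩|y ⊕ c · H(x)⟩`, on basis states. -/
def queryMap (H : Hash n d) : Basis n d → Basis n d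
  | (b, v, y, w) => (b, v, if b then xorResp y (H v).val else y, w)

/-- The oracle unitary `𝒪^H`. -/
def queryMatrix (H : Hash n d) : Matrix (Basis n d) (Basis n d) ℂ :=
  fun b' b => if b' = queryMap H b then 1 else 0

/-- An oracle quantum algorithm with `q` (controlled) queries: an initial state and operators
`A₁, …, A_q`, each a unitary, or a projection followed by a unitary, or vice versa. -/
structure Adversary (n : ℕ) (d : Sizes) (q : ℕ) where
  start : Basis n d → ℂ
  start_norm : ∑ b, ‖start b‖ ^ 2 = 1
  op : Fin q → Matrix (Basis n d) (Basis n d) ℂ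
  op_spec : ∀ i, ∃ U ∈ Matrix.unitaryGroup (Basis n d) ℂ, ∃ P : Matrix (Basis n d) (Basis n d) ℂ,
    IsStarProjection P ∧ (op i = U * P ∨ op i = P * U)

/-- The final state `A_q 𝒪^H ⋯ A₁ 𝒪^H |φ₀⟩`. -/
def Adversary.final (A : Adversary n d q) (H : Hash n d) : Basis n d → ℂ :=
  (List.finRange q).foldl (fun φ i => A.op i *ᵥ (queryMatrix H *ᵥ φ)) A.start

/-- `1 ⊗ P ⊗ 1` on the adversary's space, with `P` acting on the register `Z`. -/
def onZ (P : Matrix (Fin d.zdim) (Fin d.zdim) ℂ) : Matrix (Basis n d) (Basis n d) ℂ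
  | (b', v', y', x', a', z', e'), (b, v, y, x, a, z, e) =>
    if b' = b ∧ v' = v ∧ y' = y ∧ x' = x ∧ a' = a ∧ e' = e then P z' z else 0

/-- The probability, over a uniformly random `H`, that the measured output instance of `A^H` is
`x` and that the Fiat–Shamir verifier accepts the proof `(a₁, …, aₙ, z)` that `A^H` outputs. -/
def forgeProb (A : Adversary n d q) (prot : PCIP n d) (x : Fin d.inst) : ℝ :=
  (∑ H : Hash n d, ∑ a : Fin n → Fin d.msg, ∑ b : Basis n d,
    if b.2.2.2.1 = x ∧ b.2.2.2.2.1 = a then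
      ‖(onZ (prot.V x a (chain H x a)) *ᵥ A.final H) b‖ ^ 2 else 0)
  / Fintype.card (Hash n d)

/-! ## Classical programs with a time count

A random access machine over natural numbers with logarithmic cost. Loops are bounded by a number
that is fixed when the loop is entered, so that every program terminates; every iteration is paid
for. -/

/-- Classical memory. -/
abbrev Mem : Type := ℕ → ℕ

inductive Op where
  | add | sub | mul | div | mod | xor

def Op.eval : Op → ℕ → ℕ → ℕ
  | .add, k, l => k + l
  | .sub, k, l => k - l
  | .mul, k, l => k * l
  | .div, k, l => k / l
  | .mod, k, l => k % l
  | .xor, k, l => k ^^^ l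

/-- Expressions; `mem e` is the content of the memory cell with address `e`. -/
inductive Exp where
  | const (k : ℕ)
  | mem (e : Exp)
  | op (o : Op) (e₁ e₂ : Exp)

def Exp.eval (m : Mem) : Exp → ℕ
  | .const k => k
  | .mem e => m (e.eval m)
  | .op o e₁ e₂ => o.eval (e₁.eval m) (e₂.eval m)

/-- The time for evaluating an expression, in terms of the bit lengths of all operands. -/
def Exp.cost (m : Mem) : Exp → ℕ
  | .const k => 1 + k.size
  | .mem e => e.cost m + 1 + (m (e.eval m)).size
  | .op _ e₁ e₂ => e₁.cost m + e₂.cost m + (1 + (e₁.eval m).size) * (1 + (e₂.eval m).size)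

inductive CProg where
  | assign (addr val : Exp)
  | seq (P Q : CProg)
  | ite (e : Exp) (P Q : CProg)
  | loop (e : Exp) (P : CProg)

/-- Execution of a classical program on a memory and a clock. -/
def CProg.run : CProg → Mem × ℕ → Mem × ℕ
  | .assign a e => fun s =>
    (Function.update s.1 (a.eval s.1) (e.eval s.1), s.2 + 1 + a.cost s.1 + e.cost s.1)
  | .seq P Q => fun s => Q.run (P.run s)
  | .ite e P Q => fun s =>
    if e.eval s.1 ≠ 0 then P.run (s.1, s.2 + 1 + e.cost s.1) else Q.run (s.1, s.2 + 1 + e.cost s.1)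
  | .loop e P => fun s =>
    (fun t : Mem × ℕ => P.run (t.1, t.2 + 1))^[e.eval s.1] (s.1, s.2 + 1 + e.cost s.1)

/-! ## Quantum programs with black-box access to an adversary

Besides its classical memory, such a program has quantum registers of its own (register `r` holds
a natural number in superposition, its `j`-th binary digit being a qubit) and it holds the
registers of the adversary, which contain the initial state `|φ₀⟩` at the beginning. It can apply
the adversary's operators `A₁, …, A_q` as black boxes; the oracle queries of the adversary are not
answered unless the program does so itself. -/

/-- Names of quantum registers that can be read coherently: the program's own ones; the control
bit, the parts of the query input (the index, `0` for an instance and `1` for a challenge, the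
instance or challenge itself, the message) and the response register of the adversary;
the adversary's output registers for `x` and for the messages. -/
inductive QReg where
  | own (r : Exp)
  | ctrl | index | kind | link | msg | resp
  | outInst
  | outMsg (j : Exp)

/-- Registers that can be written to. -/
inductive Target where
  | own (r : Exp)
  | resp

inductive Prog where
  /-- a classical computation -/
  | cl (P : CProg)
  | seq (P Q : Prog)
  | ite (e : Exp) (P Q : Prog)
  | loop (e : Exp) (P : Prog)
  /-- store a uniformly random element of `{0, …, e - 1}` at a given address -/
  | sample (addr e : Exp)
  /-- measure the program's own quantum register `r`, and store the outcome -/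
  | measure (addr r : Exp)
  /-- Hadamard gate on qubit `j` of the program's own register `r` -/
  | hadamard (r j : Exp)
  /-- phase gate `diag(1, exp(iπ/4))` on qubit `j` of the program's own register `r` -/
  | phase (r j : Exp)
  /-- run a classical program in superposition: for every basis state, load the values of the
  listed registers into a copy of the memory at the given addresses, run `P` there, and xor the
  resulting content of the cell `res` to the target register -/
  | coherent (loads : List (QReg × Exp)) (P : CProg) (res : Exp) (target : Target)
  /-- apply the adversary's operator `A_{e+1}` -/
  | call (e : Exp)

/-- Basis states of all quantum registers. -/
abbrev Full (n : ℕ) (d : Sizes) : Type := (ℕ →₀ ℕ) × Basis n d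

/-- The configurations of a computation. The vector is not normalized: its squared norm
is the probability of the branch of the computation. -/
structure Conf (n : ℕ) (d : Sizes) where
  mem : Mem
  time : ℕ
  vec : Full n d →₀ ℂ

def QReg.read (m : Mem) (s : Full n d) : QReg → ℕ
  | .own r => s.1 (r.eval m)
  | .ctrl => s.2.1.toNat
  | .index => s.2.2.1.1.val
  | .kind => Sum.elim (fun _ => 0) (fun _ => 1) s.2.2.1.2.1
  | .link => Sum.elim Fin.val Fin.val s.2.2.1.2.1
  | .msg => s.2.2.1.2.2.val
  | .resp => s.2.2.2.1.val
  | .outInst => s.2.2.2.2.1.val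
  | .outMsg j => if h : j.eval m < n then (s.2.2.2.2.2.1 ⟨j.eval m, h⟩).val else 0

/-- The cost of the addresses in the name of a register. -/
def QReg.cost (m : Mem) : QReg → ℕ
  | .own r => r.cost m
  | .outMsg j => j.cost m
  | _ => 1

def Target.cost (m : Mem) : Target → ℕ
  | .own r => r.cost m
  | .resp => 1

def Target.clear (m : Mem) (s : Full n d) : Target → Full n d
  | .own r => (s.1.update (r.eval m) 0, s.2)
  | .resp => (s.1, s.2.1, s.2.2.1, ⟨0, by positivity⟩, s.2.2.2.2)

def Target.xor (m : Mem) (s : Full n d) (v : ℕ) : Target → Full n d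
  | .own r => (s.1.update (r.eval m) (s.1 (r.eval m) ^^^ v), s.2)
  | .resp => (s.1, s.2.1, s.2.2.1, xorResp s.2.2.2.1 v, s.2.2.2.2)

/-- Loading quantum registers into (a copy of) the memory. All addresses refer to the original
memory `m`. -/
def loadAll (m : Mem) (s : Full n d) (loads : List (QReg × Exp)) : Mem × ℕ :=
  loads.foldl (fun t l => (Function.update t.1 (l.2.eval m) (l.1.read m s),
    t.2 + 1 + l.1.cost m + l.2.cost m + (l.1.read m s).size)) (m, 0)

/-- The result and the time of one branch of a coherent evaluation. The computation sees `0`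
in the target register, so that the operation on basis states is an involution. -/
def coherentEval (m : Mem) (loads : List (QReg × Exp)) (P : CProg) (res : Exp) (target : Target)
    (s : Full n d) : ℕ × ℕ :=
  let t := P.run (loadAll m (target.clear m s) loads)
  (t.1 (res.eval m), t.2 + res.cost m + (t.1 (res.eval m)).size)

/-- The linear extension of a map given on basis states. -/
def applyLin (g : Full n d → (Full n d →₀ ℂ)) (ψ : Full n d →₀ ℂ) : Full n d →₀ ℂ :=
  Finsupp.linearCombination ℂ g ψ

/-- `1 ⊗ M`, with `M` acting on the adversary's registers. -/
def applyMatrix (M : Matrix (Basis n d) (Basis n d) ℂ) : (Full n d →₀ ℂ) → (Full n d →₀ ℂ) :=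
  applyLin fun s => ∑ b', Finsupp.single (s.1, b') (M b' s.2)

def applyHadamard (r j : ℕ) : (Full n d →₀ ℂ) → (Full n d →₀ ℂ) :=
  applyLin fun s =>
    Finsupp.single s ((if (s.1 r).testBit j then -1 else 1) / (Real.sqrt 2 : ℂ)) +
    Finsupp.single (s.1.update r (s.1 r ^^^ 2 ^ j), s.2) (1 / (Real.sqrt 2 : ℂ))

def applyPhase (r j : ℕ) : (Full n d →₀ ℂ) → (Full n d →₀ ℂ) :=
  applyLin fun s =>
    Finsupp.single s (if (s.1 r).testBit j then Complex.exp (Complex.I * Real.pi / 4) else 1)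

def normSq (ψ : Full n d →₀ ℂ) : ℝ := ψ.sum fun _ z => ‖z‖ ^ 2

/-- Let time pass. -/
def Conf.tick (s : Conf n d) (t : ℕ) : Conf n d := { s with time := s.time + t }

/-- The execution of a program with black-box access to `A`: the list of all branches. Every
elementary operation costs at least one unit of time, and handling a number or a qubit costs its
bit length or position. -/
def Prog.run (A : Adversary n d q) : Prog → Conf n d → List (Conf n d)
  | .cl P => fun s =>
    [{ s with mem := (P.run (s.mem, s.time)).1, time := (P.run (s.mem, s.time)).2 }]
  | .seq P Q => fun s => (P.run A s).flatMap (Q.run A)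
  | .ite e P Q => fun s =>
    if e.eval s.mem ≠ 0 then P.run A (s.tick (1 + e.cost s.mem))
    else Q.run A (s.tick (1 + e.cost s.mem))
  | .loop e P => fun s =>
    (fun l : List (Conf n d) => l.flatMap fun t => P.run A (t.tick 1))^[e.eval s.mem]
      [s.tick (1 + e.cost s.mem)]
  | .sample a e => fun s =>
    (List.range (max 1 (e.eval s.mem))).map fun k =>
      { mem := Function.update s.mem (a.eval s.mem) k
        time := s.time + 1 + a.cost s.mem + e.cost s.mem
        vec := (1 / (Real.sqrt (max 1 (e.eval s.mem) : ℕ) : ℂ)) • s.vec }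
  | .measure a r => fun s =>
    (s.vec.support.image fun b => b.1 (r.eval s.mem)).toList.map fun k =>
      { mem := Function.update s.mem (a.eval s.mem) k
        time := s.time + 1 + a.cost s.mem + r.cost s.mem + k.size
        vec := s.vec.filter fun b => b.1 (r.eval s.mem) = k }
  | .hadamard r j => fun s =>
    [{ s with
        time := s.time + 1 + r.cost s.mem + j.cost s.mem + j.eval s.mem
        vec := applyHadamard (r.eval s.mem) (j.eval s.mem) s.vec }]
  | .phase r j => fun s =>
    [{ s with
        time := s.time + 1 + r.cost s.mem + j.cost s.mem + j.eval s.mem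
        vec := applyPhase (r.eval s.mem) (j.eval s.mem) s.vec }]
  | .coherent loads P res target => fun s =>
    [{ s with
        time := s.time + 1 + target.cost s.mem +
          s.vec.support.sup fun b => (coherentEval s.mem loads P res target b).2
        vec := applyLin (fun b => Finsupp.single
          (target.xor s.mem b (coherentEval s.mem loads P res target b).1) 1) s.vec }]
  | .call e => fun s =>
    [{ s with
        time := s.time + 1 + e.cost s.mem
        vec := if h : e.eval s.mem < q then applyMatrix (A.op ⟨e.eval s.mem, h⟩) s.vec
          else s.vec }]

/-! ## The interaction of an `(n+1)`-stage program with the verifier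

Memory cells: the numbers `q`, `|𝒳|`, the number of messages, and `|𝒞|` are given in the cells
`0, 1, 2, 3`; the program leaves the instance in cell `4` in its first stage and the next message
in cell `5` in each of its first `n` stages; the next challenge is put into cell `6`. -/

/-- A configuration together with the classical messages sent so far. -/
structure View (n : ℕ) (d : Sizes) where
  conf : Conf n d
  inst : ℕ
  msgs : ℕ → ℕ

/-- The initial configuration; all quantum registers of the program itself are `|0⟩`. -/
def startConf (A : Adversary n d q) : Conf n d where
  mem := fun i => if i = 0 then q else if i = 1 then d.inst else if i = 2 then d.msg
    else if i = 3 then d.chal else 0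
  time := 0
  vec := ∑ b, Finsupp.single (0, b) (A.start b)

/-- All branches after the stages `0, …, k`, when the verifier's challenges are `c`; stage `k + 1`
starts when the challenge `c k` has arrived. -/
def views (A : Adversary n d q) (S : Fin (n + 1) → Prog) (c : Fin n → Fin d.chal) :
    (k : ℕ) → k < n + 1 → List (View n d)
  | 0, h => ((S ⟨0, h⟩).run A (startConf A)).map fun s => ⟨s, s.mem 4, fun _ => s.mem 5⟩
  | k + 1, h => (views A S c k (Nat.lt_of_succ_lt h)).flatMap fun v =>
      ((S ⟨k + 1, h⟩).run A { v.conf with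
        mem := Function.update v.conf.mem 6 (c ⟨k, Nat.lt_of_succ_lt_succ h⟩).val }).map
      fun s => ⟨s, v.inst, Function.update v.msgs (k + 1) (s.mem 5)⟩

/-- All branches of the complete interaction. -/
def finalViews (A : Adversary n d q) (S : Fin (n + 1) → Prog) (c : Fin n → Fin d.chal) :
    List (View n d) :=
  views A S c n (Nat.lt_succ_self n)

/-- The probability that the instance sent by `S^A` is `x` and that the verifier, having sent
uniformly random challenges, accepts. The last message is the content of the register `Z`. -/
def interactProb (A : Adversary n d q) (S : Fin (n + 1) → Prog) (prot : PCIP n d)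
    (x : Fin d.inst) : ℝ :=
  (∑ c : Fin n → Fin d.chal, ((finalViews A S c).map fun v =>
    ∑ a : Fin n → Fin d.msg, if v.inst = x.val ∧ ∀ i : Fin n, v.msgs i.val = (a i).val then
      normSq (applyMatrix (onZ (prot.V x a c)) v.conf.vec) else 0).sum)
  / (d.chal : ℝ) ^ n

/-- The `(n+1)`-stage program `S` runs in time `T` with black-box access to `A`. -/
def RunsInTime (A : Adversary n d q) (S : Fin (n + 1) → Prog) (T : ℕ) : Prop :=
  ∀ c : Fin n → Fin d.chal, ∀ v ∈ finalViews A S c, v.conf.time ≤ T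

end MultiRoundFS

end

/-! The proof is a measure-and-reprogram argument. Fix an output `x`, `a` and challenges `c`. They
determine `n` hash inputs `pt x a c i`, which are distinct because each carries its index, and the
Fiat–Shamir challenges of `x`, `a` under `H` equal `c` exactly if `H` maps each of these points to
the corresponding `c i` (`chain_eq_iff`). A uniform `H` conditioned on this event is distributed
like a uniform `G` reprogrammed at the `n` points. So the forging probability is an average over `c`
and `G`, summed over `a`, of the accepted squared norm in a run with the fully reprogrammed oracle
(`forgeProb_eq`).

A query to the fully reprogrammed oracle is a query to a partially reprogrammed one plus corrections
that live on queries at the missing points (`query_reprog_univ`). Expanding every query in this way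
gives a signed sum of at most `runs q n ≤ (2q + n)^n` states. Each comes from a run in which some
points are measured in some order, and the measured query is answered with the oracle just before or
just after the reprogramming. By Cauchy–Schwarz the accepted squared norm is at most `runs q n`
times the sum over these runs, split into `goodSum` (points in the order `0, 1, …`) and `badSum`
(`nsq_evol_le_goodSum_add_badSum`).

In a bad run the first hit that breaks the order is at a point containing a challenge on which the
state does not yet depend. Averaged over all transcripts this costs a factor `1/|𝒞|` on top of the
cost of guessing the messages (`sum_badSum_le`). A good run can be carried out by the simulator,
since each challenge arrives before it is needed. The simulator guesses the run with random choices
arranged so that every good run is followed with weight at least `n!/(2q + n)^n` (`guessProb_step`,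
`avg_goodSum_le`). Together with the Cauchy–Schwarz factor the loss would be `n!/(2q + n)^(2n)`.

A uniform `G` cannot be sampled efficiently. The simulator uses a polynomial with `2q` random
coefficients modulo `|𝒞| · M`, divided by `M`. Squared norms after `q` queries are sums of functions
of at most `2q` hash values, and each of these is almost fooled by the seed (`abs_seedGap_le`,
`abs_seedGap_goodSum_le`). With `M = quotVal n d q` the resulting error fits into the gap between
`(2q + n)^(2n)` and `(2q + n + 1)^(2n)` (`sum_rawError_le`).

What the simulator achieves is bounded from below by a weakest-precondition calculus (`Above`) that
follows only the branches matching the fixed `x`, `a`. Its running time is polynomial because all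
loops run `q` times and all numbers stay below a fixed length (`Prog.Tame.exists_bound`). -/

noncomputable section
namespace MultiRoundFS
variable {n : ℕ} {d : Sizes} {q : ℕ}

/-! ## Squared norms and contractions -/

/-- The squared norm of a vector. -/
def nsq {ι : Type*} [Fintype ι] (ψ : ι → ℂ) : ℝ := ∑ i, ‖ψ i‖ ^ 2

lemma nsq_nonneg {ι : Type*} [Fintype ι] (ψ : ι → ℂ) : 0 ≤ nsq ψ :=
  Finset.sum_nonneg fun _ _ => by positivity

@[simp] lemma nsq_zero {ι : Type*} [Fintype ι] : nsq (0 : ι → ℂ) = 0 := by simp [nsq]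

lemma nsq_smul {ι : Type*} [Fintype ι] (z : ℂ) (ψ : ι → ℂ) : nsq (z • ψ) = ‖z‖ ^ 2 * nsq ψ := by
  simp [nsq, Finset.mul_sum, mul_pow]

lemma nsq_indicator_le {ι : Type*} [Fintype ι] (s : Set ι) (ψ : ι → ℂ) :
    nsq (s.indicator ψ) ≤ nsq ψ := by
  refine Finset.sum_le_sum fun i _ => ?_
  by_cases h : i ∈ s <;> simp [h]

lemma nsq_eq_dotProduct {ι : Type*} [Fintype ι] (ψ : ι → ℂ) : (nsq ψ : ℂ) = star ψ ⬝ᵥ ψ := by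
  simp only [nsq, dotProduct, Pi.star_apply]
  push_cast
  refine Finset.sum_congr rfl fun i _ => ?_
  rw [RCLike.star_def, Complex.conj_mul']

/-- Matrices of operators of norm at most one. -/
def Contracts {ι : Type*} [Fintype ι] (M : Matrix ι ι ℂ) : Prop := ∀ ψ, nsq (M *ᵥ ψ) ≤ nsq ψ

lemma Contracts.mul {ι : Type*} [Fintype ι] {M N : Matrix ι ι ℂ} (hM : Contracts M)
    (hN : Contracts N) : Contracts (M * N) := fun ψ => by
  rw [← Matrix.mulVec_mulVec]
  exact (hM _).trans (hN _)

lemma contracts_of_unitary {ι : Type*} [Fintype ι] [DecidableEq ι] {U : Matrix ι ι ℂ}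
    (hU : U ∈ Matrix.unitaryGroup ι ℂ) : Contracts U := fun ψ => by
  have h : (nsq (U *ᵥ ψ) : ℂ) = nsq ψ := by
    rw [nsq_eq_dotProduct, nsq_eq_dotProduct, Matrix.star_mulVec, ← Matrix.dotProduct_mulVec,
      Matrix.mulVec_mulVec]
    have : Uᴴ * U = 1 := (Matrix.mem_unitaryGroup_iff').1 hU
    rw [this, Matrix.one_mulVec]
  exact (Complex.ofReal_injective h).le

/-- Pythagoras: `‖Qψ‖² = ⟨ψ, Qψ⟩` for every projection `Q`, so `P` and `1 - P` share the squared
norm of `ψ` between them. -/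
lemma contracts_of_isStarProjection {ι : Type*} [Fintype ι] {P : Matrix ι ι ℂ}
    (hP : IsStarProjection P) : Contracts P := fun ψ => by
  classical
  have key : ∀ Q : Matrix ι ι ℂ, IsStarProjection Q →
      (nsq (Q *ᵥ ψ) : ℂ) = star ψ ⬝ᵥ (Q *ᵥ ψ) := fun Q hQ => by
    rw [nsq_eq_dotProduct, Matrix.star_mulVec, ← Matrix.dotProduct_mulVec, Matrix.mulVec_mulVec]
    have h1 : Qᴴ = Q := hQ.isSelfAdjoint
    have h2 : Q * Q = Q := hQ.isIdempotentElem
    rw [h1, h2]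
  have h : (nsq ψ : ℂ) = nsq (P *ᵥ ψ) + nsq ((1 - P) *ᵥ ψ) := by
    rw [key P hP, key (1 - P) hP.one_sub, Matrix.sub_mulVec, Matrix.one_mulVec, dotProduct_sub,
      nsq_eq_dotProduct]
    ring
  have h' : nsq ψ = nsq (P *ᵥ ψ) + nsq ((1 - P) *ᵥ ψ) := by exact_mod_cast h
  linarith [nsq_nonneg ((1 - P) *ᵥ ψ)]

lemma Adversary.contracts_op (A : Adversary n d q) (i : Fin q) : Contracts (A.op i) := by
  obtain ⟨U, hU, P, hP, h | h⟩ := A.op_spec i <;> rw [h]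
  · exact (contracts_of_unitary hU).mul (contracts_of_isStarProjection hP)
  · exact (contracts_of_isStarProjection hP).mul (contracts_of_unitary hU)

/-- A weighted form of the Cauchy-Schwarz inequality. -/
lemma nsq_sum_le {ι κ : Type*} [Fintype ι] (s : Finset κ) (u : κ → ι → ℂ) (N V : κ → ℝ)
    (hN : ∀ k ∈ s, 0 < N k) (h : ∀ k ∈ s, nsq (u k) ≤ N k * V k) :
    nsq (∑ k ∈ s, u k) ≤ (∑ k ∈ s, N k) * ∑ k ∈ s, V k := by
  by_cases hs : s = ∅
  · subst hs; simp
  have hpos : 0 < ∑ k ∈ s, N k := Finset.sum_pos hN (Finset.nonempty_iff_ne_empty.2 hs)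
  have h1 : ∀ b, ‖(∑ k ∈ s, u k) b‖ ^ 2 ≤ (∑ k ∈ s, N k) * ∑ k ∈ s, ‖u k b‖ ^ 2 / N k := by
    intro b
    have h2 := Finset.sq_sum_div_le_sum_sq_div s (fun k => ‖u k b‖) hN
    rw [div_le_iff₀ hpos] at h2
    rw [Finset.sum_apply, mul_comm]
    exact (pow_le_pow_left₀ (norm_nonneg _) (norm_sum_le _ _) 2).trans h2
  calc nsq (∑ k ∈ s, u k) ≤ ∑ b, (∑ k ∈ s, N k) * ∑ k ∈ s, ‖u k b‖ ^ 2 / N k :=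
        Finset.sum_le_sum fun b _ => h1 b
    _ = (∑ k ∈ s, N k) * ∑ k ∈ s, nsq (u k) / N k := by
        rw [← Finset.mul_sum, Finset.sum_comm]
        simp [nsq, Finset.sum_div]
    _ ≤ _ := by
        refine mul_le_mul_of_nonneg_left (Finset.sum_le_sum fun k hk => ?_) hpos.le
        rw [div_le_iff₀ (hN k hk), mul_comm]
        exact h k hk

lemma nsq_neg {ι : Type*} [Fintype ι] (ψ : ι → ℂ) : nsq (-ψ) = nsq ψ := by simp [nsq]

/-- Shaped after a single query: `u` is the branch without a hit, `p k` and `m k` are the two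
branches that hit the point `k`. The resulting weight `N₀ + 2 |s| N₁` is the recursion of `runs`. -/
lemma nsq_add_sum_sub_le {ι κ : Type*} [Fintype ι] (s : Finset κ) (u : ι → ℂ) (p m : κ → ι → ℂ)
    (N₀ N₁ V₀ : ℝ) (Vp Vm : κ → ℝ) (hN₀ : 0 < N₀) (hN₁ : 0 < N₁) (h₀ : nsq u ≤ N₀ * V₀)
    (hp : ∀ k ∈ s, nsq (p k) ≤ N₁ * Vp k) (hm : ∀ k ∈ s, nsq (m k) ≤ N₁ * Vm k) :
    nsq (u + ∑ k ∈ s, (p k - m k)) ≤ (N₀ + 2 * s.card * N₁) * (V₀ + ∑ k ∈ s, (Vp k + Vm k)) := by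
  -- `none` indexes `u`, and the two copies of `s` index the terms `p k` and `-m k`; squared norms
  -- do not see the sign.
  have := nsq_sum_le (Finset.insertNone (s.disjSum s))
    (fun k => k.elim u (Sum.elim p fun k => -m k)) (fun k => k.elim N₀ fun _ => N₁)
    (fun k => k.elim V₀ (Sum.elim Vp Vm))
    (by intro k _; rcases k with _ | k <;> simpa)
    (by
      intro k hk
      rcases k with _ | k | k
      · simpa using h₀
      · simpa using hp k (by simpa using hk)
      · simpa [nsq_neg] using hm k (by simpa using hk))
  simp only [Finset.sum_insertNone, Finset.sum_disjSum, Option.elim, Sum.elim_inl, Sum.elim_inr,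
    Finset.sum_const, nsmul_eq_mul] at this
  convert this using 2
  · rw [Finset.sum_sub_distrib, Finset.sum_neg_distrib, sub_eq_add_neg]
  · rw [Finset.card_disjSum]; push_cast; ring
  · rw [Finset.sum_add_distrib]

/-! ## Queries -/

lemma xorResp_xorResp (y : Resp d) (v : ℕ) : xorResp (xorResp y v) v = y := by
  apply Fin.ext
  simp only [xorResp]
  rw [Nat.xor_mod_two_pow, Nat.mod_mod, ← Nat.xor_mod_two_pow, Nat.xor_assoc, Nat.xor_self,
    Nat.xor_zero, Nat.mod_eq_of_lt y.isLt]

lemma xorResp_zero (y : Resp d) : xorResp y 0 = y := by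
  apply Fin.ext
  simp [xorResp, Nat.mod_eq_of_lt y.isLt]

lemma queryMap_queryMap (H : Hash n d) (b : Basis n d) : queryMap H (queryMap H b) = b := by
  obtain ⟨c, v, y, w⟩ := b
  cases c <;> simp [queryMap, xorResp_xorResp]

lemma queryMap_involutive (H : Hash n d) : Function.Involutive (queryMap H) := queryMap_queryMap H

/-- The result of a query. -/
def query (H : Hash n d) (ψ : Basis n d → ℂ) : Basis n d → ℂ := fun b => ψ (queryMap H b)

lemma queryMatrix_mulVec (H : Hash n d) (ψ : Basis n d → ℂ) : queryMatrix H *ᵥ ψ = query H ψ := by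
  funext b
  simp only [Matrix.mulVec, dotProduct, queryMatrix, query]
  rw [Finset.sum_eq_single (queryMap H b)]
  · simp [queryMap_queryMap]
  · intro b' _ hb'
    rw [if_neg, zero_mul]
    rintro rfl
    exact hb' (queryMap_queryMap H b').symm
  · simp

lemma nsq_query (H : Hash n d) (ψ : Basis n d → ℂ) : nsq (query H ψ) = nsq ψ :=
  Fintype.sum_equiv (queryMap_involutive H).toPerm _ _ fun _ => rfl

lemma query_add (H : Hash n d) (ψ φ : Basis n d → ℂ) :
    query H (ψ + φ) = query H ψ + query H φ := rfl

lemma query_zero (H : Hash n d) : query H (0 : Basis n d → ℂ) = 0 := rfl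

lemma query_smul (H : Hash n d) (z : ℂ) (ψ : Basis n d → ℂ) :
    query H (z • ψ) = z • query H ψ := rfl

/-- The basis states with a query at `v`. -/
def atPt (v : Dom n d) : Set (Basis n d) := {b | b.1 = true ∧ b.2.1 = v}

/-! ## Reprogramming along a chain of challenges -/

/-- The points `(0, x, a₁)`, `(i - 1, cᵢ₋₁, aᵢ)`. -/
def pt (x : Fin d.inst) (a : Fin n → Fin d.msg) (c : Fin n → Fin d.chal) (i : Fin n) : Dom n d :=
  (i, if i.val = 0 then Sum.inl x else Sum.inr (c ⟨i.val - 1, by omega⟩), a i)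

open Classical in
/-- The hash function `G`, reprogrammed at the points with index in `I`. -/
def reprog (x : Fin d.inst) (a : Fin n → Fin d.msg) (c : Fin n → Fin d.chal) (I : Finset (Fin n))
    (G : Hash n d) : Hash n d :=
  fun w => if w.1 ∈ I ∧ w = pt x a c w.1 then c w.1 else G w

/-- The first `h` indices. -/
def below (n h : ℕ) : Finset (Fin n) := Finset.univ.filter fun i => i.val < h

@[simp] lemma mem_below {h : ℕ} {i : Fin n} : i ∈ below n h ↔ i.val < h := by simp [below]

@[simp] lemma below_zero : below n 0 = ∅ := by ext; simp

lemma below_self : below n n = Finset.univ := by ext; simp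

lemma below_succ {h : ℕ} (hh : h < n) : below n (h + 1) = insert ⟨h, hh⟩ (below n h) := by
  ext i; simp [Fin.ext_iff]; omega

lemma compl_below {h : ℕ} (hh : h < n) :
    (below n h)ᶜ = insert ⟨h, hh⟩ (Finset.univ.filter fun i : Fin n => h < i.val) := by
  ext i; simp [Fin.ext_iff]; omega

lemma card_compl_below (h : ℕ) : (below n h)ᶜ.card = n - h := by
  rw [Finset.card_compl, Fintype.card_fin, below]
  rcases Nat.lt_or_ge h n with hh | hh
  · rw [Fin.card_filter_val_lt]; omega
  · rw [Finset.filter_true_of_mem (fun i _ => by omega)]; simp; omega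

/-- The effect of reprogramming everywhere, decomposed with respect to the point that is queried. -/
lemma query_reprog_univ (x : Fin d.inst) (a : Fin n → Fin d.msg) (c : Fin n → Fin d.chal)
    (I : Finset (Fin n)) (G : Hash n d) (ψ : Basis n d → ℂ) :
    query (reprog x a c Finset.univ G) ψ = query (reprog x a c I G) ψ + ∑ i ∈ Iᶜ,
      (query (reprog x a c (insert i I) G) ((atPt (pt x a c i)).indicator ψ) -
        query (reprog x a c I G) ((atPt (pt x a c i)).indicator ψ)) := by
  funext b
  obtain ⟨k, w, y, r⟩ := b
  simp only [query, Pi.add_apply, Finset.sum_apply, Pi.sub_apply]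
  cases k
  · simp [queryMap, atPt, Set.indicator]
  by_cases h : w.1 ∉ I ∧ w = pt x a c w.1
  · obtain ⟨h1, h2⟩ := h
    rw [Finset.sum_eq_single w.1]
    · have e1 : (atPt (pt x a c w.1)).indicator ψ (queryMap (reprog x a c I G) (true, w, y, r)) =
          ψ (queryMap (reprog x a c I G) (true, w, y, r)) :=
        Set.indicator_of_mem (by simp [atPt, queryMap, ← h2]) _
      have e2 : (atPt (pt x a c w.1)).indicator ψ
          (queryMap (reprog x a c (insert w.1 I) G) (true, w, y, r)) =
          ψ (queryMap (reprog x a c (insert w.1 I) G) (true, w, y, r)) :=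
        Set.indicator_of_mem (by simp [atPt, queryMap, ← h2]) _
      have e3 : reprog x a c Finset.univ G w = reprog x a c (insert w.1 I) G w := by
        simp [reprog]
      rw [e1, e2]
      simp only [queryMap, e3]
      ring
    · intro i _ hi
      have : ∀ H : Hash n d, (atPt (pt x a c i)).indicator ψ (queryMap H (true, w, y, r)) = 0 := by
        intro H
        refine Set.indicator_of_notMem ?_ _
        simp only [atPt, queryMap, Set.mem_ofPred_eq, true_and]
        intro e
        exact hi (by rw [e]; rfl)
      simp [this]
    · intro hw; simp [h1] at hw
  · rw [Finset.sum_eq_zero]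
    · have : reprog x a c Finset.univ G w = reprog x a c I G w := by
        simp only [reprog, Finset.mem_univ, true_and]
        by_cases hI : w.1 ∈ I
        · simp [hI]
        · rw [if_neg (fun e => h ⟨hI, e⟩), if_neg (fun e => hI e.1)]
      simp [queryMap, this]
    · intro i hi
      have : ∀ H : Hash n d, (atPt (pt x a c i)).indicator ψ (queryMap H (true, w, y, r)) = 0 := by
        intro H
        refine Set.indicator_of_notMem ?_ _
        simp only [atPt, queryMap, Set.mem_ofPred_eq, true_and]
        intro e
        have e' : w.1 = i := by rw [e]; rfl
        exact h ⟨by simpa [e'] using hi, by rw [e']; exact e⟩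
      simp [this]

/-! ## Decomposition into runs with measured and reprogrammed queries -/

abbrev AOp (n : ℕ) (d : Sizes) : Type := Matrix (Basis n d) (Basis n d) ℂ

/-- Evolution under alternating queries and operators. -/
def evol (H : Hash n d) : List (AOp n d) → (Basis n d → ℂ) → (Basis n d → ℂ)
  | [], ψ => ψ
  | B :: l, ψ => evol H l (B *ᵥ query H ψ)

lemma evol_add (H : Hash n d) (l : List (AOp n d)) (ψ φ : Basis n d → ℂ) :
    evol H l (ψ + φ) = evol H l ψ + evol H l φ := by
  induction l generalizing ψ φ with
  | nil => rfl
  | cons B l ih => simp [evol, query_add, Matrix.mulVec_add, ih]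

lemma evol_smul (H : Hash n d) (l : List (AOp n d)) (z : ℂ) (ψ : Basis n d → ℂ) :
    evol H l (z • ψ) = z • evol H l ψ := by
  induction l generalizing ψ with
  | nil => rfl
  | cons B l ih => simp [evol, query_smul, Matrix.mulVec_smul, ih]

/-- `evol` as a linear map. -/
def evolLin (H : Hash n d) (l : List (AOp n d)) : (Basis n d → ℂ) →ₗ[ℂ] (Basis n d → ℂ) where
  toFun := evol H l
  map_add' := evol_add H l
  map_smul' := evol_smul H l

/-- The state after a measurement of the query register with outcome `vᵢ` and a query that is
answered with the oracle reprogrammed at the points in `I`. -/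
def hitQuery (x : Fin d.inst) (a : Fin n → Fin d.msg) (c : Fin n → Fin d.chal) (G : Hash n d)
    (I : Finset (Fin n)) (i : Fin n) (ψ : Basis n d → ℂ) : Basis n d → ℂ :=
  query (reprog x a c I G) ((atPt (pt x a c i)).indicator ψ)

/-- The sum of `F` over all final states of runs in which the points outside of `I` are measured
in some order. -/
def allSum (F : (Basis n d → ℂ) → ℝ) (x : Fin d.inst) (a : Fin n → Fin d.msg)
    (c : Fin n → Fin d.chal) (G : Hash n d) :
    List (AOp n d) → Finset (Fin n) → (Basis n d → ℂ) → ℝ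
  | [], _, ψ => F ψ
  | B :: l, I, ψ => allSum F x a c G l I (B *ᵥ query (reprog x a c I G) ψ) +
      ∑ i ∈ Iᶜ, (allSum F x a c G l (insert i I) (B *ᵥ hitQuery x a c G (insert i I) i ψ) +
        allSum F x a c G l (insert i I) (B *ᵥ hitQuery x a c G I i ψ))

/-- The part of `allSum` that comes from runs with measured points in the order `h, h + 1, …`. -/
def goodSum (F : (Basis n d → ℂ) → ℝ) (x : Fin d.inst) (a : Fin n → Fin d.msg)
    (c : Fin n → Fin d.chal) (G : Hash n d) :
    List (AOp n d) → ℕ → (Basis n d → ℂ) → ℝ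
  | [], _, ψ => F ψ
  | B :: l, h, ψ => goodSum F x a c G l h (B *ᵥ query (reprog x a c (below n h) G) ψ) +
      if hh : h < n then
        goodSum F x a c G l (h + 1) (B *ᵥ hitQuery x a c G (below n (h + 1)) ⟨h, hh⟩ ψ) +
        goodSum F x a c G l (h + 1) (B *ᵥ hitQuery x a c G (below n h) ⟨h, hh⟩ ψ)
      else 0

/-- The part of `allSum` that comes from the other runs. -/
def badSum (F : (Basis n d → ℂ) → ℝ) (x : Fin d.inst) (a : Fin n → Fin d.msg)
    (c : Fin n → Fin d.chal) (G : Hash n d) :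
    List (AOp n d) → ℕ → (Basis n d → ℂ) → ℝ
  | [], _, _ => 0
  | B :: l, h, ψ => badSum F x a c G l h (B *ᵥ query (reprog x a c (below n h) G) ψ) +
      (if hh : h < n then
        badSum F x a c G l (h + 1) (B *ᵥ hitQuery x a c G (below n (h + 1)) ⟨h, hh⟩ ψ) +
        badSum F x a c G l (h + 1) (B *ᵥ hitQuery x a c G (below n h) ⟨h, hh⟩ ψ)
      else 0) +
      ∑ i : Fin n with h < i.val,
        (allSum F x a c G l (insert i (below n h))
          (B *ᵥ hitQuery x a c G (insert i (below n h)) i ψ) +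
        allSum F x a c G l (insert i (below n h)) (B *ᵥ hitQuery x a c G (below n h) i ψ))

/-- The number of runs with `r` queries and `k` points. -/
def runs : ℕ → ℕ → ℕ
  | 0, _ => 1
  | r + 1, k => runs r k + 2 * k * runs r (k - 1)

lemma runs_pos (r k : ℕ) : 0 < runs r k := by
  induction r generalizing k with
  | zero => simp [runs]
  | succ r ih => simp only [runs]; have := ih k; omega

/-- These are the first two terms of the binomial expansion. For `y = 2r + n` the choices with and
without a hit at a query fit into `(2(r + 1) + n)^k`; the bound on `runs` and the sampling of the
simulator both rest on this. -/
lemma pow_add_two_mul_le (y k : ℕ) : y ^ k + 2 * k * y ^ (k - 1) ≤ (y + 2) ^ k := by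
  induction k with
  | zero => simp
  | succ k ih =>
    have h : y * (k * y ^ (k - 1)) = k * y ^ k := by
      cases k with
      | zero => simp
      | succ k => simp only [Nat.add_sub_cancel, pow_succ]; ring
    calc y ^ (k + 1) + 2 * (k + 1) * y ^ (k + 1 - 1)
        = y * y ^ k + 2 * (y * (k * y ^ (k - 1))) + 2 * y ^ k := by
          rw [h, Nat.add_sub_cancel, pow_succ]; ring
      _ ≤ (y ^ k + 2 * k * y ^ (k - 1)) * (y + 2) := by nlinarith [Nat.zero_le (k * y ^ (k - 1))]
      _ ≤ _ := by rw [pow_succ]; exact Nat.mul_le_mul_right _ ih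

/-- Any positive offset would do in place of `n` here; the offset `n` is what `guessProb_zero_mono`
needs. -/
lemma runs_le {n : ℕ} (hn : 0 < n) (r k : ℕ) : runs r k ≤ (2 * r + n) ^ k := by
  induction r generalizing k with
  | zero => simpa [runs] using Nat.one_le_pow _ _ hn
  | succ r ih =>
    calc runs (r + 1) k ≤ (2 * r + n) ^ k + 2 * k * (2 * r + n) ^ (k - 1) :=
          Nat.add_le_add (ih k) (Nat.mul_le_mul_left _ (ih _))
      _ ≤ (2 * r + n + 2) ^ k := pow_add_two_mul_le _ _
      _ = _ := by ring_nf

section Decomposition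

variable (P : AOp n d) (x : Fin d.inst) (a : Fin n → Fin d.msg) (c : Fin n → Fin d.chal)
  (G : Hash n d)

/-- The rest of the run is linear, so `query_reprog_univ` passes through it. Only the current query
is expanded; later ones still see the fully reprogrammed oracle. -/
lemma evol_cons_reprog (B : AOp n d) (l : List (AOp n d)) (I : Finset (Fin n))
    (ψ : Basis n d → ℂ) :
    P *ᵥ evol (reprog x a c Finset.univ G) (B :: l) ψ =
      P *ᵥ evol (reprog x a c Finset.univ G) l (B *ᵥ query (reprog x a c I G) ψ) +
      ∑ i ∈ Iᶜ, (P *ᵥ evol (reprog x a c Finset.univ G) l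
          (B *ᵥ hitQuery x a c G (insert i I) i ψ) -
        P *ᵥ evol (reprog x a c Finset.univ G) l (B *ᵥ hitQuery x a c G I i ψ)) := by
  set H := reprog x a c Finset.univ G
  let L : (Basis n d → ℂ) →ₗ[ℂ] (Basis n d → ℂ) := P.mulVecLin ∘ₗ evolLin H l ∘ₗ B.mulVecLin
  have hL : ∀ φ, L φ = P *ᵥ evol H l (B *ᵥ φ) := fun φ => rfl
  simp only [evol, ← hL]
  rw [query_reprog_univ x a c I, map_add, map_sum]
  simp only [map_sub, hitQuery]

/-- Induction over the queries: a hit leaves one point fewer outside `I`, in accordance with the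
argument `k - 1` in `runs`. -/
lemma nsq_evol_le_allSum (l : List (AOp n d)) (I : Finset (Fin n)) (ψ : Basis n d → ℂ) :
    nsq (P *ᵥ evol (reprog x a c Finset.univ G) l ψ) ≤
      runs l.length Iᶜ.card * allSum (fun φ => nsq (P *ᵥ φ)) x a c G l I ψ := by
  induction l generalizing I ψ with
  | nil => simp [evol, allSum, runs]
  | cons B l ih =>
    rw [evol_cons_reprog P x a c G B l I, allSum]
    have hc : ∀ i ∈ Iᶜ, (insert i I)ᶜ.card = Iᶜ.card - 1 := fun i hi => by
      rw [Finset.compl_insert, Finset.card_erase_of_mem hi]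
    refine (nsq_add_sum_sub_le _ _ _ _ _ _ _ _ _ (by exact_mod_cast runs_pos _ _)
      (by exact_mod_cast runs_pos l.length (Iᶜ.card - 1)) (ih I _)
      (fun i hi => hc i hi ▸ ih (insert i I) _) (fun i hi => hc i hi ▸ ih (insert i I) _)).trans ?_
    simp [runs]

/-- While the hits come in order, the induction stays within this statement, with `h` replaced by `h
+ 1`. A hit of a later point breaks the order for good and is handed over to `nsq_evol_le_allSum`.
-/
lemma nsq_evol_le_goodSum_add_badSum (l : List (AOp n d)) (h : ℕ) (ψ : Basis n d → ℂ) :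
    nsq (P *ᵥ evol (reprog x a c Finset.univ G) l ψ) ≤
      runs l.length (n - h) * (goodSum (fun φ => nsq (P *ᵥ φ)) x a c G l h ψ +
        badSum (fun φ => nsq (P *ᵥ φ)) x a c G l h ψ) := by
  induction l generalizing h ψ with
  | nil => simp [evol, goodSum, badSum, runs]
  | cons B l ih =>
    rw [evol_cons_reprog P x a c G B l (below n h), goodSum, badSum]
    have hc : ∀ i ∈ (below n h)ᶜ, (insert i (below n h))ᶜ.card = n - h - 1 := fun i hi => by
      rw [Finset.compl_insert, Finset.card_erase_of_mem hi, card_compl_below]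
    set F := fun φ : Basis n d → ℂ => nsq (P *ᵥ φ)
    -- The share of the runs whose current query hits the point `i` and is answered with the oracle
    -- reprogrammed at `J`; below, `J` is the set of the first `h` indices with or without `i`.
    let V : Finset (Fin n) → Fin n → ℝ := fun J i =>
      if i.val = h then goodSum F x a c G l (h + 1) (B *ᵥ hitQuery x a c G J i ψ) +
        badSum F x a c G l (h + 1) (B *ᵥ hitQuery x a c G J i ψ)
      else allSum F x a c G l (insert i (below n h)) (B *ᵥ hitQuery x a c G J i ψ)
    have hV : ∀ J, ∀ i ∈ (below n h)ᶜ, nsq (P *ᵥ evol (reprog x a c Finset.univ G) l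
        (B *ᵥ hitQuery x a c G J i ψ)) ≤ runs l.length (n - h - 1) * V J i := by
      intro J i hi
      by_cases hih : i.val = h
      · simp only [V, hih, if_true]
        exact ih (h + 1) _
      · simp only [V, hih, if_false]
        rw [← hc i hi]
        exact nsq_evol_le_allSum P x a c G l _ _
    refine (nsq_add_sum_sub_le _ _ _ _ _ _ _ (fun i => V (insert i (below n h)) i)
      (fun i => V (below n h) i) (by exact_mod_cast runs_pos _ _)
      (by exact_mod_cast runs_pos l.length (n - h - 1)) (ih h _)
      (fun i hi => hV _ i hi) (fun i hi => hV _ i hi)).trans (le_of_eq ?_)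
    rw [card_compl_below, List.length_cons, runs]
    push_cast
    congr 1
    by_cases hh : h < n
    · rw [compl_below hh, Finset.sum_insert (by simp)]
      have e : ∀ i ∈ Finset.univ.filter fun i : Fin n => h < i.val,
          V (insert i (below n h)) i + V (below n h) i =
          allSum F x a c G l (insert i (below n h))
            (B *ᵥ hitQuery x a c G (insert i (below n h)) i ψ) +
          allSum F x a c G l (insert i (below n h)) (B *ᵥ hitQuery x a c G (below n h) i ψ) := by
        intro i hi
        have : i.val ≠ h := by simp at hi; omega
        simp [V, this]
      rw [Finset.sum_congr rfl e]
      simp only [V, hh, dif_pos, if_true, below_succ hh]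
      ring
    · have e1 : (below n h)ᶜ = ∅ := by ext i; simp; omega
      have e2 : (Finset.univ.filter fun i : Fin n => h < i.val) = ∅ := by ext i; simp; omega
      rw [e1, e2]
      simp only [hh, dif_neg, not_false_iff, Finset.sum_empty]
      ring

end Decomposition

/-! ### Monotonicity, positivity and homogeneity of the sums over runs -/

section Monotone

variable {F F' : (Basis n d → ℂ) → ℝ} (x : Fin d.inst) (a : Fin n → Fin d.msg)
  (c : Fin n → Fin d.chal) (G : Hash n d)

lemma allSum_mono (hF : ∀ ψ, F ψ ≤ F' ψ) (l : List (AOp n d)) (I : Finset (Fin n))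
    (ψ : Basis n d → ℂ) : allSum F x a c G l I ψ ≤ allSum F' x a c G l I ψ := by
  induction l generalizing I ψ with
  | nil => exact hF ψ
  | cons B l ih =>
    exact add_le_add (ih _ _) (Finset.sum_le_sum fun i _ => add_le_add (ih _ _) (ih _ _))

lemma badSum_mono (hF : ∀ ψ, F ψ ≤ F' ψ) (l : List (AOp n d)) (h : ℕ) (ψ : Basis n d → ℂ) :
    badSum F x a c G l h ψ ≤ badSum F' x a c G l h ψ := by
  induction l generalizing h ψ with
  | nil => exact le_rfl
  | cons B l ih =>
    refine add_le_add (add_le_add (ih _ _) ?_) (Finset.sum_le_sum fun i _ =>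
      add_le_add (allSum_mono x a c G hF _ _ _) (allSum_mono x a c G hF _ _ _))
    split_ifs
    · exact add_le_add (ih _ _) (ih _ _)
    · exact le_rfl

lemma allSum_zero (F : (Basis n d → ℂ) → ℝ) (hF : F = fun _ => 0) (l : List (AOp n d))
    (I : Finset (Fin n)) (ψ : Basis n d → ℂ) : allSum F x a c G l I ψ = 0 := by
  induction l generalizing I ψ with
  | nil => simp [allSum, hF]
  | cons B l ih => simp [allSum, ih]

/-- Positivity is monotonicity, applied to the zero functional. -/
lemma badSum_nonneg (hF : ∀ ψ, 0 ≤ F ψ) (l : List (AOp n d)) (h : ℕ) (ψ : Basis n d → ℂ) :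
    0 ≤ badSum F x a c G l h ψ := by
  have key : ∀ (l : List (AOp n d)) (h : ℕ) (ψ : Basis n d → ℂ),
      badSum (fun _ => 0) x a c G l h ψ = 0 := by
    intro l
    induction l with
    | nil => intros; rfl
    | cons B l ih => intro h ψ; simp [badSum, ih, allSum_zero x a c G (fun _ => 0) rfl]
  rw [← key l h ψ]
  exact badSum_mono x a c G hF l h ψ

lemma goodSum_nonneg (hF : ∀ ψ, 0 ≤ F ψ) (l : List (AOp n d)) (h : ℕ) (ψ : Basis n d → ℂ) :
    0 ≤ goodSum F x a c G l h ψ := by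
  induction l generalizing h ψ with
  | nil => exact hF ψ
  | cons B l ih =>
    refine add_nonneg (ih _ _) ?_
    split_ifs
    · exact add_nonneg (ih _ _) (ih _ _)
    · exact le_rfl

lemma goodSum_zero (hF : F 0 = 0) (l : List (AOp n d)) (h : ℕ) :
    goodSum F x a c G l h 0 = 0 := by
  induction l generalizing h with
  | nil => exact hF
  | cons B l ih => simp [goodSum, hitQuery, query_zero, ih]

/-- Turns the amplitude `1/√E` of a branch of a uniform sample into the probability `1/E`. -/
lemma goodSum_smul (hF : ∀ (z : ℂ) ψ, F (z • ψ) = ‖z‖ ^ 2 * F ψ) (l : List (AOp n d)) (h : ℕ) (z : ℂ)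
    (ψ : Basis n d → ℂ) : goodSum F x a c G l h (z • ψ) = ‖z‖ ^ 2 * goodSum F x a c G l h ψ := by
  induction l generalizing h ψ with
  | nil => exact hF z ψ
  | cons B l ih =>
    have hq : ∀ I i, hitQuery x a c G I i (z • ψ) = z • hitQuery x a c G I i ψ := fun I i => by
      rw [hitQuery, hitQuery, ← query_smul]
      congr 1
      funext b
      by_cases hb : b ∈ atPt (pt x a c i) <;> simp [hb]
    simp only [goodSum, query_smul, Matrix.mulVec_smul, ih, hq]
    split_ifs <;> ring

end Monotone

end MultiRoundFS
end

noncomputable section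
namespace MultiRoundFS
variable {n : ℕ} {d : Sizes} {q : ℕ}

/-! ## Runs that hit the points in a wrong order -/

/-- Instances, messages and challenges. -/
abbrev Transcript (n : ℕ) (d : Sizes) : Type :=
  Fin d.inst × (Fin n → Fin d.msg) × (Fin n → Fin d.chal)

/-- Replace the `i`-th message, and the instance if `i = 0`. -/
def setMsg (i : Fin n) (y : Fin d.inst × Fin d.msg) (ω : Transcript n d) : Transcript n d :=
  (if i.val = 0 then y.1 else ω.1, Function.update ω.2.1 i y.2, ω.2.2)

/-- Replace the `j`-th challenge. -/
def setChal (j : Fin n) (z : Fin d.chal) (ω : Transcript n d) : Transcript n d :=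
  (ω.1, ω.2.1, Function.update ω.2.2 j z)

/-- Exchanging `a i` with the fresh value `y` is an involution of the pairs `(a, y)`. -/
lemma sum_update {ι α : Type*} [Fintype ι] [DecidableEq ι] [Fintype α] (i : ι)
    (f : (ι → α) → ℝ) :
    ∑ a : ι → α, ∑ y, f (Function.update a i y) = Fintype.card α * ∑ a, f a := by
  have hinv : Function.Involutive fun p : (ι → α) × α => (Function.update p.1 i p.2, p.1 i) := by
    rintro ⟨a, y⟩; simp
  rw [← Fintype.sum_prod_type' (f := fun a y => f (Function.update a i y)),
    Fintype.sum_equiv hinv.toPerm (fun p => f (Function.update p.1 i p.2)) (fun p => f p.1)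
      (fun _ => rfl), Fintype.sum_prod_type]
  simp [Finset.mul_sum]

/-- The fresh value always includes an instance, used only if `i = 0`. This makes the factor the
same for all `i` and explains the form of `msgWeight`. -/
lemma sum_setMsg (i : Fin n) (f : Transcript n d → ℝ) :
    ∑ ω, ∑ y, f (setMsg i y ω) = (d.inst * d.msg : ℝ) * ∑ ω, f ω := by
  by_cases hi : i.val = 0
  · simp only [setMsg, hi, if_true, Fintype.sum_prod_type]
    have : ∀ x' : Fin d.inst, ∑ a : Fin n → Fin d.msg, ∑ c : Fin n → Fin d.chal,
        ∑ y, f (x', Function.update a i y, c) = d.msg * ∑ a, ∑ c, f (x', a, c) := fun x' => by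
      simp_rw [Finset.sum_comm (s := (Finset.univ : Finset (Fin n → Fin d.chal)))
        (t := (Finset.univ : Finset (Fin d.msg)))]
      rw [sum_update i fun a => ∑ c, f (x', a, c), Fintype.card_fin]
    calc _ = ∑ _x : Fin d.inst, ∑ x' : Fin d.inst, ∑ a : Fin n → Fin d.msg,
          ∑ c : Fin n → Fin d.chal, ∑ y, f (x', Function.update a i y, c) := by
          refine Finset.sum_congr rfl fun x _ => ?_
          simp_rw [Finset.sum_comm (s := (Finset.univ : Finset (Fin n → Fin d.chal)))
            (t := (Finset.univ : Finset (Fin d.inst)))]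
          rw [Finset.sum_comm]
      _ = _ := by
          simp_rw [this]
          simp [Finset.mul_sum, mul_assoc]
  · simp only [setMsg, hi, if_false, Fintype.sum_prod_type]
    simp only [Finset.sum_const, Finset.card_univ, Fintype.card_fin, nsmul_eq_mul,
      ← Finset.mul_sum]
    rw [mul_assoc, Finset.mul_sum (a := (d.msg : ℝ))]
    congr 1
    refine Finset.sum_congr rfl fun x _ => ?_
    simp_rw [Finset.sum_comm (s := (Finset.univ : Finset (Fin n → Fin d.chal)))
      (t := (Finset.univ : Finset (Fin d.msg)))]
    rw [sum_update i fun a => ∑ c, f (x, a, c), Fintype.card_fin]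

lemma sum_setChal (j : Fin n) (f : Transcript n d → ℝ) :
    ∑ ω, ∑ z, f (setChal j z ω) = (d.chal : ℝ) * ∑ ω, f ω := by
  simp only [setChal, Fintype.sum_prod_type, Finset.mul_sum]
  refine Finset.sum_congr rfl fun x _ => Finset.sum_congr rfl fun a _ => ?_
  rw [sum_update j fun c => f (x, a, c), Fintype.card_fin, Finset.mul_sum]

/-- If resampling part of `ω` does not affect `φ`, and changes the event `E ω` so that each basis
state is rarely hit, then the event has small probability. -/
lemma sum_nsq_indicator_le {Ω Y : Type*} [Fintype Ω] [Fintype Y] {ι : Type*} [Fintype ι]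
    (σ : Y → Ω → Ω) (K m : ℝ) (hK : 0 < K)
    (hσ : ∀ f : Ω → ℝ, ∑ ω, ∑ y, f (σ y ω) = K * ∑ ω, f ω) (φ : Ω → ι → ℂ)
    (hφ : ∀ y ω, φ (σ y ω) = φ ω) (E : Ω → Set ι)
    (hE : ∀ ω b, ∑ y, (E (σ y ω)).indicator (fun _ => (1 : ℝ)) b ≤ m) :
    ∑ ω, nsq ((E ω).indicator (φ ω)) ≤ m / K * ∑ ω, nsq (φ ω) := by
  -- Resampling multiplies the sum over `ω` by `K` and leaves `φ` alone. For fixed `ω` and `b` it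
  -- remains to count the `y` for which `b` lies in the resampled event.
  rw [div_mul_eq_mul_div, le_div_iff₀ hK, mul_comm, ← hσ, Finset.mul_sum]
  refine Finset.sum_le_sum fun ω _ => ?_
  simp only [nsq, hφ]
  rw [Finset.sum_comm, Finset.mul_sum]
  refine Finset.sum_le_sum fun b _ => ?_
  calc ∑ y, ‖(E (σ y ω)).indicator (φ ω) b‖ ^ 2
      = (∑ y, (E (σ y ω)).indicator (fun _ => (1 : ℝ)) b) * ‖φ ω b‖ ^ 2 := by
        rw [Finset.sum_mul]
        refine Finset.sum_congr rfl fun y _ => ?_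
        by_cases hb : b ∈ E (σ y ω) <;> simp [hb]
    _ ≤ _ := mul_le_mul_of_nonneg_right (hE ω b) (by positivity)

/-- The inverse number of possible values of the `i`-th message (with the instance if `i = 0`). -/
def msgWeight (d : Sizes) (i : Fin n) : ℝ := (if i.val = 0 then 1 else d.inst) / (d.inst * d.msg)

lemma msgWeight_nonneg (i : Fin n) : 0 ≤ msgWeight d i := by
  unfold msgWeight; split_ifs <;> positivity

/-- The event is determined by the `i`-th message (with the instance if `i = 0`). -/
def Separates {ι : Type*} (i : Fin n) (E : Transcript n d → Set ι) : Prop :=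
  ∀ ω b y y', b ∈ E (setMsg i y ω) → b ∈ E (setMsg i y' ω) → y.2 = y'.2 ∧ (i.val = 0 → y.1 = y'.1)

open Classical in
-- For `i = 0` the event determines the whole fresh value; otherwise it determines the message only,
-- and the idle instance component is free.
lemma Separates.sum_le {ι : Type*} {i : Fin n} {E : Transcript n d → Set ι} (hE : Separates i E)
    (ω : Transcript n d) (b : ι) :
    ∑ y, (E (setMsg i y ω)).indicator (fun _ => (1 : ℝ)) b ≤
      if i.val = 0 then 1 else d.inst := by
  have h1 : ∑ y, (E (setMsg i y ω)).indicator (fun _ => (1 : ℝ)) b =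
      ((Finset.univ.filter fun y => b ∈ E (setMsg i y ω)).card : ℝ) := by
    rw [Finset.card_filter]
    push_cast
    exact Finset.sum_congr rfl fun y _ => by simp [Set.indicator_apply]
  rw [h1]
  split_ifs with hi
  · norm_cast
    rw [Finset.card_le_one]
    intro y hy y' hy'
    simp only [Finset.mem_filter, Finset.mem_univ, true_and] at hy hy'
    obtain ⟨e1, e2⟩ := hE ω b y y' hy hy'
    exact Prod.ext (e2 hi) e1
  · norm_cast
    calc _ ≤ (Finset.univ : Finset (Fin d.inst)).card :=
          Finset.card_le_card_of_injOn Prod.fst (fun _ _ => Finset.mem_coe.2 (Finset.mem_univ _))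
            fun y hy y' hy' e => by
              simp only [Finset.coe_filter, Finset.mem_univ, true_and, Set.mem_ofPred_eq] at hy hy'
              exact Prod.ext e (hE ω b y y' hy hy').1
      _ = _ := by simp

section

variable (hX : 0 < d.inst) (hM : 0 < d.msg) (hC : 0 < d.chal)
include hX hM

lemma sum_nsq_indicator_separates_le {ι : Type*} [Fintype ι] {i : Fin n}
    {E : Transcript n d → Set ι} (hE : Separates i E) (φ : Transcript n d → ι → ℂ)
    (hφ : ∀ y ω, φ (setMsg i y ω) = φ ω) :
    ∑ ω, nsq ((E ω).indicator (φ ω)) ≤ msgWeight d i * ∑ ω, nsq (φ ω) :=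
  sum_nsq_indicator_le (setMsg i) _ _ (by positivity) (sum_setMsg i) φ hφ E hE.sum_le

/-- The messages in `J` are independent of `φ`, and of the events with the other indices, so the
guesses can be charged one after the other. Applied to points that are never queried and are read
off the output. -/
lemma msgWeight_prod_aux {ι : Type*} [Fintype ι] (E : Fin n → Transcript n d → Set ι)
    (hE : ∀ i, Separates i (E i)) (hE' : ∀ i j y ω, i ≠ j → E i (setMsg j y ω) = E i ω)
    (J : Finset (Fin n)) (φ : Transcript n d → ι → ℂ)
    (hφ : ∀ i ∈ J, ∀ y ω, φ (setMsg i y ω) = φ ω) :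
    ∑ ω, nsq ({b | ∀ i ∈ J, b ∈ E i ω}.indicator (φ ω)) ≤
      (∏ i ∈ J, msgWeight d i) * ∑ ω, nsq (φ ω) := by
  classical
  induction J using Finset.induction_on with
  | empty => simp
  | insert i J hi ih =>
    rw [Finset.prod_insert hi, mul_assoc]
    have e : ∀ ω, {b | ∀ k ∈ insert i J, b ∈ E k ω}.indicator (φ ω) =
        (E i ω).indicator ({b | ∀ k ∈ J, b ∈ E k ω}.indicator (φ ω)) := fun ω => by
      rw [Set.indicator_indicator]
      congr 1
      ext b; simp
    simp_rw [e]
    refine (sum_nsq_indicator_separates_le hX hM (hE i)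
      (fun ω => {b | ∀ k ∈ J, b ∈ E k ω}.indicator (φ ω)) ?_).trans
      (mul_le_mul_of_nonneg_left (ih fun k hk => hφ k (Finset.mem_insert_of_mem hk))
        (msgWeight_nonneg i))
    intro y ω
    have : {b | ∀ k ∈ J, b ∈ E k (setMsg i y ω)} = {b | ∀ k ∈ J, b ∈ E k ω} := by
      ext b
      refine forall₂_congr fun k hk => ?_
      rw [hE' k i y ω (by rintro rfl; exact hi hk)]
    simp only [this, hφ i (Finset.mem_insert_self _ _)]

end

/-- The basis states with output `x`, `a`. -/
def outEvent (x : Fin d.inst) (a : Fin n → Fin d.msg) : Set (Basis n d) :=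
  {b | b.2.2.2.1 = x ∧ b.2.2.2.2.1 = a}

/-- The basis states with output `aᵢ` (and `x` if `i = 0`). -/
def outPart (i : Fin n) (ω : Transcript n d) : Set (Basis n d) :=
  {b | b.2.2.2.2.1 i = ω.2.1 i ∧ (i.val = 0 → b.2.2.2.1 = ω.1)}

lemma separates_outPart (i : Fin n) : Separates i (outPart (d := d) i) := by
  intro ω b y y' h h'
  simp only [outPart, setMsg, Set.mem_ofPred_eq, Function.update_self] at h h'
  exact ⟨h.1.symm.trans h'.1, fun hi => by
    have h1 := h.2 hi; have h2 := h'.2 hi; rw [if_pos hi] at h1 h2; exact h1.symm.trans h2⟩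

lemma outPart_setMsg (i j : Fin n) (y) (ω : Transcript n d) (h : i ≠ j) :
    outPart i (setMsg j y ω) = outPart i ω := by
  ext b
  simp only [outPart, setMsg, Set.mem_ofPred_eq, Function.update_of_ne h]
  refine and_congr_right fun _ => ?_
  by_cases hi : i.val = 0
  · rw [if_neg fun hj => h (Fin.ext (hi.trans hj.symm))]
  · simp [hi]

/-- The point with index `i` of a transcript. -/
def tpt (ω : Transcript n d) (i : Fin n) : Dom n d := pt ω.1 ω.2.1 ω.2.2 i

lemma separates_atPt (i : Fin n) :
    Separates i fun ω : Transcript n d => atPt (tpt ω i) := by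
  intro ω b y y' h h'
  have e : tpt (setMsg i y ω) i = tpt (setMsg i y' ω) i := h.2.symm.trans h'.2
  simp only [tpt, pt, setMsg, Function.update_self, Prod.mk.injEq, true_and] at e
  refine ⟨e.2, fun hi => ?_⟩
  simpa [hi] using e.1

lemma tpt_setMsg (i j : Fin n) (y) (ω : Transcript n d) (h : i ≠ j) :
    tpt (setMsg j y ω) i = tpt ω i := by
  simp only [tpt, pt, setMsg, Function.update_of_ne h]
  by_cases hi : i.val = 0
  · have hj : j.val ≠ 0 := fun hj => h (Fin.ext (hi.trans hj.symm))
    simp [hj]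
  · simp [hi]

/-- The point `i` contains the challenge with index `i - 1` and no other. -/
lemma tpt_setChal (i j : Fin n) (z) (ω : Transcript n d) (h : i.val ≠ j.val + 1) :
    tpt (setChal j z ω) i = tpt ω i := by
  simp only [tpt, pt, setChal]
  by_cases hi : i.val = 0
  · simp [hi]
  · rw [Function.update_of_ne]
    intro e
    have := congrArg Fin.val e
    simp at this
    omega

/-- Reprogramming along a transcript. -/
def trep (ω : Transcript n d) (I : Finset (Fin n)) (G : Hash n d) : Hash n d :=
  reprog ω.1 ω.2.1 ω.2.2 I G

lemma trep_setMsg (I : Finset (Fin n)) (G : Hash n d) (j : Fin n) (y) (ω : Transcript n d)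
    (hj : j ∉ I) : trep (setMsg j y ω) I G = trep ω I G := by
  funext w
  have h := tpt_setMsg w.1 j y ω
  simp only [tpt] at h
  simp only [trep, reprog]
  by_cases hw : w.1 ∈ I
  · rw [h (by rintro rfl; exact hj hw)]; rfl
  · simp [hw]

/-- The `j`-th challenge enters the reprogrammed oracle in two ways: as the new value at the point
`j` and as part of the location of the point `j + 1`. -/
lemma trep_setChal (I : Finset (Fin n)) (G : Hash n d) (j : Fin n) (z) (ω : Transcript n d)
    (hj : j ∉ I) (hj' : ∀ i ∈ I, i.val ≠ j.val + 1) :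
    trep (setChal j z ω) I G = trep ω I G := by
  funext w
  have h := tpt_setChal w.1 j z ω
  simp only [tpt] at h
  simp only [trep, reprog]
  by_cases hw : w.1 ∈ I
  · have : (setChal j z ω).2.2 w.1 = ω.2.2 w.1 :=
      Function.update_of_ne (by rintro e; exact hj (e ▸ hw)) _ _
    rw [h (hj' _ hw), this]
  · simp [hw]

/-- Source of the factor `1/|𝒞|`: for `i ≠ 0` a query at the point `i` determines the preceding
challenge as well as the message, and only the idle instance component is left free. -/
lemma sum_indicator_atPt_le {i : Fin n} (hi : i.val ≠ 0) (ω : Transcript n d) (b : Basis n d) :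
    ∑ y : Fin d.chal × (Fin d.inst × Fin d.msg),
      (atPt (tpt (setMsg i y.2 (setChal ⟨i.val - 1, by omega⟩ y.1 ω)) i)).indicator
        (fun _ => (1 : ℝ)) b ≤ d.inst := by
  classical
  have h1 : ∀ y : Fin d.chal × (Fin d.inst × Fin d.msg),
      tpt (setMsg i y.2 (setChal ⟨i.val - 1, by omega⟩ y.1 ω)) i = (i, Sum.inr y.1, y.2.2) := by
    intro y
    simp [tpt, pt, setMsg, setChal, hi]
  simp only [h1, Set.indicator_apply]
  rw [Finset.sum_boole]
  norm_cast
  calc _ ≤ (Finset.univ : Finset (Fin d.inst)).card :=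
        Finset.card_le_card_of_injOn (fun y => y.2.1)
          (fun _ _ => Finset.mem_coe.2 (Finset.mem_univ _)) fun y hy y' hy' e => by
            replace hy := Finset.mem_filter_univ _ |>.1 (Finset.mem_coe.1 hy)
            replace hy' := Finset.mem_filter_univ _ |>.1 (Finset.mem_coe.1 hy')
            have h2 := hy.2.symm.trans hy'.2
            simp only [Prod.mk.injEq, true_and, Sum.inr.injEq] at h2
            exact Prod.ext h2.1 (Prod.ext e h2.2)
    _ = _ := by simp

/-! ### The weight of the runs, summed over all transcripts -/

section Bounds

variable (hX : 0 < d.inst) (hM : 0 < d.msg) (G : Hash n d)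
include hX hM

/-- Each point outside `I` costs its `msgWeight`, whether a query hits it or it is found in the
final output, because the state does not depend on its message before that. The order of the hits
plays no role. -/
lemma sum_allSum_le (l : List (AOp n d)) (hl : ∀ B ∈ l, Contracts B) (I : Finset (Fin n))
    (ψ : Transcript n d → Basis n d → ℂ)
    (hψ : ∀ i ∉ I, ∀ y ω, ψ (setMsg i y ω) = ψ ω) :
    ∑ ω, allSum (fun φ => nsq ((outEvent ω.1 ω.2.1).indicator φ)) ω.1 ω.2.1 ω.2.2 G l I (ψ ω) ≤
      runs l.length Iᶜ.card * ((∏ i ∈ Iᶜ, msgWeight d i) * ∑ ω, nsq (ψ ω)) := by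
  classical
  induction l generalizing I ψ with
  | nil =>
    simp only [allSum, List.length_nil, runs, Nat.cast_one, one_mul]
    refine le_trans (Finset.sum_le_sum fun ω _ => ?_)
      (msgWeight_prod_aux hX hM outPart separates_outPart outPart_setMsg Iᶜ ψ
        fun i hi => hψ i (by simpa using hi))
    refine Finset.sum_le_sum fun b _ => ?_
    by_cases hb : b ∈ outEvent ω.1 ω.2.1
    -- Discarding the part of the output that belongs to `I` only enlarges the event.
    · have : b ∈ {b | ∀ i ∈ Iᶜ, b ∈ outPart i ω} := fun i _ => ⟨by rw [hb.2], fun _ => hb.1⟩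
      rw [Set.indicator_of_mem hb, Set.indicator_of_mem this]
    · rw [Set.indicator_of_notMem hb]; simp
  | cons B l ih =>
    have hB := hl B (by simp)
    have hl' : ∀ B ∈ l, Contracts B := fun B' h => hl B' (by simp [h])
    set K := ∏ i ∈ Iᶜ, msgWeight d i
    set S := ∑ ω, nsq (ψ ω)
    have hK : 0 ≤ K := Finset.prod_nonneg fun i _ => msgWeight_nonneg i
    simp only [allSum, Finset.sum_add_distrib]
    have h0 : ∑ ω, allSum (fun φ => nsq ((outEvent ω.1 ω.2.1).indicator φ)) ω.1 ω.2.1 ω.2.2 G l I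
        (B *ᵥ query (reprog ω.1 ω.2.1 ω.2.2 I G) (ψ ω)) ≤ runs l.length Iᶜ.card * (K * S) := by
      refine (ih hl' I (fun ω => B *ᵥ query (trep ω I G) (ψ ω)) fun i hi y ω => by
        simp only [trep_setMsg I G i y ω hi, hψ i hi]).trans ?_
      refine mul_le_mul_of_nonneg_left (mul_le_mul_of_nonneg_left
        (Finset.sum_le_sum fun ω _ => (hB _).trans (nsq_query _ _).le) hK) (by positivity)
    have h1 : ∀ i ∈ Iᶜ, ∀ J ⊆ insert i I, ∑ ω, allSum
        (fun φ => nsq ((outEvent ω.1 ω.2.1).indicator φ)) ω.1 ω.2.1 ω.2.2 G l (insert i I)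
        (B *ᵥ hitQuery ω.1 ω.2.1 ω.2.2 G J i (ψ ω)) ≤
        runs l.length (Iᶜ.card - 1) * (K * S) := by
      intro i hi J hJ
      have hi' : i ∉ I := by simpa using hi
      have hc : (insert i I)ᶜ = Iᶜ.erase i := Finset.compl_insert
      refine (ih hl' (insert i I)
        (fun ω => B *ᵥ query (trep ω J G) ((atPt (tpt ω i)).indicator (ψ ω)))
        fun k hk y ω => ?_).trans ?_
      · have hk1 : i ≠ k := fun e => hk (by simp [e])
        have hk2 : k ∉ I := fun e => hk (by simp [e])
        simp only [trep_setMsg J G k y ω (fun e => hk (hJ e)), tpt_setMsg i k y ω hk1, hψ k hk2]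
      · rw [hc, Finset.card_erase_of_mem hi]
        refine mul_le_mul_of_nonneg_left ?_ (by positivity)
        have hK' : 0 ≤ ∏ k ∈ Iᶜ.erase i, msgWeight d k :=
          Finset.prod_nonneg fun i _ => msgWeight_nonneg i
        calc _ ≤ (∏ k ∈ Iᶜ.erase i, msgWeight d k) *
              ∑ ω, nsq ((atPt (tpt ω i)).indicator (ψ ω)) :=
              mul_le_mul_of_nonneg_left
                (Finset.sum_le_sum fun ω _ => (hB _).trans (nsq_query _ _).le) hK'
          _ ≤ (∏ k ∈ Iᶜ.erase i, msgWeight d k) * (msgWeight d i * S) :=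
              mul_le_mul_of_nonneg_left (sum_nsq_indicator_separates_le hX hM
                (separates_atPt i) ψ (hψ i hi')) hK'
          _ = K * S := by rw [← mul_assoc, Finset.prod_erase_mul _ _ hi]
    have h2 : ∑ ω : Transcript n d, ∑ i ∈ Iᶜ,
        (allSum (fun φ => nsq ((outEvent ω.1 ω.2.1).indicator φ)) ω.1 ω.2.1 ω.2.2 G l (insert i I)
          (B *ᵥ hitQuery ω.1 ω.2.1 ω.2.2 G (insert i I) i (ψ ω)) +
        allSum (fun φ => nsq ((outEvent ω.1 ω.2.1).indicator φ)) ω.1 ω.2.1 ω.2.2 G l (insert i I)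
          (B *ᵥ hitQuery ω.1 ω.2.1 ω.2.2 G I i (ψ ω))) ≤
        ∑ _i ∈ Iᶜ, 2 * (runs l.length (Iᶜ.card - 1) * (K * S)) := by
      rw [Finset.sum_comm]
      refine Finset.sum_le_sum fun i hi => ?_
      rw [Finset.sum_add_distrib, two_mul]
      exact add_le_add (h1 i hi _ le_rfl) (h1 i hi _ (Finset.subset_insert _ _))
    simp only [Finset.sum_add_distrib] at h2
    refine (add_le_add h0 h2).trans (le_of_eq ?_)
    simp only [Finset.sum_const, nsmul_eq_mul, List.length_cons, runs]
    push_cast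
    ring

/-- As long as the hits are in order, the state depends only on the messages and challenges of the
points already hit. The first hit out of order is at some `i > h` and has to guess the message `i`
and also the challenge `i - 1`. What follows is estimated by `sum_allSum_le`, which no longer needs
independence of the challenges. -/
lemma sum_badSum_le (hC : 0 < d.chal) (l : List (AOp n d)) (hl : ∀ B ∈ l, Contracts B) (h : ℕ)
    (ψ : Transcript n d → Basis n d → ℂ)
    (hψ : ∀ i : Fin n, h ≤ i.val → ∀ y ω, ψ (setMsg i y ω) = ψ ω)
    (hψ' : ∀ i : Fin n, h ≤ i.val → ∀ z ω, ψ (setChal i z ω) = ψ ω) :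
    ∑ ω, badSum (fun φ => nsq ((outEvent ω.1 ω.2.1).indicator φ)) ω.1 ω.2.1 ω.2.2 G l h (ψ ω) ≤
      runs l.length (n - h) *
        ((∏ i ∈ (below n h)ᶜ, msgWeight d i) * ∑ ω, nsq (ψ ω)) / d.chal := by
  classical
  induction l generalizing h ψ with
  | nil =>
    simp only [badSum, Finset.sum_const_zero]
    have : 0 ≤ ∑ ω, nsq (ψ ω) := Finset.sum_nonneg fun _ _ => nsq_nonneg _
    have := Finset.prod_nonneg fun i (_ : i ∈ (below n h)ᶜ) => msgWeight_nonneg (d := d) i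
    positivity
  | cons B l ih =>
    have hB := hl B (by simp)
    have hl' : ∀ B ∈ l, Contracts B := fun B' h => hl B' (by simp [h])
    set K := ∏ i ∈ (below n h)ᶜ, msgWeight d i
    set S := ∑ ω, nsq (ψ ω)
    have hK : 0 ≤ K := Finset.prod_nonneg fun i _ => msgWeight_nonneg i
    have h0 : ∑ ω, badSum (fun φ => nsq ((outEvent ω.1 ω.2.1).indicator φ)) ω.1 ω.2.1 ω.2.2 G l h
        (B *ᵥ query (reprog ω.1 ω.2.1 ω.2.2 (below n h) G) (ψ ω)) ≤
        runs l.length (n - h) * (K * S) / d.chal := by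
      refine (ih hl' h (fun ω => B *ᵥ query (trep ω (below n h) G) (ψ ω)) (fun i hi y ω => by
        simp only [trep_setMsg (below n h) G i y ω (by simp; omega), hψ i hi])
        (fun i hi z ω => by
          simp only [trep_setChal (below n h) G i z ω (by simp; omega)
            (fun k hk => by simp at hk; omega), hψ' i hi])).trans ?_
      gcongr
      exact Finset.sum_le_sum fun ω _ => (hB _).trans (nsq_query _ _).le
    have hgood : ∀ hh : h < n, ∀ J ⊆ below n (h + 1), ∑ ω, badSum
        (fun φ => nsq ((outEvent ω.1 ω.2.1).indicator φ)) ω.1 ω.2.1 ω.2.2 G l (h + 1)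
        (B *ᵥ hitQuery ω.1 ω.2.1 ω.2.2 G J ⟨h, hh⟩ (ψ ω)) ≤
        runs l.length (n - h - 1) * (K * S) / d.chal := by
      intro hh J hJ
      refine (ih hl' (h + 1)
        (fun ω => B *ᵥ query (trep ω J G) ((atPt (tpt ω ⟨h, hh⟩)).indicator (ψ ω)))
        (fun k hk y ω => ?_) (fun k hk z ω => ?_)).trans ?_
      · have hk1 : (⟨h, hh⟩ : Fin n) ≠ k := fun e => by simp [← e] at hk
        have hk2 : k ∉ J := fun e => by have := hJ e; simp at this; omega
        simp only [trep_setMsg J G k y ω hk2, tpt_setMsg _ k y ω hk1, hψ k (by omega)]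
      · have hk2 : k ∉ J := fun e => by have := hJ e; simp at this; omega
        have hk3 : ∀ i ∈ J, i.val ≠ k.val + 1 := fun i e => by
          have := hJ e; simp at this; omega
        have hk1 : (⟨h, hh⟩ : Fin n).val ≠ k.val + 1 := by simp; omega
        simp only [trep_setChal J G k z ω hk2 hk3, tpt_setChal _ k z ω hk1, hψ' k (by omega)]
      · have hmem : (⟨h, hh⟩ : Fin n) ∈ (below n h)ᶜ := by simp
        have hc : (below n (h + 1))ᶜ = (below n h)ᶜ.erase ⟨h, hh⟩ := by
          rw [below_succ hh, Finset.compl_insert]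
        rw [hc, Nat.sub_sub]
        refine div_le_div_of_nonneg_right (mul_le_mul_of_nonneg_left ?_ (by positivity))
          (by positivity)
        have hK' : 0 ≤ ∏ k ∈ (below n h)ᶜ.erase ⟨h, hh⟩, msgWeight d k :=
          Finset.prod_nonneg fun i _ => msgWeight_nonneg i
        calc _ ≤ (∏ k ∈ (below n h)ᶜ.erase ⟨h, hh⟩, msgWeight d k) *
              ∑ ω, nsq ((atPt (tpt ω ⟨h, hh⟩)).indicator (ψ ω)) :=
              mul_le_mul_of_nonneg_left
                (Finset.sum_le_sum fun ω _ => (hB _).trans (nsq_query _ _).le) hK'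
          _ ≤ (∏ k ∈ (below n h)ᶜ.erase ⟨h, hh⟩, msgWeight d k) *
              (msgWeight d ⟨h, hh⟩ * S) :=
              mul_le_mul_of_nonneg_left (sum_nsq_indicator_separates_le hX hM
                (separates_atPt _) ψ (hψ _ le_rfl)) hK'
          _ = K * S := by rw [← mul_assoc, Finset.prod_erase_mul _ _ hmem]
    have hbad : ∀ i : Fin n, h < i.val → ∀ J ⊆ insert i (below n h), ∑ ω, allSum
        (fun φ => nsq ((outEvent ω.1 ω.2.1).indicator φ)) ω.1 ω.2.1 ω.2.2 G l
        (insert i (below n h)) (B *ᵥ hitQuery ω.1 ω.2.1 ω.2.2 G J i (ψ ω)) ≤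
        runs l.length (n - h - 1) * (K * S) / d.chal := by
      intro i hi J hJ
      have hmem : i ∈ (below n h)ᶜ := by simp; omega
      have hc : (insert i (below n h))ᶜ = (below n h)ᶜ.erase i := Finset.compl_insert
      refine (sum_allSum_le hX hM G l hl' (insert i (below n h))
        (fun ω => B *ᵥ query (trep ω J G) ((atPt (tpt ω i)).indicator (ψ ω)))
        (fun k hk y ω => ?_)).trans ?_
      · have hk1 : i ≠ k := fun e => hk (by simp [e])
        have hk2 : h ≤ k.val := by
          by_contra hlt; exact hk (Finset.mem_insert_of_mem (by simp; omega))
        simp only [trep_setMsg J G k y ω (fun e => hk (hJ e)), tpt_setMsg i k y ω hk1, hψ k hk2]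
      · rw [hc, Finset.card_erase_of_mem hmem, card_compl_below, mul_div_assoc]
        gcongr
        have hK' : 0 ≤ ∏ k ∈ (below n h)ᶜ.erase i, msgWeight d k :=
          Finset.prod_nonneg fun i _ => msgWeight_nonneg i
        -- The challenge contained in the point `i`; since `i > h`, its index is at least `h`, so
        -- `ψ` does not depend on it.
        let j : Fin n := ⟨i.val - 1, by omega⟩
        have hj : h ≤ j.val := by simp only [j]; omega
        have hi0 : i.val ≠ 0 := by omega
        have hrare : ∑ ω, nsq ((atPt (tpt ω i)).indicator (ψ ω)) ≤
            msgWeight d i * S / d.chal := by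
          -- Of the `|𝒞| · |𝒳| · |ℳ|` fresh values of challenge, instance and message at most `|𝒳|`
          -- produce the given query; the quotient is `msgWeight d i / |𝒞|`.
          have := sum_nsq_indicator_le
            (fun (y : Fin d.chal × (Fin d.inst × Fin d.msg)) ω => setMsg i y.2 (setChal j y.1 ω))
            (d.chal * (d.inst * d.msg)) (d.inst) (by positivity)
            (fun f => by
              have h1 := sum_setChal j fun ω => ∑ y, f (setMsg i y ω)
              rw [sum_setMsg] at h1
              rw [mul_assoc, ← h1]
              exact Finset.sum_congr rfl fun ω _ => Fintype.sum_prod_type _) ψ (fun y ω => by rw [hψ i (by omega), hψ' j hj])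
            (fun ω => atPt (tpt ω i)) (fun ω b => sum_indicator_atPt_le hi0 ω b)
          refine this.trans (le_of_eq ?_)
          simp only [msgWeight, hi0, if_false]
          field_simp
          rfl
        calc _ ≤ (∏ k ∈ (below n h)ᶜ.erase i, msgWeight d k) *
              ∑ ω, nsq ((atPt (tpt ω i)).indicator (ψ ω)) :=
              mul_le_mul_of_nonneg_left
                (Finset.sum_le_sum fun ω _ => (hB _).trans (nsq_query _ _).le) hK'
          _ ≤ (∏ k ∈ (below n h)ᶜ.erase i, msgWeight d k) *
              (msgWeight d i * S / d.chal) := mul_le_mul_of_nonneg_left hrare hK'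
          _ = K * S / d.chal := by
              rw [← mul_div_assoc, ← mul_assoc, Finset.prod_erase_mul _ _ hmem]
    have hT : 0 ≤ K * S / d.chal := by
      have : 0 ≤ S := Finset.sum_nonneg fun _ _ => nsq_nonneg _
      positivity
    have hsum : ∑ ω : Transcript n d, ∑ i : Fin n with h < i.val,
        (allSum (fun φ => nsq ((outEvent ω.1 ω.2.1).indicator φ)) ω.1 ω.2.1 ω.2.2 G l
          (insert i (below n h))
          (B *ᵥ hitQuery ω.1 ω.2.1 ω.2.2 G (insert i (below n h)) i (ψ ω)) +
        allSum (fun φ => nsq ((outEvent ω.1 ω.2.1).indicator φ)) ω.1 ω.2.1 ω.2.2 G l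
          (insert i (below n h)) (B *ᵥ hitQuery ω.1 ω.2.1 ω.2.2 G (below n h) i (ψ ω))) ≤
        ∑ _i : Fin n with h < _i.val, 2 * (runs l.length (n - h - 1) * (K * S) / d.chal) := by
      rw [Finset.sum_comm]
      refine Finset.sum_le_sum fun i hi => ?_
      have hi' : h < i.val := by simpa using hi
      rw [Finset.sum_add_distrib, two_mul]
      exact add_le_add (hbad i hi' _ le_rfl) (hbad i hi' _ (Finset.subset_insert _ _))
    simp only [badSum]
    rw [Finset.sum_add_distrib, Finset.sum_add_distrib]
    by_cases hh : h < n
    · simp only [hh, dif_pos]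
      rw [Finset.sum_add_distrib]
      refine (add_le_add (add_le_add h0 (add_le_add (hgood hh _ le_rfl) (hgood hh _
        (by rw [below_succ hh]; exact Finset.subset_insert _ _)))) hsum).trans (le_of_eq ?_)
      have hcard : ((Finset.univ.filter fun i : Fin n => h < i.val).card : ℝ) + 1 = (n - h : ℕ) := by
        rw [← card_compl_below, compl_below hh, Finset.card_insert_of_notMem (by simp)]
        push_cast; rfl
      rw [Finset.sum_const, nsmul_eq_mul, List.length_cons, runs]
      push_cast
      rw [← hcard]
      ring
    · have e2 : (Finset.univ.filter fun i : Fin n => h < i.val) = ∅ := by ext i; simp; omega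
      simp only [hh, dif_neg, not_false_iff, Finset.sum_const_zero, add_zero]
      refine (add_le_add h0 hsum).trans (le_of_eq ?_)
      rw [e2, Finset.sum_empty]
      have : n - h = 0 := by omega
      simp [runs, this]

end Bounds

end MultiRoundFS
end

noncomputable section
namespace MultiRoundFS
variable {n : ℕ} {d : Sizes} {q : ℕ}

/-! ## The forging probability in terms of a reprogrammed oracle -/

/-- The location of each point uses the guessed challenge `c` instead of the actual one; the two
agree by induction along the chain. -/
lemma chain_eq_iff (H : Hash n d) (x : Fin d.inst) (a : Fin n → Fin d.msg)
    (c : Fin n → Fin d.chal) : chain H x a = c ↔ ∀ i, H (pt x a c i) = c i := by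
  constructor
  · rintro rfl ⟨i, hi⟩
    cases i <;> rfl
  · intro h
    have key : ∀ (i : ℕ) (hi : i < n), chainAux H x a i hi = c ⟨i, hi⟩ := by
      intro i
      induction i with
      | zero => intro hi; exact h ⟨0, hi⟩
      | succ i ih =>
        intro hi
        rw [chainAux, ih]
        exact h ⟨i + 1, hi⟩
    exact funext fun i => key i i.isLt

/-- Points with different indices never coincide, so the last reprogramming may be carried out
first, as an ordinary update of `G`. -/
lemma reprog_update (x : Fin d.inst) (a : Fin n → Fin d.msg) (c : Fin n → Fin d.chal) {h : ℕ}
    (hh : h < n) (G : Hash n d) :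
    reprog x a c (below n (h + 1)) G =
      reprog x a c (below n h) (Function.update G (pt x a c ⟨h, hh⟩) (c ⟨h, hh⟩)) := by
  funext w
  simp only [reprog, mem_below]
  by_cases hw : w = pt x a c ⟨h, hh⟩
  · subst hw; simp [pt]
  · rw [Function.update_of_ne hw]
    have : w.1.val = h → w ≠ pt x a c w.1 := by
      intro e e'
      apply hw
      rw [e']
      congr 1
      exact Fin.ext e
    by_cases h1 : w.1.val < h
    · simp [h1, Nat.lt_succ_of_lt h1]
    · by_cases h2 : w.1.val = h
      · rw [if_neg fun e => this h2 e.2, if_neg fun e => h1 e.1]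
      · rw [if_neg fun e => by omega, if_neg fun e => h1 e.1]

/-- `sum_update`, applied to `f` restricted to the functions with value `y` at `i`. -/
lemma sum_indicator_update {ι α : Type*} [Fintype ι] [DecidableEq ι] [Fintype α] [DecidableEq α]
    (f : (ι → α) → ℝ) (i : ι) (y : α) :
    ∑ G : ι → α, f (Function.update G i y) =
      Fintype.card α * ∑ G : ι → α, if G i = y then f G else 0 := by
  rw [← sum_update i]
  refine Finset.sum_congr rfl fun G _ => ?_
  simp

/-- A reprogrammed uniform function is a uniform function conditioned on the prescribed values. The
condition has probability `|𝒞|^(-h)` because the points are distinct. -/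
lemma sum_reprog_below (x : Fin d.inst) (a : Fin n → Fin d.msg) (c : Fin n → Fin d.chal)
    (F : Hash n d → ℝ) (h : ℕ) (hh : h ≤ n) :
    ∑ G, F (reprog x a c (below n h) G) = (d.chal : ℝ) ^ h *
      ∑ G : Hash n d, if ∀ i ∈ below n h, G (pt x a c i) = c i then F G else 0 := by
  classical
  induction h generalizing F with
  | zero =>
    have : ∀ G, reprog x a c ∅ G = G := fun G => funext fun w => by simp [reprog]
    simp [this]
  | succ h ih =>
    have hn : h < n := hh
    have e1 : ∀ G : Hash n d, reprog x a c (below n h) G (pt x a c ⟨h, hn⟩) =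
        G (pt x a c ⟨h, hn⟩) := fun G => by
      simp [reprog, pt]
    calc ∑ G, F (reprog x a c (below n (h + 1)) G)
        = d.chal * ∑ G : Hash n d, if G (pt x a c ⟨h, hn⟩) = c ⟨h, hn⟩ then
            F (reprog x a c (below n h) G) else 0 := by
          simp_rw [reprog_update x a c hn]
          rw [sum_indicator_update (fun G => F (reprog x a c (below n h) G)), Fintype.card_fin]
      _ = d.chal * ∑ G, (fun G : Hash n d => if G (pt x a c ⟨h, hn⟩) = c ⟨h, hn⟩ then F G else 0)
            (reprog x a c (below n h) G) := by simp only [e1]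
      _ = _ := by
          rw [ih (fun G => if G (pt x a c ⟨h, hn⟩) = c ⟨h, hn⟩ then F G else 0) hn.le, pow_succ', mul_assoc]
          congr 2
          refine Finset.sum_congr rfl fun G _ => ?_
          rw [below_succ hn]
          simp only [Finset.forall_mem_insert]
          split_ifs <;> tauto

/-- The list of the operators of an adversary. -/
def Adversary.ops (A : Adversary n d q) : List (AOp n d) := (List.finRange q).map A.op

lemma Adversary.contracts_ops (A : Adversary n d q) : ∀ B ∈ A.ops, Contracts B := by
  intro B hB
  obtain ⟨i, _, rfl⟩ := List.mem_map.1 hB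
  exact A.contracts_op i

lemma Adversary.length_ops (A : Adversary n d q) : A.ops.length = q := by simp [ops]

lemma Adversary.final_eq (A : Adversary n d q) (H : Hash n d) :
    A.final H = evol H A.ops A.start := by
  unfold Adversary.final Adversary.ops
  generalize List.finRange q = l
  generalize A.start = φ
  induction l generalizing φ with
  | nil => rfl
  | cons i l ih => 
    simp only [List.foldl_cons, List.map_cons, evol]
    rw [ih, queryMatrix_mulVec]

/-- The projection onto the output `x`, `a` and accepted last messages. -/
def accMatrix (prot : PCIP n d) (x : Fin d.inst) (a : Fin n → Fin d.msg)
    (c : Fin n → Fin d.chal) : AOp n d :=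
  Matrix.diagonal ((outEvent x a).indicator fun _ => 1) * onZ (prot.V x a c)

lemma accMatrix_mulVec (prot : PCIP n d) (x : Fin d.inst) (a : Fin n → Fin d.msg)
    (c : Fin n → Fin d.chal) (ψ : Basis n d → ℂ) :
    accMatrix prot x a c *ᵥ ψ = (outEvent x a).indicator (onZ (prot.V x a c) *ᵥ ψ) := by
  rw [accMatrix, ← Matrix.mulVec_mulVec]
  funext b
  rw [Matrix.mulVec_diagonal]
  by_cases hb : b ∈ outEvent x a <;> simp [hb]

/-- Split according to the value `c` of the chain: exactly one `c` contributes for each `H` and `a`.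
The condition on `H` is then removed by `sum_reprog_below` with `h = n`. -/
lemma forgeProb_eq (A : Adversary n d q) (prot : PCIP n d) (x : Fin d.inst) (hC : 0 < d.chal) :
    forgeProb A prot x = (∑ G : Hash n d, ∑ a, ∑ c, nsq (accMatrix prot x a c *ᵥ
      evol (reprog x a c Finset.univ G) A.ops A.start)) / d.chal ^ n / Fintype.card (Hash n d) := by
  classical
  unfold forgeProb
  congr 1
  rw [eq_div_iff (by positivity)]
  have h1 : ∀ (H : Hash n d) (a : Fin n → Fin d.msg), (∑ b : Basis n d,
      if b.2.2.2.1 = x ∧ b.2.2.2.2.1 = a then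
        ‖(onZ (prot.V x a (chain H x a)) *ᵥ A.final H) b‖ ^ 2 else 0) =
      ∑ c, if ∀ i ∈ below n n, H (pt x a c i) = c i then
        nsq (accMatrix prot x a c *ᵥ evol H A.ops A.start) else 0 := by
    intro H a
    have : ∀ c, (∀ i ∈ below n n, H (pt x a c i) = c i) ↔ c = chain H x a := fun c => by
      rw [eq_comm, chain_eq_iff]; simp
    simp only [this]
    rw [Finset.sum_ite_eq' Finset.univ (chain H x a), if_pos (Finset.mem_univ _),
      accMatrix_mulVec, ← Adversary.final_eq]
    refine Finset.sum_congr rfl fun b _ => ?_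
    by_cases hb : b ∈ outEvent x a
    · rw [Set.indicator_of_mem hb]; exact if_pos hb
    · rw [Set.indicator_of_notMem hb, norm_zero, zero_pow two_ne_zero]; exact if_neg hb
  simp only [h1]
  rw [Finset.sum_comm (s := Finset.univ (α := Hash n d)),
    Finset.sum_comm (s := Finset.univ (α := Hash n d)), Finset.sum_mul]
  refine Finset.sum_congr rfl fun a _ => ?_
  rw [Finset.sum_comm (s := Finset.univ (α := Hash n d)),
    Finset.sum_comm (s := Finset.univ (α := Hash n d)), Finset.sum_mul]
  refine Finset.sum_congr rfl fun c _ => ?_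
  rw [← below_self, sum_reprog_below x a c
    (fun H => nsq (accMatrix prot x a c *ᵥ evol H A.ops A.start)) n le_rfl, mul_comm]

lemma onZ_mulVec (P : Matrix (Fin d.zdim) (Fin d.zdim) ℂ) (ψ : Basis n d → ℂ)
    (b : Bool) (v : Dom n d) (y : Resp d) (x : Fin d.inst) (a : Fin n → Fin d.msg)
    (z : Fin d.zdim) (e : Fin d.edim) :
    (onZ P *ᵥ ψ) (b, v, y, x, a, z, e) = (P *ᵥ fun z' => ψ (b, v, y, x, a, z', e)) z := by
  simp only [Matrix.mulVec, dotProduct]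
  symm
  refine Finset.sum_of_injOn (fun z' => (b, v, y, x, a, z', e)) ?_ (by simp) ?_ ?_
  · intro z _ z' _ h
    simpa using h
  · rintro ⟨b', v', y', x', a', z', e'⟩ _ h
    simp only [onZ]
    rw [if_neg, zero_mul]
    rintro ⟨rfl, rfl, rfl, rfl, rfl, rfl⟩
    exact h ⟨z', by simp, rfl⟩
  · intro z' _
    simp [onZ]

/-- The operator is block diagonal: it acts as `P` on the register `Z` for each value of the other
registers. -/
lemma contracts_onZ {P : Matrix (Fin d.zdim) (Fin d.zdim) ℂ} (hP : Contracts P) :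
    Contracts (onZ P : AOp n d) := by
  intro ψ
  simp only [nsq, Fintype.sum_prod_type]
  refine Finset.sum_le_sum fun b _ => Finset.sum_le_sum fun i _ => ?_
  refine Finset.sum_le_sum fun v _ => Finset.sum_le_sum fun y _ => ?_
  refine Finset.sum_le_sum fun r _ => Finset.sum_le_sum fun x _ => ?_
  refine Finset.sum_le_sum fun a _ => ?_
  rw [Finset.sum_comm, Finset.sum_comm (s := (Finset.univ : Finset (Fin d.zdim)))]
  refine Finset.sum_le_sum fun e _ => ?_
  simp only [onZ_mulVec]
  exact hP _

lemma onZ_indicator_outEvent (P : Matrix (Fin d.zdim) (Fin d.zdim) ℂ) (ψ : Basis n d → ℂ)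
    (x : Fin d.inst) (a : Fin n → Fin d.msg) :
    onZ P *ᵥ (outEvent x a).indicator ψ = (outEvent x a).indicator (onZ P *ᵥ ψ) := by
  funext b
  obtain ⟨b, v, y, x', a', z, e⟩ := b
  by_cases h : x' = x ∧ a' = a
  · have h1 : ∀ z, ((b, v, y, x', a', z, e) : Basis n d) ∈ outEvent x a := fun z => h
    rw [Set.indicator_of_mem (h1 z), onZ_mulVec, onZ_mulVec]
    simp only [Set.indicator_of_mem (h1 _)]
  · have h1 : ∀ z, ((b, v, y, x', a', z, e) : Basis n d) ∉ outEvent x a := fun z => h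
    rw [Set.indicator_of_notMem (h1 z), onZ_mulVec]
    simp only [Set.indicator_of_notMem (h1 _)]
    exact congrFun (Matrix.mulVec_zero P) z

lemma nsq_accMatrix_le (prot : PCIP n d) (x : Fin d.inst) (a : Fin n → Fin d.msg)
    (c : Fin n → Fin d.chal) (ψ : Basis n d → ℂ) :
    nsq (accMatrix prot x a c *ᵥ ψ) ≤ nsq ((outEvent x a).indicator ψ) := by
  rw [accMatrix_mulVec, ← onZ_indicator_outEvent]
  exact contracts_onZ (contracts_of_isStarProjection (prot.isProj x a c)) _

lemma contracts_accMatrix (prot : PCIP n d) (x : Fin d.inst) (a : Fin n → Fin d.msg)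
    (c : Fin n → Fin d.chal) : Contracts (accMatrix prot x a c) := fun ψ =>
  (nsq_accMatrix_le prot x a c ψ).trans (nsq_indicator_le _ _)

end MultiRoundFS
end

noncomputable section
namespace MultiRoundFS
variable {n : ℕ} {d : Sizes} {q : ℕ}

/-! ## A family of hash functions with almost uniform marginals -/

lemma sum_range_mul_of_periodic {f : ℕ → ℝ} {e : ℕ} (hf : ∀ i, f (i + e) = f i) (m : ℕ) :
    ∑ i ∈ Finset.range (m * e), f i = m * ∑ i ∈ Finset.range e, f i := by
  have hf' : ∀ m i, f (m * e + i) = f i := by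
    intro m
    induction m with
    | zero => simp
    | succ m ih => intro i; rw [Nat.succ_mul, add_right_comm, hf, ih]
  induction m with
  | zero => simp
  | succ m ih =>
    rw [Nat.succ_mul, Finset.sum_range_add, ih]
    simp only [hf']
    push_cast; ring

lemma sum_zmod_eq_sum_range {N : ℕ} [NeZero N] (g : ZMod N → ℝ) :
    ∑ w, g w = ∑ i ∈ Finset.range N, g (i : ZMod N) := by
  refine Finset.sum_nbij' (fun w => w.val) (fun i => (i : ZMod N)) ?_ ?_ ?_ ?_ ?_
  · intro w _; simpa using ZMod.val_lt w
  · simp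
  · intro w _; simp
  · intro i hi; exact ZMod.val_cast_of_lt (by simpa using hi)
  · intro w _; simp

/-- Windows of length `e` placed at distance `e` around the cycle cover each residue `e` times, even
if `e` and `N` are not coprime: the inner sum is periodic in `i` with both periods `e` and `N`, and
its sum over `N * e` consecutive `i` is computed in both ways. -/
lemma sum_sum_range_zmod {N : ℕ} [NeZero N] (g : ZMod N → ℝ) (h₀ : ZMod N) (e : ℕ) :
    ∑ u : ZMod N, ∑ i ∈ Finset.range e, g (h₀ + e * u + i) = e * ∑ w, g w := by
  let s : ℕ → ℝ := fun i => ∑ u : ZMod N, g (h₀ + e * u + i)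
  have hs1 : ∀ i, s (i + e) = s i := fun i => by
    refine Fintype.sum_equiv (Equiv.addRight 1) _ _ fun u => ?_
    simp only [Equiv.coe_addRight]
    congr 1
    push_cast; ring
  have hs2 : ∀ i, s (i + N) = s i := fun i => by simp [s]
  have hs3 : ∑ i ∈ Finset.range N, s i = N * ∑ w, g w := by
    simp only [s]
    rw [Finset.sum_comm]
    have : ∀ u : ZMod N, ∑ i ∈ Finset.range N, g (h₀ + e * u + i) = ∑ w, g w := fun u => by
      rw [← sum_zmod_eq_sum_range fun i : ZMod N => g (h₀ + e * u + i)]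
      exact Fintype.sum_equiv (Equiv.addLeft (h₀ + e * u)) _ _ fun _ => rfl
    simp [this, ZMod.card]
  have h4 := sum_range_mul_of_periodic hs1 N
  rw [mul_comm N e, sum_range_mul_of_periodic hs2 e, hs3] at h4
  have hN : (N : ℝ) ≠ 0 := by exact_mod_cast NeZero.ne N
  rw [Finset.sum_comm]
  refine mul_left_cancel₀ hN ?_
  change (N : ℝ) * ∑ i ∈ Finset.range e, s i = _
  rw [← h4]; ring

/-- The interval of length `M` that contains a residue. -/
def bucket (C M : ℕ) [NeZero (C * M)] (w : ZMod (C * M)) : Fin C :=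
  ⟨w.val / M, Nat.div_lt_of_lt_mul ((ZMod.val_lt w).trans_eq (mul_comm C M))⟩

variable {C M : ℕ} [NeZero (C * M)]

lemma sum_bucket (φ : Fin C → ℝ) : ∑ w, φ (bucket C M w) = M * ∑ y, φ y := by
  have hM : 0 < M := Nat.pos_of_ne_zero fun h => NeZero.ne (C * M) (by simp [h])
  let φ' : ℕ → ℝ := fun i => if h : i < C then φ ⟨i, h⟩ else 0
  have h1 : ∀ w, φ (bucket C M w) = φ' (w.val / M) := fun w => by
    have := (bucket C M w).isLt
    simp only [bucket] at this
    simp only [φ', bucket, this, dif_pos]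
  have h2 : ∀ m, ∑ i ∈ Finset.range (m * M), φ' (i / M) = M * ∑ y ∈ Finset.range m, φ' y := by
    intro m
    induction m with
    | zero => simp
    | succ m ih =>
      rw [Nat.succ_mul, Finset.sum_range_add, ih, Finset.sum_range_succ, mul_add]
      congr 1
      rw [Finset.sum_congr rfl fun i hi => by
        rw [mul_comm m, Nat.mul_add_div hM, Nat.div_eq_of_lt (by simpa using hi), add_zero]]
      simp
  simp only [h1]
  rw [sum_zmod_eq_sum_range fun w : ZMod (C * M) => φ' (w.val / M)]
  have h3 : ∑ y ∈ Finset.range C, φ' y = ∑ y, φ y := by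
    rw [← Fin.sum_univ_eq_sum_range]
    exact Finset.sum_congr rfl fun y _ => by simp [φ']
  rw [← h3, ← h2]
  exact Finset.sum_congr rfl fun i hi => by rw [ZMod.val_cast_of_lt (by simpa using hi)]

lemma card_near_boundary (e : ℕ) :
    ∑ w : ZMod (C * M), (if w.val % M < e then (1 : ℝ) else 0) ≤ C * e := by
  rw [sum_zmod_eq_sum_range fun w : ZMod (C * M) => (if w.val % M < e then (1 : ℝ) else 0)]
  have h1 : ∀ i ∈ Finset.range (C * M),
      (if ((i : ZMod (C * M)).val % M < e) then (1 : ℝ) else 0) = if i % M < e then 1 else 0 :=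
    fun i hi => by rw [ZMod.val_cast_of_lt (by simpa using hi)]
  rw [Finset.sum_congr rfl h1, sum_range_mul_of_periodic (f := fun i => if i % M < e then 1 else 0)
    (by simp)]
  refine mul_le_mul_of_nonneg_left ?_ (by positivity)
  rw [Finset.sum_boole]
  norm_cast
  calc _ ≤ (Finset.range e).card := Finset.card_le_card fun i hi => by
        simp only [Finset.mem_filter, Finset.mem_range] at hi ⊢
        rw [Nat.mod_eq_of_lt hi.1] at hi
        exact hi.2
    _ = e := Finset.card_range e

/-- Going back by fewer than `e` steps from a residue at distance at least `e` from the start of its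
interval does not leave the interval. -/
lemma bucket_add_of_far {w : ZMod (C * M)} {i e : ℕ} (hi : i < e) (h : ¬ (w + i).val % M < e) :
    bucket C M (w + i) = bucket C M w := by
  have hM : 0 < M := Nat.pos_of_ne_zero fun h => NeZero.ne (C * M) (by simp [h])
  set v := w + i
  have hv : i ≤ v.val := by
    have := Nat.mod_le v.val M
    omega
  have hw : w = ((v.val - i : ℕ) : ZMod (C * M)) := by
    rw [Nat.cast_sub hv]; simp [v]
  have hw' : w.val = v.val - i := by
    rw [hw, ZMod.val_cast_of_lt (lt_of_le_of_lt (Nat.sub_le _ _) (ZMod.val_lt v))]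
  apply Fin.ext
  simp only [bucket]
  rw [hw']
  have h1 := Nat.div_add_mod v.val M
  have h2 : v.val - i = M * (v.val / M) + (v.val % M - i) := by omega
  rw [h2, Nat.mul_add_div hM, Nat.div_eq_of_lt (a := v.val % M - i)
    (by have := Nat.mod_lt v.val hM; omega), add_zero]

/-- Replace each term of the progression by the average over the `e` residues starting there. By
`sum_sum_range_zmod` these windows cover all residues evenly, and a term changes only if its window
reaches the first `e` residues of an interval. -/
lemma sum_bucket_progression_nat (φ : Fin C → ℝ) (hφ : ∀ y, |φ y| ≤ 1) (h₀ : ZMod (C * M)) {e : ℕ}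
    (he : 0 < e) :
    |∑ u, φ (bucket C M (h₀ + e * u)) - M * ∑ y, φ y| ≤ 2 * C * e := by
  have he' : (0 : ℝ) < e := by exact_mod_cast he
  rw [← sum_bucket (M := M) φ]
  have h1 : e * (∑ u, φ (bucket C M (h₀ + e * u)) - ∑ w, φ (bucket C M w)) =
      ∑ u : ZMod (C * M), ∑ i ∈ Finset.range e,
        (φ (bucket C M (h₀ + e * u)) - φ (bucket C M (h₀ + e * u + i))) := by
    simp only [Finset.sum_sub_distrib]
    rw [sum_sum_range_zmod (fun w => φ (bucket C M w)), mul_sub]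
    simp [Finset.mul_sum]
  have h2 : |e * (∑ u, φ (bucket C M (h₀ + e * u)) - ∑ w, φ (bucket C M w))| ≤
      e * (2 * C * e) := by
    rw [h1]
    calc _ ≤ ∑ u : ZMod (C * M), ∑ i ∈ Finset.range e,
          |φ (bucket C M (h₀ + e * u)) - φ (bucket C M (h₀ + e * u + i))| :=
          (Finset.abs_sum_le_sum_abs _ _).trans
            (Finset.sum_le_sum fun u _ => Finset.abs_sum_le_sum_abs _ _)
      _ ≤ ∑ u : ZMod (C * M), ∑ i ∈ Finset.range e,
          2 * (if (h₀ + e * u + i).val % M < e then (1 : ℝ) else 0) := by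
          refine Finset.sum_le_sum fun u _ => Finset.sum_le_sum fun i hi => ?_
          split_ifs with h
          · calc _ ≤ |φ (bucket C M (h₀ + e * u))| + |φ (bucket C M (h₀ + e * u + i))| :=
by
                  rw [sub_eq_add_neg, ← abs_neg (φ (bucket C M (h₀ + e * u + i)))]
                  exact abs_add_le _ _
              _ ≤ 2 * 1 := by
                  have h3 := hφ (bucket C M (h₀ + e * u))
                  have h4 := hφ (bucket C M (h₀ + e * u + i))
                  linarith
          · rw [bucket_add_of_far (by simpa using hi) h]; simp
      _ ≤ _ := by
          rw [sum_sum_range_zmod (fun w : ZMod (C * M) =>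
            2 * (if w.val % M < e then (1 : ℝ) else 0)), ← Finset.mul_sum]
          have := card_near_boundary (C := C) (M := M) e
          nlinarith
  rw [abs_mul, abs_of_pos he'] at h2
  exact le_of_mul_le_mul_left h2 he'

/-- The sign of `δ` is absorbed by the substitution of `-u` for `u`. -/
lemma sum_bucket_progression (φ : Fin C → ℝ) (hφ : ∀ y, |φ y| ≤ 1) (h₀ : ZMod (C * M)) {δ : ℤ}
    (hδ : δ ≠ 0) :
    |∑ u, φ (bucket C M (h₀ + δ * u)) - M * ∑ y, φ y| ≤ 2 * C * δ.natAbs := by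
  have h := sum_bucket_progression_nat φ hφ h₀ (Int.natAbs_pos.2 hδ)
  rcases Int.natAbs_eq δ with e | e
  · convert h using 5
    rw [e]; simp
  · convert h using 3
    refine Fintype.sum_equiv (Equiv.neg _) _ _ fun u => ?_
    rw [e]; simp

/-- Natural numbers that represent the hash inputs. -/
def encode (v : Dom n d) : ℕ :=
  ((Sum.elim Fin.val Fin.val v.2.1 * d.msg + v.2.2.val) * 2 + Sum.elim (fun _ => 0) (fun _ => 1) v.2.1)
    * n + v.1.val

/-- A bound for the numbers that represent hash inputs. -/
def encodeBound (n : ℕ) (d : Sizes) : ℕ := (d.inst + d.chal) * d.msg * 2 * n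

lemma mul_add_lt {a b c k : ℕ} (h1 : a < c) (h2 : b < k) : a * k + b < c * k := by
  nlinarith [Nat.mul_le_mul_right k (Nat.succ_le_of_lt h1)]

lemma encode_lt (v : Dom n d) : encode v < encodeBound n d := by
  obtain ⟨i, l, m⟩ := v
  refine mul_add_lt (mul_add_lt (mul_add_lt ?_ m.isLt) ?_) i.isLt
  · rcases l with l | l <;> simp <;> omega
  · rcases l with l | l <;> simp

lemma mul_add_inj {a b a' b' k : ℕ} (h1 : b < k) (h2 : b' < k) (h : a * k + b = a' * k + b') :
    a = a' ∧ b = b' := by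
  have hk : 0 < k := by omega
  have e1 : (a * k + b) / k = (a' * k + b') / k := by rw [h]
  have e2 : (a * k + b) % k = (a' * k + b') % k := by rw [h]
  rw [mul_comm a, mul_comm a', Nat.mul_add_div hk, Nat.mul_add_div hk, Nat.div_eq_of_lt h1,
    Nat.div_eq_of_lt h2] at e1
  rw [mul_comm a, mul_comm a', Nat.mul_add_mod, Nat.mul_add_mod, Nat.mod_eq_of_lt h1,
    Nat.mod_eq_of_lt h2] at e2
  exact ⟨by simpa using e1, e2⟩

lemma encode_injective : Function.Injective (encode (n := n) (d := d)) := by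
  rintro ⟨i, l, m⟩ ⟨i', l', m'⟩ h
  obtain ⟨h1, hi⟩ := mul_add_inj i.isLt i'.isLt h
  obtain ⟨h2, hk⟩ := mul_add_inj (by rcases l with l | l <;> simp)
    (by rcases l' with l | l <;> simp) h1
  obtain ⟨h3, hm⟩ := mul_add_inj m.isLt m'.isLt h2
  refine Prod.ext (Fin.ext hi) (Prod.ext ?_ (Fin.ext hm))
  rcases l with l | l <;> rcases l' with l' | l' <;> simp_all [Fin.ext_iff]

/-- The polynomial with the given coefficients, the leading one first. -/
def hornerSum {R : Type*} [CommRing R] {k : ℕ} (s : Fin k → R) (v : R) : R :=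
  ∑ i, s i * v ^ (k - 1 - i.val)

/-- The hash function with a given seed. -/
def seedHash [NeZero (d.chal * M)] {k : ℕ} (s : Fin k → ZMod (d.chal * M)) : Hash n d :=
  fun v => bucket d.chal M (hornerSum s (encode v))

open Polynomial in
/-- A direction in which the seed can be moved without affecting the values at the other points
of `S`. -/
lemma exists_direction {k : ℕ} (S : Finset (Dom n d)) (hS : S.card ≤ k) (v : Dom n d)
    (hv : v ∈ S) : ∃ (t : Fin k → ℤ) (δ : ℤ), δ ≠ 0 ∧ δ.natAbs ≤ encodeBound n d ^ k ∧
      hornerSum t (encode v : ℤ) = δ ∧ ∀ w ∈ S, w ≠ v → hornerSum t (encode w : ℤ) = 0 := by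
  -- The numerator of the Lagrange polynomial of `v`. Without division it has integer coefficients,
  -- at the price of a value `δ` at `v` that need not be invertible modulo `|𝒞| · M`;
  -- `sum_bucket_progression` copes with that.
  let L : ℤ[X] := ∏ w ∈ S.erase v, (X - C (encode w : ℤ))
  have hk : 0 < k := lt_of_lt_of_le (Finset.card_pos.2 ⟨v, hv⟩) hS
  have hdeg : L.natDegree < k := by
    rw [Polynomial.natDegree_prod_of_monic _ _ fun w _ => monic_X_sub_C _]
    simp only [natDegree_X_sub_C, Finset.sum_const, smul_eq_mul, mul_one]
    rw [Finset.card_erase_of_mem hv]; omega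
  have heval : ∀ x : ℤ, hornerSum (fun i : Fin k => L.coeff (k - 1 - i.val)) x = L.eval x := by
    intro x
    rw [hornerSum, Polynomial.eval_eq_sum_range' hdeg, ← Finset.sum_range_reflect,
      Finset.sum_range]
  have hL : ∀ x : ℤ, L.eval x = ∏ w ∈ S.erase v, (x - encode w) := fun x => by
    simp [L, Polynomial.eval_prod]
  refine ⟨fun i => L.coeff (k - 1 - i.val), L.eval (encode v : ℤ), ?_, ?_, heval _, ?_⟩
  · rw [hL, Finset.prod_ne_zero_iff]
    intro w hw e
    refine (Finset.mem_erase.1 hw).1 (encode_injective ?_)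
    omega
  · rw [hL, ← Int.natAbsHom_apply, map_prod]
    have hpos : 0 < encodeBound n d := (Nat.zero_le _).trans_lt (encode_lt v)
    calc _ ≤ ∏ _w ∈ S.erase v, encodeBound n d := Finset.prod_le_prod' fun w _ => by
            have := encode_lt v; have := encode_lt w
            simp only [Int.natAbsHom_apply]
            omega
      _ ≤ _ := by
          rw [Finset.prod_const]
          exact Nat.pow_le_pow_right hpos ((Finset.card_le_card (Finset.erase_subset _ _)).trans hS)
  · intro w hw hne
    rw [heval, hL]
    exact Finset.prod_eq_zero (Finset.mem_erase.2 ⟨hne, hw⟩) (by simp)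

/-- The average. -/
def avg {α : Type*} [Fintype α] (f : α → ℝ) : ℝ := (∑ a, f a) / Fintype.card α

/-- The difference of the averages over all seeds and over all hash functions. -/
def seedGap [NeZero (d.chal * M)] (k : ℕ) (f : Hash n d → ℝ) : ℝ :=
  avg (fun s : Fin k → ZMod (d.chal * M) => f (seedHash s)) - avg f

lemma abs_avg_le {α : Type*} [Fintype α] [Nonempty α] {f : α → ℝ} {b : ℝ} (h : ∀ a, |f a| ≤ b) :
    |avg f| ≤ b := by
  have hpos : (0 : ℝ) < Fintype.card α := by exact_mod_cast Fintype.card_pos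
  rw [avg, abs_div, abs_of_pos hpos, div_le_iff₀ hpos]
  calc |∑ a, f a| ≤ ∑ a, |f a| := Finset.abs_sum_le_sum_abs _ _
    _ ≤ ∑ _a : α, b := Finset.sum_le_sum fun a _ => h a
    _ = _ := by simp [mul_comm]

lemma avg_sub {α : Type*} [Fintype α] (f g : α → ℝ) :
    avg (fun a => f a - g a) = avg f - avg g := by
  simp [avg, Finset.sum_sub_distrib, sub_div]

lemma avg_avg_update {ι α : Type*} [Fintype ι] [DecidableEq ι] [Fintype α] [Nonempty α]
    (f : (ι → α) → ℝ) (i : ι) : avg (fun a => avg fun y => f (Function.update a i y)) = avg f := by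
  have : (Fintype.card α : ℝ) ≠ 0 := by exact_mod_cast Fintype.card_ne_zero
  unfold avg
  rw [← Finset.sum_div, sum_update]
  field_simp

lemma hornerSum_add_mul {R : Type*} [CommRing R] {k : ℕ} (s t : Fin k → R) (u v : R) :
    hornerSum (fun i => s i + u * t i) v = hornerSum s v + u * hornerSum t v := by
  simp only [hornerSum, Finset.mul_sum, ← Finset.sum_add_distrib]
  exact Finset.sum_congr rfl fun i _ => by ring

lemma hornerSum_intCast {N k : ℕ} (t : Fin k → ℤ) (v : ℕ) :
    hornerSum (fun i => (t i : ZMod N)) (v : ZMod N) = (hornerSum t (v : ℤ) : ℤ) := by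
  simp [hornerSum]

lemma bucket_resample_gap [NeZero (d.chal * M)] (φ : Fin d.chal → ℝ) (hφ : ∀ y, |φ y| ≤ 1)
    (h₀ : ZMod (d.chal * M)) {δ : ℤ} (hδ : δ ≠ 0) {D : ℕ} (hD : δ.natAbs ≤ D) :
    |avg (fun u : ZMod (d.chal * M) => φ (bucket d.chal M (h₀ + δ * u))) - avg φ| ≤
      2 * D / M := by
  have h := sum_bucket_progression φ hφ h₀ hδ
  have hne := NeZero.ne (d.chal * M)
  have hM : (0 : ℝ) < M := by
    exact_mod_cast Nat.pos_of_ne_zero fun h => hne (by simp [h])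
  have hC : (0 : ℝ) < d.chal := by
    exact_mod_cast Nat.pos_of_ne_zero fun h => hne (by simp [h])
  have e : avg (fun u : ZMod (d.chal * M) => φ (bucket d.chal M (h₀ + δ * u))) - avg φ =
      (∑ u : ZMod (d.chal * M), φ (bucket d.chal M (h₀ + δ * u)) - M * ∑ y, φ y) /
        (d.chal * M) := by
    simp only [avg, ZMod.card, Fintype.card_fin]
    push_cast
    field_simp
  rw [e, abs_div, abs_of_pos (by positivity : (0 : ℝ) < d.chal * M),
    div_le_div_iff₀ (by positivity) hM]
  calc _ ≤ 2 * (d.chal : ℝ) * δ.natAbs * M := mul_le_mul_of_nonneg_right h hM.le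
    _ ≤ 2 * (d.chal : ℝ) * D * M := by
        have : (δ.natAbs : ℝ) ≤ D := by exact_mod_cast hD
        gcongr
    _ = _ := by ring

/-- A bounded function of few values of the hash function is almost fooled by a random seed. -/
lemma abs_seedGap_le [NeZero (d.chal * M)] {k : ℕ} (S : Finset (Dom n d)) (hS : S.card ≤ k)
    (f : Hash n d → ℝ) (hf : DependsOn f S) (hf1 : ∀ G, |f G| ≤ 1) :
    |seedGap (M := M) k f| ≤ S.card * (2 * (encodeBound n d ^ k : ℕ) / M) := by
  have hC : 0 < d.chal := Nat.pos_of_ne_zero fun h => NeZero.ne (d.chal * M) (by simp [h])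
  have : Nonempty (Fin d.chal) := ⟨⟨0, hC⟩⟩
  induction S using Finset.induction_on generalizing f with
  | empty =>
    obtain ⟨G₀⟩ : Nonempty (Hash n d) := inferInstance
    have hc : ∀ G, f G = f G₀ := fun G => hf (by simp)
    have hM : 0 < M := Nat.pos_of_ne_zero fun h => NeZero.ne (d.chal * M) (by simp [h])
    simp [seedGap, avg, hc]
    field_simp
    simp
  | insert v S hv ih =>
    classical
    -- The value at `v` is replaced by a uniform one. This does not change the average over all hash
    -- functions, and it removes `v` from the points on which the function depends.
    let f' : Hash n d → ℝ := fun G => avg fun y => f (Function.update G v y)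
    have h1 : avg f = avg f' := (avg_avg_update f v).symm
    have hf' : DependsOn f' (S : Set (Dom n d)) := by
      intro G G' h
      simp only [f']
      congr 1
      funext y
      refine hf fun w hw => ?_
      by_cases hwv : w = v
      · subst hwv; simp
      · simp only [Function.update_of_ne hwv]
        exact h w (by simpa [hwv] using hw)
    have ih' := ih ((Finset.card_le_card (Finset.subset_insert _ _)).trans hS) f' hf'
      fun G => abs_avg_le fun y => hf1 _
    obtain ⟨t, δ, hδ, hδ', htv, htw⟩ := exists_direction (insert v S) hS v
      (Finset.mem_insert_self _ _)
    -- A uniform seed remains uniform when shifted by `u • t`, for every `u`.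
    have h2 : avg (fun s : Fin k → ZMod (d.chal * M) => f (seedHash s)) =
        avg fun s : Fin k → ZMod (d.chal * M) => avg fun u : ZMod (d.chal * M) =>
          f (seedHash fun i => s i + u * (t i : ZMod (d.chal * M))) := by
      have : ∀ u : ZMod (d.chal * M), ∑ s : Fin k → ZMod (d.chal * M),
          f (seedHash fun i => s i + u * (t i : ZMod (d.chal * M))) = ∑ s : Fin k → ZMod (d.chal * M), f (seedHash s) :=
        fun u => Fintype.sum_equiv (Equiv.addRight fun i => u * (t i : ZMod (d.chal * M))) _ _
          fun s => rfl
      have hne : ((d.chal : ℝ) * M) ≠ 0 := by exact_mod_cast NeZero.ne (d.chal * M)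
      simp only [avg]
      rw [← Finset.sum_div, Finset.sum_comm]
      simp only [this, Finset.sum_const, Finset.card_univ, ZMod.card, nsmul_eq_mul]
      push_cast
      rw [mul_div_cancel_left₀ _ hne]
    -- The shift moves the value at `v` along an arithmetic progression and preserves the values at
    -- all other relevant points.
    have h3 : ∀ (s : Fin k → ZMod (d.chal * M)) (u : ZMod (d.chal * M)),
        f (seedHash fun i => s i + u * (t i : ZMod (d.chal * M))) = f (Function.update (seedHash s) v
          (bucket d.chal M (hornerSum s (encode v) + δ * u))) := by
      intro s u
      refine hf fun w hw => ?_
      simp only [seedHash]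
      rw [hornerSum_add_mul, hornerSum_intCast]
      by_cases hwv : w = v
      · subst hwv; rw [htv, Function.update_self, mul_comm u]
      · rw [htw w (by simpa using hw) hwv, Function.update_of_ne hwv]; simp [seedHash]
    have h4 : |avg (fun s : Fin k → ZMod (d.chal * M) => f (seedHash s)) -
        avg (fun s : Fin k → ZMod (d.chal * M) => f' (seedHash s))| ≤
        2 * (encodeBound n d ^ k : ℕ) / M := by
      rw [h2, ← avg_sub]
      refine abs_avg_le fun s => ?_
      simp only [h3, f']
      exact bucket_resample_gap (fun y => f (Function.update (seedHash s) v y))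
        (fun y => hf1 _) _ hδ hδ'
    rw [Finset.card_insert_of_notMem hv]
    have h5 : seedGap (M := M) k f = (avg (fun s : Fin k → ZMod (d.chal * M) => f (seedHash s)) -
        avg (fun s : Fin k → ZMod (d.chal * M) => f' (seedHash s))) + seedGap (M := M) k f' := by
      rw [seedGap, seedGap, h1]; ring
    rw [h5]
    push_cast at *
    refine (abs_add_le _ _).trans ((add_le_add h4 ih').trans (le_of_eq ?_))
    ring

/-! ## Sums of vectors that depend on few values of the hash function -/

/-- `f` is a sum of `w` vectors of norm at most one that depend on `r` values of the hash function
each. -/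
def JuntaSum (r w : ℕ) (f : Hash n d → Basis n d → ℂ) : Prop :=
  ∃ (ι : Type) (_ : Fintype ι) (F : ι → Hash n d → Basis n d → ℂ) (S : ι → Finset (Dom n d)),
    Fintype.card ι ≤ w ∧ (∀ i, (S i).card ≤ r) ∧ (∀ i, DependsOn (F i) (S i)) ∧
    (∀ i G, nsq (F i G) ≤ 1) ∧ ∀ G, f G = ∑ i, F i G

lemma juntaSum_const {ψ : Basis n d → ℂ} (hψ : nsq ψ ≤ 1) : JuntaSum 0 1 fun _ => ψ :=
  ⟨Unit, inferInstance, fun _ _ => ψ, fun _ => ∅, by simp, by simp, fun _ _ _ _ => rfl,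
    fun _ _ => hψ, by simp⟩

lemma JuntaSum.map {r w : ℕ} {f : Hash n d → Basis n d → ℂ} (hf : JuntaSum r w f)
    (L : (Basis n d → ℂ) →ₗ[ℂ] (Basis n d → ℂ)) (hL : ∀ ψ, nsq (L ψ) ≤ nsq ψ) :
    JuntaSum r w fun G => L (f G) := by
  obtain ⟨ι, _, F, S, hw, hr, hS, hF, h⟩ := hf
  refine ⟨ι, inferInstance, fun i G => L (F i G), S, hw, hr, fun i G G' hG => ?_,
    fun i G => (hL _).trans (hF i G), fun G => by simp only [h, map_sum]⟩
  simp only [hS i hG]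

/-- Restriction to a set of basis states, as a linear map. -/
def indLin (s : Set (Basis n d)) : (Basis n d → ℂ) →ₗ[ℂ] (Basis n d → ℂ) where
  toFun ψ := s.indicator ψ
  map_add' ψ φ := Set.indicator_add s ψ φ
  map_smul' z ψ := by
    funext b; by_cases hb : b ∈ s <;> simp [hb]

/-- The basis states with a given query, or without a query. -/
def queryClass : Option (Dom n d) → Set (Basis n d)
  | none => {b | b.1 = false}
  | some v => atPt v

lemma sum_queryClass (ψ : Basis n d → ℂ) : ∑ o, (queryClass o).indicator ψ = ψ := by
  classical
  funext b
  rw [Finset.sum_apply, Fintype.sum_option]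
  obtain ⟨k, v, y, r⟩ := b
  cases k
  · simp [queryClass, atPt, Set.indicator]
  · simp [queryClass, atPt, Set.indicator]

/-- Split each vector according to the queried point. On a single class the answer depends on one
further hash value, or on none if the control bit is off; the number of vectors is multiplied by the
number of classes. -/
lemma JuntaSum.query {r w : ℕ} {f : Hash n d → Basis n d → ℂ} (hf : JuntaSum r w f)
    (x : Fin d.inst) (a : Fin n → Fin d.msg) (c : Fin n → Fin d.chal) (I : Finset (Fin n)) :
    JuntaSum (r + 1) (w * (Fintype.card (Dom n d) + 1))
      fun G => query (reprog x a c I G) (f G) := by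
  classical
  obtain ⟨ι, _, F, S, hw, hr, hS, hF, h⟩ := hf
  refine ⟨ι × Option (Dom n d), inferInstance,
    fun p G => MultiRoundFS.query (reprog x a c I G) ((queryClass p.2).indicator (F p.1 G)),
    fun p => S p.1 ∪ p.2.toFinset, ?_, fun p => ?_, fun p G G' hG => ?_, fun p G => ?_, fun G => ?_⟩
  · rw [Fintype.card_prod, Fintype.card_option]
    exact Nat.mul_le_mul_right _ hw
  · refine (Finset.card_union_le _ _).trans (add_le_add (hr _) ?_)
    cases p.2 <;> simp
  · have h1 : F p.1 G = F p.1 G' := hS p.1 fun v hv => hG v (by simp [Finset.mem_coe.1 hv])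
    funext b
    simp only [MultiRoundFS.query, h1]
    obtain ⟨i, o⟩ := p
    obtain ⟨k, v, y, r⟩ := b
    cases k
    · rfl
    by_cases hv : o = some v
    · have h2 : reprog x a c I G v = reprog x a c I G' v := by
        have := hG v (by simp [hv])
        simp [reprog, this]
      simp only [queryMap, h2]
    -- A query does not change the query register, so a basis state outside the class stays outside
    -- whatever the oracle is.
    · have h3 : ∀ H : Hash n d, queryMap H (true, v, y, r) ∉ queryClass o := by
        intro H hH
        cases o with
        | none => simp [queryClass, queryMap] at hH
        | some v' => exact hv (by rw [← hH.2]; rfl)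
      rw [Set.indicator_of_notMem (h3 _), Set.indicator_of_notMem (h3 _)]
  · rw [nsq_query]
    exact (nsq_indicator_le _ _).trans (hF _ _)
  · simp only [Fintype.sum_prod_type, h]
    have : ∀ φ, MultiRoundFS.query (reprog x a c I G) φ =
        ∑ o, MultiRoundFS.query (reprog x a c I G) ((queryClass o).indicator φ) := fun φ => by
      conv_lhs => rw [← sum_queryClass φ]
      funext b
      simp [MultiRoundFS.query, Finset.sum_apply]
    rw [← Finset.sum_congr rfl fun i _ => this (F i G)]
    funext b
    simp [MultiRoundFS.query, Finset.sum_apply]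

/-- The real part of the inner product. -/
def reInner (ψ φ : Basis n d → ℂ) : ℝ := ∑ b, ((starRingEnd ℂ) (ψ b) * φ b).re

lemma abs_reInner_le {ψ φ : Basis n d → ℂ} (hψ : nsq ψ ≤ 1) (hφ : nsq φ ≤ 1) :
    |reInner ψ φ| ≤ 1 := by
  calc |reInner ψ φ| ≤ ∑ b, |((starRingEnd ℂ) (ψ b) * φ b).re| := Finset.abs_sum_le_sum_abs _ _
    _ ≤ ∑ b, (‖ψ b‖ ^ 2 + ‖φ b‖ ^ 2) / 2 := Finset.sum_le_sum fun b _ => by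
        refine (Complex.abs_re_le_norm _).trans ?_
        rw [norm_mul, RCLike.norm_conj]
        nlinarith [sq_nonneg (‖ψ b‖ - ‖φ b‖)]
    _ = (nsq ψ + nsq φ) / 2 := by
        rw [nsq, nsq, ← Finset.sum_add_distrib, Finset.sum_div]
    _ ≤ 1 := by linarith

lemma nsq_sum_eq {ι : Type*} [Fintype ι] (F : ι → Basis n d → ℂ) :
    nsq (∑ i, F i) = ∑ i, ∑ j, reInner (F i) (F j) := by
  have h1 : ∀ z : ℂ, ‖z‖ ^ 2 = ((starRingEnd ℂ) z * z).re := fun z => by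
    rw [Complex.conj_mul']; norm_cast
  simp only [nsq, reInner, h1, Finset.sum_apply, map_sum, Finset.sum_mul_sum, Complex.re_sum]
  rw [Finset.sum_comm]
  exact Finset.sum_congr rfl fun i _ => Finset.sum_comm

lemma seedGap_add [NeZero (d.chal * M)] (k : ℕ) (f g : Hash n d → ℝ) :
    seedGap (M := M) k (fun G => f G + g G) = seedGap (M := M) k f + seedGap (M := M) k g := by
  simp only [seedGap, avg, Finset.sum_add_distrib]
  ring

lemma seedGap_sum [NeZero (d.chal * M)] {ι : Type*} (s : Finset ι) (k : ℕ)
    (f : ι → Hash n d → ℝ) :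
    seedGap (M := M) k (fun G => ∑ i ∈ s, f i G) = ∑ i ∈ s, seedGap (M := M) k (f i) := by
  classical
  induction s using Finset.induction_on with
  | empty => simp [seedGap, avg]
  | insert i s hi ih => simp only [Finset.sum_insert hi, seedGap_add, ih]

/-- The error bound for a single function of at most `k` values. -/
def gapUnit (n : ℕ) (d : Sizes) (M k : ℕ) : ℝ := k * (2 * (encodeBound n d ^ k : ℕ) / M)

lemma gapUnit_nonneg (k : ℕ) : 0 ≤ gapUnit n d M k := by unfold gapUnit; positivity

/-- A squared norm is a sum of `w²` inner products. Each one depends on the hash values of two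
vectors, hence on at most `2r` of them, and is bounded by one. -/
lemma JuntaSum.abs_seedGap_nsq_le [NeZero (d.chal * M)] {r w k : ℕ} {f : Hash n d → Basis n d → ℂ}
    (hf : JuntaSum r w f) (hk : 2 * r ≤ k) :
    |seedGap (M := M) k fun G => nsq (f G)| ≤ (w : ℝ) ^ 2 * gapUnit n d M k := by
  classical
  obtain ⟨ι, _, F, S, hw, hr, hS, hF, h⟩ := hf
  simp only [h, nsq_sum_eq]
  rw [seedGap_sum]
  simp only [seedGap_sum]
  have h1 : ∀ i j, |seedGap (M := M) k fun G => reInner (F i G) (F j G)| ≤ gapUnit n d M k := by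
    intro i j
    have hc : (S i ∪ S j).card ≤ k :=
      ((Finset.card_union_le _ _).trans (add_le_add (hr i) (hr j))).trans (by omega)
    refine (abs_seedGap_le (S i ∪ S j) hc _ (fun G G' hG => ?_)
      fun G => abs_reInner_le (hF i G) (hF j G)).trans ?_
    · rw [hS i fun v hv => hG v (by simp [Finset.mem_coe.1 hv]),
        hS j fun v hv => hG v (by simp [Finset.mem_coe.1 hv])]
    · unfold gapUnit
      gcongr
  calc _ ≤ ∑ i, ∑ j, |seedGap (M := M) k fun G => reInner (F i G) (F j G)| :=
        (Finset.abs_sum_le_sum_abs _ _).trans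
          (Finset.sum_le_sum fun i _ => Finset.abs_sum_le_sum_abs _ _)
    _ ≤ ∑ _i : ι, ∑ _j : ι, gapUnit n d M k :=
        Finset.sum_le_sum fun i _ => Finset.sum_le_sum fun j _ => h1 i j
    _ = (Fintype.card ι : ℝ) ^ 2 * gapUnit n d M k := by simp; ring
    _ ≤ _ := by
        have : (Fintype.card ι : ℝ) ≤ w := by exact_mod_cast hw
        have := gapUnit_nonneg (n := n) (d := d) (M := M) k
        gcongr

/-- The final state of each run is a junta sum with one more hash value per query. Since two vectors
meet in an inner product, `2q` coefficients are enough for `q` queries. The number of good runs is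
estimated by `runs`. -/
lemma abs_seedGap_goodSum_le [NeZero (d.chal * M)] {k : ℕ} {P : AOp n d} (hP : Contracts P)
    (x : Fin d.inst) (a : Fin n → Fin d.msg) (c : Fin n → Fin d.chal)
    (l : List (AOp n d)) (hl : ∀ B ∈ l, Contracts B) (h : ℕ) {r w : ℕ}
    {f : Hash n d → Basis n d → ℂ} (hf : JuntaSum r w f) (hk : 2 * (r + l.length) ≤ k) :
    |seedGap (M := M) k fun G => goodSum (fun φ => nsq (P *ᵥ φ)) x a c G l h (f G)| ≤
      runs l.length (n - h) *
        (((w * (Fintype.card (Dom n d) + 1) ^ l.length : ℕ) : ℝ) ^ 2 * gapUnit n d M k) := by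
  induction l generalizing h r w f with
  | nil =>
    simp only [goodSum, List.length_nil, runs, pow_zero, mul_one, Nat.cast_one, one_mul]
    exact (hf.map P.mulVecLin hP).abs_seedGap_nsq_le (by simpa using hk)
  | cons B l ih =>
    have hB := hl B (by simp)
    have hl' : ∀ B ∈ l, Contracts B := fun B' h => hl B' (by simp [h])
    have hk' : 2 * (r + 1 + l.length) ≤ k := by simp at hk; omega
    set D := Fintype.card (Dom n d) + 1
    set T := ((w * D ^ (l.length + 1) : ℕ) : ℝ) ^ 2 * gapUnit n d M k with hT
    have hT' : ((w * D * D ^ l.length : ℕ) : ℝ) ^ 2 * gapUnit n d M k = T := by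
      rw [hT]; congr 3; ring
    have hT0 : 0 ≤ T := by have := gapUnit_nonneg (n := n) (d := d) (M := M) k; positivity
    have h0 := ih hl' h ((hf.query x a c (below n h)).map B.mulVecLin hB) hk'
    rw [hT'] at h0
    simp only [goodSum, List.length_cons]
    rw [seedGap_add]
    refine (abs_add_le _ _).trans ?_
    by_cases hh : h < n
    · simp only [hh, dif_pos]
      rw [seedGap_add]
      have h1 : ∀ I, |seedGap (M := M) k fun G => goodSum (fun φ => nsq (P *ᵥ φ)) x a c G l (h + 1)
          (B *ᵥ hitQuery x a c G I ⟨h, hh⟩ (f G))| ≤ runs l.length (n - (h + 1)) * T :=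
        fun I => hT' ▸ ih hl' (h + 1) (((hf.map (indLin (atPt (pt x a c ⟨h, hh⟩)))
        (nsq_indicator_le _)).query x a c I).map B.mulVecLin hB) hk'
      refine (add_le_add h0 ((abs_add_le _ _).trans
        (add_le_add (h1 (below n (h + 1))) (h1 (below n h))))).trans ?_
      have e : n - (h + 1) = n - h - 1 := by omega
      -- Only one point may be hit next in a good run, in two ways, whereas `runs` counts `2 (n -
      -- h)` branches.
      have e2 : (1 : ℝ) ≤ (n - h : ℕ) := by exact_mod_cast (by omega : 1 ≤ n - h)
      have e3 : (0 : ℝ) ≤ runs l.length (n - h - 1) * T := by positivity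
      rw [runs, e, ← hT]
      push_cast [-Nat.cast_sub]
      nlinarith
    · simp only [hh, dif_neg, not_false_iff]
      have : seedGap (n := n) (d := d) (M := M) k (fun _ => 0) = 0 := by simp [seedGap, avg]
      rw [this, abs_zero, add_zero]
      refine h0.trans (mul_le_mul_of_nonneg_right ?_ hT0)
      rw [runs]
      exact_mod_cast Nat.le_add_right _ _

end MultiRoundFS
end

noncomputable section
namespace MultiRoundFS
variable {n : ℕ} {d : Sizes} {q : ℕ}

/-! ## Rules for lower bounds on what a program achieves -/

/-- The memory after the execution of a classical program. -/
def CProg.exec : CProg → Mem → Mem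
  | .assign a e => fun m => Function.update m (a.eval m) (e.eval m)
  | .seq P Q => fun m => Q.exec (P.exec m)
  | .ite e P Q => fun m => if e.eval m ≠ 0 then P.exec m else Q.exec m
  | .loop e P => fun m => P.exec^[e.eval m] m

lemma CProg.run_fst (P : CProg) (s : Mem × ℕ) : (P.run s).1 = P.exec s.1 := by
  induction P generalizing s with
  | assign a e => rfl
  | seq P Q ihP ihQ => simp only [run, exec, ihQ, ihP]
  | ite e P Q ihP ihQ =>
    simp only [run, exec]
    split_ifs
    · rw [ihP]
    · rw [ihQ]
  | loop e P ih =>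
    simp only [run, exec]
    have : ∀ (k : ℕ) (t : Mem × ℕ),
        ((fun t : Mem × ℕ => P.run (t.1, t.2 + 1))^[k] t).1 = P.exec^[k] t.1 := by
      intro k
      induction k with
      | zero => intro t; rfl
      | succ k ihk => intro t; rw [Function.iterate_succ_apply, Function.iterate_succ_apply, ihk, ih]
    rw [this]

/-- The sum of `f` over all branches of the execution of `P`. -/
def wp (A : Adversary n d q) (P : Prog) (f : Conf n d → ℝ) (s : Conf n d) : ℝ :=
  ((P.run A s).map f).sum

/-- The vector `∑ ψ(b) |w(b)⟩|b⟩`. -/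
def liftBy (w : Basis n d → ℕ →₀ ℕ) (ψ : Basis n d → ℂ) : Full n d →₀ ℂ :=
  ∑ b, Finsupp.single (w b, b) (ψ b)

/-- The vector with the program's registers in the basis state `o`. -/
def lift (o : ℕ →₀ ℕ) (ψ : Basis n d → ℂ) : Full n d →₀ ℂ := liftBy (fun _ => o) ψ

open Classical in
lemma liftBy_apply (w : Basis n d → ℕ →₀ ℕ) (ψ : Basis n d → ℂ) (s : Full n d) :
    liftBy w ψ s = if s.1 = w s.2 then ψ s.2 else 0 := by
  obtain ⟨o, b⟩ := s
  rw [liftBy, Finsupp.finsetSum_apply, Finset.sum_eq_single b]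
  · rw [Finsupp.single_apply]
    simp [Prod.ext_iff, eq_comm]
  · intro b' _ hb
    rw [Finsupp.single_apply, if_neg]
    intro e; exact hb (Prod.ext_iff.1 e).2
  · simp

lemma smul_lift (z : ℂ) (o : ℕ →₀ ℕ) (ψ : Basis n d → ℂ) : z • lift o ψ = lift o (z • ψ) := by
  simp [lift, liftBy, Finset.smul_sum]

lemma applyLin_lift (g : Full n d → (Full n d →₀ ℂ)) (o : ℕ →₀ ℕ) (ψ : Basis n d → ℂ) :
    applyLin g (lift o ψ) = ∑ b, ψ b • g (o, b) := by
  simp [applyLin, lift, liftBy, map_sum]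

lemma applyMatrix_lift (M : AOp n d) (o : ℕ →₀ ℕ) (ψ : Basis n d → ℂ) :
    applyMatrix M (lift o ψ) = lift o (M *ᵥ ψ) := by
  rw [applyMatrix, applyLin_lift]
  simp only [lift, liftBy, Matrix.mulVec, dotProduct, Finset.smul_sum]
  rw [Finset.sum_comm]
  refine Finset.sum_congr rfl fun b' _ => ?_
  rw [Finsupp.single_finsetSum]
  refine Finset.sum_congr rfl fun b _ => ?_
  rw [Finsupp.smul_single, smul_eq_mul, mul_comm]

lemma normSq_lift (o : ℕ →₀ ℕ) (ψ : Basis n d → ℂ) : normSq (lift o ψ) = nsq ψ := by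
  classical
  have hsub : (lift o ψ).support ⊆ Finset.univ.image fun b : Basis n d => (o, b) := by
    intro s hs
    rw [Finsupp.mem_support_iff, lift, liftBy_apply] at hs
    simp only [Finset.mem_image, Finset.mem_univ, true_and]
    refine ⟨s.2, ?_⟩
    by_contra h
    apply hs
    rw [if_neg fun e => h (Prod.ext e.symm rfl)]
  rw [normSq, Finsupp.sum_of_support_subset _ hsub _ (by simp),
    Finset.sum_image (fun b _ b' _ h => (Prod.ext_iff.1 h).2)]
  exact Finset.sum_congr rfl fun b _ => by rw [lift, liftBy_apply]; simp

/-- On all configurations with the given memory and vector, `f` is at least `r`. -/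
def Above (f : Conf n d → ℝ) (m : Mem) (o : ℕ →₀ ℕ) (ψ : Basis n d → ℂ) (r : ℝ) : Prop :=
  ∀ t, r ≤ f ⟨m, t, lift o ψ⟩

section Rules

variable {A : Adversary n d q} {f : Conf n d → ℝ} {m : Mem} {o : ℕ →₀ ℕ} {ψ : Basis n d → ℂ}
  {r : ℝ}

lemma Above.mono {r' : ℝ} (h : Above f m o ψ r) (hr : r' ≤ r) : Above f m o ψ r' :=
  fun t => hr.trans (h t)

lemma wp_nonneg (hf : ∀ s, 0 ≤ f s) (P : Prog) (s : Conf n d) : 0 ≤ wp A P f s :=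
  List.sum_nonneg (by simpa using fun t _ => hf t)

lemma sum_map_flatMap {α β : Type*} (l : List α) (g : α → List β) (f : β → ℝ) :
    ((l.flatMap g).map f).sum = (l.map fun a => ((g a).map f).sum).sum := by
  induction l with
  | nil => rfl
  | cons a l ih => simp [List.flatMap_cons, ih]

lemma wp_seq_eq (P Q : Prog) (s : Conf n d) : wp A (.seq P Q) f s = wp A P (wp A Q f) s :=
  sum_map_flatMap _ _ _

lemma Above.seq {P Q : Prog} (h : Above (wp A P (wp A Q f)) m o ψ r) :
    Above (wp A (.seq P Q) f) m o ψ r := fun t => by rw [wp_seq_eq]; exact h t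

lemma Above.cl {P : CProg} (h : Above f (P.exec m) o ψ r) : Above (wp A (.cl P) f) m o ψ r := by
  intro t
  simp only [wp, Prog.run, List.map_cons, List.map_nil, List.sum_cons, List.sum_nil, add_zero]
  rw [CProg.run_fst]
  exact h _

lemma Above.ite_true {e : Exp} {P Q : Prog} (he : e.eval m ≠ 0) (h : Above (wp A P f) m o ψ r) :
    Above (wp A (.ite e P Q) f) m o ψ r := fun t => by
  simp only [wp, Prog.run, he, ne_eq, not_false_iff, if_true]
  exact h _

lemma Above.ite_false {e : Exp} {P Q : Prog} (he : e.eval m = 0) (h : Above (wp A Q f) m o ψ r) :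
    Above (wp A (.ite e P Q) f) m o ψ r := fun t => by
  simp only [wp, Prog.run, he, ne_eq, not_true, if_false]
  exact h _

lemma Above.call {e : Exp} (he : e.eval m < q)
    (h : Above f m o (A.op ⟨e.eval m, he⟩ *ᵥ ψ) r) : Above (wp A (.call e) f) m o ψ r := fun t => by
  simp only [wp, Prog.run, List.map_cons, List.map_nil, List.sum_cons, List.sum_nil, add_zero, he,
    dif_pos, applyMatrix_lift]
  exact h _

/-- The rule for loops; `R i` is the assertion with `i` iterations left. -/
lemma Above.loop {e : Exp} {P : Prog} (hf : ∀ s, 0 ≤ f s)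
    (R : ℕ → Mem → (ℕ →₀ ℕ) → (Basis n d → ℂ) → ℝ → Prop)
    (h0 : ∀ m o ψ r, R 0 m o ψ r → Above f m o ψ r)
    (hs : ∀ (i : ℕ) (g : Conf n d → ℝ), (∀ s, 0 ≤ g s) →
      (∀ m o ψ r, R i m o ψ r → Above g m o ψ r) →
      ∀ m o ψ r, R (i + 1) m o ψ r → Above (wp A P g) m o ψ r)
    (h : R (e.eval m) m o ψ r) : Above (wp A (.loop e P) f) m o ψ r := by
  -- Running an iteration first on the list of branches amounts to applying the backward transformer
  -- last to `f`.
  have key : ∀ (k : ℕ) (l : List (Conf n d)),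
      (((fun l : List (Conf n d) => l.flatMap fun t => P.run A (t.tick 1))^[k] l).map f).sum =
      (l.map ((fun (g : Conf n d → ℝ) s => wp A P g (s.tick 1))^[k] f)).sum := by
    intro k
    induction k with
    | zero => intro l; rfl
    | succ k ih =>
      intro l
      rw [Function.iterate_succ_apply, ih, sum_map_flatMap, Function.iterate_succ_apply']
      rfl
  have hpos : ∀ k s, 0 ≤ ((fun (g : Conf n d → ℝ) s => wp A P g (s.tick 1))^[k] f) s := by
    intro k
    induction k with
    | zero => exact hf
    | succ k ih =>
      intro s
      rw [Function.iterate_succ_apply']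
      exact wp_nonneg ih _ _
  have hR : ∀ k m o ψ r, R k m o ψ r →
      Above ((fun (g : Conf n d → ℝ) s => wp A P g (s.tick 1))^[k] f) m o ψ r := by
    intro k
    induction k with
    | zero => exact h0
    | succ k ih =>
      intro m o ψ r hr t
      rw [Function.iterate_succ_apply']
      exact hs k _ (hpos k) ih m o ψ r hr (t + 1)
  intro t
  simp only [wp, Prog.run]
  rw [key]
  simp only [List.map_cons, List.map_nil, List.sum_cons, List.sum_nil, add_zero]
  exact hR _ m o ψ r h _

/-- The branches of the sample carry the same vector scaled by `1/√E`, and their lower bounds add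
up. -/
lemma Above.sample {a e : Exp} {E : ℕ} (hE : e.eval m = E) (hE0 : 0 < E) (ρ : ℕ → ℝ)
    (h : ∀ k < E, Above f (Function.update m (a.eval m) k) o ((1 / (Real.sqrt E : ℂ)) • ψ) (ρ k)) :
    Above (wp A (.sample a e) f) m o ψ (∑ k ∈ Finset.range E, ρ k) := fun t => by
  simp only [wp, Prog.run, hE, max_eq_right (Nat.one_le_iff_ne_zero.2 hE0.ne'), smul_lift, List.map_map]
  rw [← List.sum_toFinset _ (List.nodup_range), List.toFinset_range]
  exact Finset.sum_le_sum fun k hk => h k (Finset.mem_range.1 hk) _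

lemma coherentEval_fst (m : Mem) (loads : List (QReg × Exp)) (P : CProg) (res : Exp)
    (target : Target) (s : Full n d) : (coherentEval m loads P res target s).1 =
      P.exec (loadAll m (target.clear m s) loads).1 (res.eval m) := by
  simp only [coherentEval, CProg.run_fst]

/-- A coherent evaluation that answers a query. -/
lemma Above.coherent_resp {loads : List (QReg × Exp)} {P : CProg} {res : Exp} {H : Hash n d}
    (hv : ∀ b : Basis n d, (coherentEval m loads P res .resp (o, b)).1 =
      if b.1 then (H b.2.1).val else 0)
    (h : Above f m o (query H ψ) r) : Above (wp A (.coherent loads P res .resp) f) m o ψ r := by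
  intro t
  simp only [wp, Prog.run, List.map_cons, List.map_nil, List.sum_cons, List.sum_nil, add_zero]
  have e : applyLin (fun b => Finsupp.single
      (Target.resp.xor m b (coherentEval m loads P res .resp b).1) 1) (lift o ψ) =
      lift o (query H ψ) := by
    rw [applyLin_lift, lift, liftBy]
    refine Fintype.sum_equiv (queryMap_involutive H).toPerm _ _ fun b => ?_
    simp only [Function.Involutive.coe_toPerm, query, queryMap_queryMap, hv, Finsupp.smul_single,
      smul_eq_mul, mul_one]
    congr 1
    obtain ⟨k, v, y, w⟩ := b
    cases k <;> simp [Target.xor, queryMap, xorResp_zero]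
  rw [e]
  exact h _

/-- A function of the basis state of the adversary is computed and measured. -/
lemma Above.measure {loads : List (QReg × Exp)} {P : CProg} {res : Exp} {h K a : ℕ}
    (hf : ∀ s, 0 ≤ f s) {val : Basis n d → ℕ} (ho : o h = 0)
    (hv : ∀ b, (coherentEval m loads P res (.own (.const h)) (o, b)).1 = val b)
    (hr : {b | val b = K}.indicator ψ = 0 → r ≤ 0)
    (hK : Above f (Function.update m a K) (o.update h K) ({b | val b = K}.indicator ψ) r) :
    Above (wp A (.seq (.coherent loads P res (.own (.const h)))
      (.measure (.const a) (.const h))) f) m o ψ r := by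
  classical
  intro t
  rw [wp_seq_eq]
  simp only [wp, Prog.run, List.map_cons, List.map_nil, List.sum_cons, List.sum_nil, add_zero,
    List.map_map, Exp.eval]
  have e : applyLin (fun b => Finsupp.single (Target.xor m b
      (coherentEval m loads P res (.own (.const h)) b).1 (.own (.const h))) 1) (lift o ψ) =
      liftBy (fun b => o.update h (val b)) ψ := by
    rw [applyLin_lift, liftBy]
    refine Finset.sum_congr rfl fun b _ => ?_
    rw [hv, Finsupp.smul_single, smul_eq_mul, mul_one]
    simp [Target.xor, Exp.eval, ho]
  rw [e]
  have hfil : (liftBy (fun b => o.update h (val b)) ψ).filter (fun b => b.1 h = K) =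
      lift (o.update h K) ({b | val b = K}.indicator ψ) := by
    ext s
    rw [Finsupp.filter_apply, lift, liftBy_apply, liftBy_apply]
    by_cases h1 : s.1 h = K
    · rw [if_pos h1]
      by_cases h2 : val s.2 = K
      · rw [Set.indicator_of_mem (show s.2 ∈ {b | val b = K} from h2), h2]
      · rw [Set.indicator_of_notMem (show s.2 ∉ {b | val b = K} from h2), ite_self, if_neg]
        intro e
        apply h2
        rw [← h1, e]; simp
    · rw [if_neg h1, if_neg]
      intro e
      apply h1
      rw [e]; simp
  -- An outcome of amplitude zero has no branch in the list; then `hr` makes the claim trivial.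
  -- Otherwise the branch with outcome `K` is kept and all others are dropped, as they contribute
  -- nonnegative amounts.
  by_cases hz : {b | val b = K}.indicator ψ = 0
  · refine (hr hz).trans (List.sum_nonneg ?_)
    simp only [List.mem_map]
    rintro _ ⟨k, _, rfl⟩
    exact hf _
  · obtain ⟨b, hb⟩ := Function.ne_iff.1 hz
    have hbK : val b = K := by
      by_contra h2
      exact hb (Set.indicator_of_notMem (s := {b | val b = K}) h2 _)
    have hψ : ψ b ≠ 0 := by
      rwa [Set.indicator_of_mem (show b ∈ {b | val b = K} from hbK)] at hb
    have hmem : K ∈ ((liftBy (fun b => o.update h (val b)) ψ).support.image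
        fun b => b.1 h).toList := by
      rw [Finset.mem_toList, Finset.mem_image]
      refine ⟨(o.update h (val b), b), ?_, by simp [hbK]⟩
      rw [Finsupp.mem_support_iff, liftBy_apply]
      simpa using hψ
    refine le_trans ?_ (List.single_le_sum (l := List.map _ _) ?_ _ (List.mem_map_of_mem hmem))
    · simp only [Function.comp]
      unfold Above at hK
      rw [← hfil] at hK
      exact hK _
    · simp only [List.mem_map]
      rintro _ ⟨k, _, rfl⟩
      exact hf _

end Rules

end MultiRoundFS
end

noncomputable section
namespace MultiRoundFS
variable {n : ℕ} {d : Sizes} {q : ℕ}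

/-! ## The program

Memory layout: `7` index of the next query, `8` flag for a pending measured query, `9` choice of the
oracle for that query, `10` modulus, `11` quotient of the modulus and the number of challenges,
`12` samples, `13` base for the modulus, `14`–`18` copies of the query registers, `19`–`21` scratch,
`22` measurement outcome, `30 + 2i` and `31 + 2i` messages and challenges, seeds from `30 + 2n`. -/

/-- The content of the cell with address `k`. -/
def cell (k : ℕ) : Exp := .mem (.const k)

/-- The remainder modulo the content of cell `10`. -/
def reduced (e : Exp) : Exp := .op .mod e (cell 10)

/-- Test for equality, with result `0` or `1`. -/
def eqExp (e₁ e₂ : Exp) : Exp :=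
  .op .sub (.const 1) (.op .add (.op .sub e₁ e₂) (.op .sub e₂ e₁))

def powExp (e : Exp) : ℕ → Exp
  | 0 => .const 1
  | k + 1 => .op .mul (powExp e k) e

@[simp] lemma cell_eval (m : Mem) (k : ℕ) : (cell k).eval m = m k := rfl

@[simp] lemma reduced_eval (m : Mem) (e : Exp) : (reduced e).eval m = e.eval m % m 10 := rfl

@[simp] lemma eqExp_eval (m : Mem) (e₁ e₂ : Exp) :
    (eqExp e₁ e₂).eval m = if e₁.eval m = e₂.eval m then 1 else 0 := by
  simp only [eqExp, Exp.eval, Op.eval]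
  split_ifs <;> omega

@[simp] lemma powExp_eval (m : Mem) (e : Exp) (k : ℕ) :
    (powExp e k).eval m = e.eval m ^ k := by
  induction k with
  | zero => rfl
  | succ k ih => simp [powExp, Exp.eval, Op.eval, ih, pow_succ]

def queryLoads : List (QReg × Exp) :=
  [(.ctrl, .const 14), (.index, .const 15), (.kind, .const 16), (.link, .const 17),
    (.msg, .const 18)]

/-- The number that represents the hash input in the cells `15`–`18`. -/
def encodeExp (n : ℕ) : Exp :=
  .op .add (.op .mul (.op .add (.op .mul (.op .add (.op .mul (cell 17) (cell 2)) (cell 18))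
    (.const 2)) (cell 16)) (.const n)) (cell 15)

/-- All loops are over the content `q` of cell `0`, so two steps are made per iteration to use `2q`
coefficients. Everything written is reduced modulo cell `10`, which keeps all numbers short. -/
def hashStep (n : ℕ) : CProg :=
  .seq (.assign (.const 19) (reduced (.op .add (.op .mul (cell 19) (encodeExp n))
      (.mem (.op .add (.const (30 + 2 * n)) (cell 20))))))
    (.assign (.const 20) (reduced (.op .add (cell 20) (.const 1))))

/-- Evaluation of the polynomial whose coefficients are the seeds. -/
def hashProg (n : ℕ) : CProg :=
  .seq (.assign (.const 19) (reduced (.const 0)))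
    (.seq (.assign (.const 20) (reduced (.const 0)))
      (.loop (cell 0) (.seq (hashStep n) (hashStep n))))

/-- The instance or challenge that belongs to the `i`-th point. -/
def linkExp (i : ℕ) : Exp := if i = 0 then cell 4 else cell (31 + 2 * (i - 1))

def kindExp (i : ℕ) : Exp := .const (if i = 0 then 0 else 1)

/-- Test whether the hash input is the `i`-th point. -/
def matchExp (i : ℕ) : Exp :=
  .op .mul (eqExp (cell 15) (.const i)) (.op .mul (eqExp (cell 16) (kindExp i))
    (.op .mul (eqExp (cell 17) (linkExp i)) (eqExp (cell 18) (cell (30 + 2 * i)))))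

/-- The answer of the oracle, reprogrammed at the first `h` points. -/
def tableExp : ℕ → Exp
  | 0 => .op .div (cell 19) (cell 11)
  | h + 1 => .op .add (.op .mul (matchExp h) (cell (31 + 2 * h)))
      (.op .mul (.op .sub (.const 1) (matchExp h)) (tableExp h))

def answerProg (n h : ℕ) : CProg :=
  .seq (hashProg n) (.assign (.const 21) (reduced (.op .mul (cell 14) (tableExp h))))

/-- Answer a query of the adversary, with the oracle reprogrammed at the first `h` points. -/
def queryProg (n h : ℕ) : Prog := .coherent queryLoads (answerProg n h) (.const 21) .resp

/-- Combination of an instance or challenge and a message. -/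
def packExp : Exp := .op .add (.const 1) (.op .add (.op .mul (cell 17) (cell 2)) (cell 18))

/-- The value `0` means that the query does not have the required form; `packExp` is never `0`. -/
def hitExp (h : ℕ) : Exp :=
  .op .mul (cell 14) (.op .mul (eqExp (cell 15) (.const h))
    (.op .mul (eqExp (cell 16) (kindExp h)) packExp))

/-- Measure whether a query has the form of the `h`-th point and, if so, which one. -/
def measureQuery (h : ℕ) : Prog :=
  .seq (.coherent queryLoads (.assign (.const 21) (reduced (hitExp h))) (.const 21)
    (.own (.const h))) (.measure (.const 22) (.const h))

/-- Measure the instance and the `h`-th message in the output registers. -/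
def measureOutput (h : ℕ) : Prog :=
  .seq (.coherent [(.outInst, .const 17), (.outMsg (.const h), .const 18)]
    (.assign (.const 21) (reduced packExp)) (.const 21) (.own (.const h)))
    (.measure (.const 22) (.const h))

def nop : CProg := .assign (.const 12) (cell 12)

/-- Record the outcome of a measurement as the `h`-th message (and the instance). -/
def recordProg (h : ℕ) : CProg :=
  .seq (.assign (.const (30 + 2 * h))
      (reduced (.op .mod (.op .sub (cell 22) (.const 1)) (cell 2))))
    (.seq (.assign (.const 5) (cell (30 + 2 * h)))
      (if h = 0 then
        .assign (.const 4) (reduced (.op .div (.op .sub (cell 22) (.const 1)) (cell 2)))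
      else nop))

def setTo (k : ℕ) (e : Exp) : CProg := .assign (.const k) (reduced e)

/-- Apply the adversary's next operator. -/
def applyNext : Prog :=
  .seq (.call (cell 7)) (.cl (setTo 7 (.op .add (cell 7) (.const 1))))

def advance (n h : ℕ) : Prog := .seq (queryProg n h) applyNext

/-- The measured query stays unanswered until the challenge arrives, since the answer may have to
come from the oracle reprogrammed with it. Which oracle answers is decided now, by the parity of the
sample in cell `12`. -/
def hitProg (h : ℕ) : Prog :=
  .seq (measureQuery h) (.seq (.cl (recordProg h))
    (.seq (.cl (setTo 9 (.op .mod (cell 12) (.const 2)))) (.cl (setTo 8 (.const 1)))))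

/-- The number of remaining queries. -/
def remExp : Exp := .op .sub (cell 0) (cell 7)

/-- The number of choices at a query. -/
def rangeExp (n k : ℕ) : Exp := powExp (.op .add (.op .mul (.const 2) remExp) (.const n)) k

/-- The number of choices that lead to a measurement of the query. -/
def hitRangeExp (n k : ℕ) : Exp :=
  .op .mul (.const (2 * k)) (powExp (.op .add (.op .mul (.const 2)
    (.op .sub remExp (.const 1))) (.const n)) (k - 1))

/-- The truncated difference is nonzero exactly if the sample is below `hitRangeExp`; in that case
the query is measured. -/
def stepProg (n h : ℕ) : Prog :=
  .seq (.sample (.const 12) (reduced (rangeExp n (n - h))))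
    (.ite (.op .sub (hitRangeExp n (n - h)) (cell 12)) (hitProg h) (advance n h))

/-- Run the adversary until a query is measured as the `h`-th point, or else measure the output. -/
def searchProg (n h : ℕ) : Prog :=
  .seq (.loop (cell 0) (.ite (.op .mul remExp (.op .sub (.const 1) (cell 8)))
      (stepProg n h) (.cl nop)))
    (.ite (cell 8) (.cl nop) (.seq (measureOutput h) (.cl (recordProg h))))

/-- Store the `h`-th challenge and answer a pending query. -/
def resumeProg (n h : ℕ) : Prog :=
  .seq (.cl (.assign (.const (31 + 2 * h)) (cell 6)))
    (.ite (cell 8)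
      (.seq (.ite (cell 9) (queryProg n (h + 1)) (queryProg n h))
        (.seq applyNext (.cl (setTo 8 (.const 0)))))
      (.cl nop))

/-- Run the adversary to the end. -/
def finishProg (n : ℕ) : Prog := .loop (cell 0) (.ite remExp (advance n n) (.cl nop))

/-- An upper bound for all relevant quantities. -/
def baseExp (n : ℕ) : Exp :=
  .op .add (.op .mul (.op .mul (.op .mul (.op .add (cell 1) (cell 3)) (cell 2)) (.const 2))
    (.const n)) (.op .add (.op .mul (.const 2) (cell 0)) (.const (n + 2)))

/-- The computation of the modulus. -/
def initProg (n : ℕ) : CProg :=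
  .seq (.assign (.const 13) (baseExp n)) (.seq (.assign (.const 11) (powExp (cell 13) (2 * n + 8)))
    (.seq (.loop (cell 0) (.assign (.const 11) (.op .mul (cell 11) (powExp (cell 13) 4))))
      (.assign (.const 10) (.op .mul (cell 3) (cell 11)))))

def seedStep (n : ℕ) : Prog :=
  .seq (.sample (.op .add (.const (30 + 2 * n)) (cell 20)) (cell 10))
    (.cl (setTo 20 (.op .add (cell 20) (.const 1))))

def seedProg (n : ℕ) : Prog := .loop (cell 0) (.seq (seedStep n) (seedStep n))

/-- The simulator. -/
def simulator (n : ℕ) (i : Fin (n + 1)) : Prog :=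
  .seq (if i.val = 0 then .seq (.cl (initProg n)) (seedProg n) else resumeProg n (i.val - 1))
    (if i.val < n then searchProg n i.val else finishProg n)

/-! ## Correctness of the answers to queries -/

/-- The state of the memory during a run: `l` are the seeds, the first `hm` messages and the first
`hc` challenges are known, and the `j`-th query is next. -/
structure Ready (n : ℕ) (d : Sizes) (q M : ℕ) (l : ℕ → ℕ) (x : Fin d.inst) (a : Fin n → Fin d.msg)
    (c : Fin n → Fin d.chal) (hm hc j : ℕ) (m : Mem) : Prop where
  queries : m 0 = q
  msg : m 2 = d.msg
  modulus : m 10 = d.chal * M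
  divisor : m 11 = M
  next : m 7 = j
  seeds : ∀ i < 2 * q, m (30 + 2 * n + i) = l i
  inst : 0 < hm → m 4 = x
  msgs : ∀ i : Fin n, i.val < hm → m (30 + 2 * i) = a i
  chals : ∀ i : Fin n, i.val < hc → m (31 + 2 * i) = c i

variable {M : ℕ} {l : ℕ → ℕ} {x : Fin d.inst} {a : Fin n → Fin d.msg} {c : Fin n → Fin d.chal}
  {hm hc j : ℕ} {m : Mem}

/-- Two memories agree except on scratch cells. -/
def SameData (m m' : Mem) : Prop :=
  ∀ k, (k = 0 ∨ k = 2 ∨ k = 4 ∨ k = 7 ∨ k = 10 ∨ k = 11 ∨ 30 ≤ k) → m' k = m k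

lemma Ready.congr {m' : Mem} (h : Ready n d q M l x a c hm hc j m) (e : SameData m m') :
    Ready n d q M l x a c hm hc j m' where
  queries := (e _ (by simp)).trans h.queries
  msg := (e _ (by simp)).trans h.msg
  modulus := (e _ (by simp)).trans h.modulus
  divisor := (e _ (by simp)).trans h.divisor
  next := (e _ (by simp)).trans h.next
  seeds i hi := (e _ (by omega)).trans (h.seeds i hi)
  inst hi := (e _ (by simp)).trans (h.inst hi)
  msgs i hi := (e _ (by omega)).trans (h.msgs i hi)
  chals i hi := (e _ (by omega)).trans (h.chals i hi)

lemma sameData_update {k : ℕ} (hk : k < 30) (h0 : k ≠ 0) (h2 : k ≠ 2) (h4 : k ≠ 4) (h7 : k ≠ 7)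
    (h10 : k ≠ 10) (h11 : k ≠ 11) (v : ℕ) : SameData m (Function.update m k v) := fun i hi =>
  Function.update_of_ne (by omega) _ _

lemma SameData.trans {m' m'' : Mem} (h : SameData m m') (h' : SameData m' m'') :
    SameData m m'' := fun k hk => (h' k hk).trans (h k hk)

/-- Whether the hash input starts with an instance or with a challenge. -/
def kindOf (v : Dom n d) : ℕ := Sum.elim (fun _ => 0) (fun _ => 1) v.2.1

/-- The instance or challenge in a hash input. -/
def linkOf (v : Dom n d) : ℕ := Sum.elim Fin.val Fin.val v.2.1

lemma eq_pt_iff (v : Dom n d) (i : Fin n) : v = pt x a c i ↔ v.1.val = i.val ∧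
    kindOf v = (if i.val = 0 then 0 else 1) ∧
    linkOf v = (if i.val = 0 then x.val else (c ⟨i.val - 1, by omega⟩).val) ∧
    v.2.2.val = (a i).val := by
  obtain ⟨k, s, y⟩ := v
  by_cases hi : i.val = 0
  · rcases s with s | s <;> simp [pt, kindOf, linkOf, hi, Fin.ext_iff]
  · rcases s with s | s <;> simp [pt, kindOf, linkOf, hi, Fin.ext_iff]

/-- The memory after the query registers have been loaded. -/
structure Loaded (m : Mem) (b : Basis n d) (m' : Mem) : Prop where
  same : SameData m m'
  ctrl : m' 14 = b.1.toNat
  index : m' 15 = b.2.1.1.val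
  kind : m' 16 = kindOf b.2.1
  link : m' 17 = linkOf b.2.1
  msg : m' 18 = b.2.1.2.2.val

lemma Loaded.update {b : Basis n d} {m' : Mem} (h : Loaded m b m') {k : ℕ}
    (hk : k = 19 ∨ k = 20 ∨ k = 21) (v : ℕ) : Loaded m b (Function.update m' k v) where
  same := h.same.trans (sameData_update (by omega) (by omega) (by omega) (by omega) (by omega)
    (by omega) (by omega) v)
  ctrl := by rw [Function.update_of_ne (by omega), h.ctrl]
  index := by rw [Function.update_of_ne (by omega), h.index]
  kind := by rw [Function.update_of_ne (by omega), h.kind]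
  link := by rw [Function.update_of_ne (by omega), h.link]
  msg := by rw [Function.update_of_ne (by omega), h.msg]

lemma loaded_queryLoads (m : Mem) (o : ℕ →₀ ℕ) (b : Basis n d) (t : Target) :
    Loaded m b (loadAll m (t.clear m (o, b)) queryLoads).1 := by
  cases t <;>
  · simp only [loadAll, queryLoads, List.foldl_cons, List.foldl_nil, QReg.read, Target.clear,
      Exp.eval]
    constructor
    · intro k hk
      simp only [Function.update_apply]
      rw [if_neg (by omega), if_neg (by omega), if_neg (by omega), if_neg (by omega),
        if_neg (by omega)]
    all_goals rfl

/-- The Horner scheme modulo `N`. -/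
def hornerNat (N : ℕ) (l : ℕ → ℕ) (v : ℕ) : ℕ → ℕ
  | 0 => 0
  | i + 1 => (hornerNat N l v i * v + l i) % N

lemma hornerNat_lt {N : ℕ} (hN : 0 < N) (v k : ℕ) : hornerNat N l v k < N := by
  cases k with
  | zero => exact hN
  | succ k => exact Nat.mod_lt _ hN

lemma cast_hornerNat (N : ℕ) (v k : ℕ) : (hornerNat N l v k : ZMod N) =
    hornerSum (fun i : Fin k => (l i : ZMod N)) (v : ZMod N) := by
  induction k with
  | zero => simp [hornerNat, hornerSum]
  | succ k ih =>
    rw [hornerNat, ZMod.natCast_mod]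
    push_cast
    rw [ih, hornerSum, hornerSum, Fin.sum_univ_castSucc, Finset.sum_mul]
    congr 1
    · refine Finset.sum_congr rfl fun i _ => ?_
      rw [mul_assoc, ← pow_succ]
      have : k - 1 - i.val + 1 = k + 1 - 1 - i.val := by omega
      simp [this]
    · simp

/-- The hash function with seed `l`. -/
def listHash (n : ℕ) (d : Sizes) (q M : ℕ) [NeZero (d.chal * M)] (l : ℕ → ℕ) : Hash n d :=
  seedHash fun i : Fin (2 * q) => (l i : ZMod (d.chal * M))

lemma listHash_val [NeZero (d.chal * M)] (v : Dom n d) :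
    (listHash n d q M l v).val = hornerNat (d.chal * M) l (encode v) (2 * q) / M := by
  simp only [listHash, seedHash, bucket]
  rw [← cast_hornerNat, ZMod.val_cast_of_lt (hornerNat_lt (Nat.pos_of_ne_zero (NeZero.ne _)) _ _)]

lemma encodeExp_eval {b : Basis n d} {m' : Mem} (hm2 : m 2 = d.msg) (h : Loaded m b m') :
    (encodeExp n).eval m' = encode b.2.1 := by
  simp only [encodeExp, Exp.eval, Op.eval, cell_eval, h.index, h.kind, h.link, h.msg,
    (h.same 2 (by simp)).trans hm2]
  rfl

/-- The bound `2q < |𝒞| · M` makes the reduction of the loop counter in cell `20` harmless. -/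
lemma hashStep_exec (hq : 2 * q < d.chal * M) (hr : Ready n d q M l x a c hm hc j m)
    {b : Basis n d} {m' : Mem} (h : Loaded m b m') {i : ℕ} (hi : i < 2 * q)
    (h19 : m' 19 = hornerNat (d.chal * M) l (encode b.2.1) i) (h20 : m' 20 = i) :
    Loaded m b ((hashStep n).exec m') ∧
    (hashStep n).exec m' 19 = hornerNat (d.chal * M) l (encode b.2.1) (i + 1) ∧
    (hashStep n).exec m' 20 = i + 1 := by
  have h10 : m' 10 = d.chal * M := (h.same 10 (by simp)).trans hr.modulus
  have hs : m' (30 + 2 * n + i) = l i := (h.same _ (by omega)).trans (hr.seeds i hi)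
  simp only [hashStep, CProg.exec, Exp.eval, cell_eval, Op.eval, reduced_eval,
    encodeExp_eval hr.msg h, h19, h20, h10, hs]
  refine ⟨(h.update (by simp) _).update (by simp) _, ?_, ?_⟩
  · simp [hornerNat]
  · simp [h20, h10]
    rw [Nat.mod_eq_of_lt (by omega)]

lemma hashProg_exec (hq : 2 * q < d.chal * M) (hr : Ready n d q M l x a c hm hc j m)
    {b : Basis n d} {m' : Mem} (h : Loaded m b m') :
    Loaded m b ((hashProg n).exec m') ∧
    (hashProg n).exec m' 19 = hornerNat (d.chal * M) l (encode b.2.1) (2 * q) := by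
  set m₀ := Function.update (Function.update m' 19 0) 20 0
  have hm₀ : Loaded m b m₀ := (h.update (by simp) _).update (by simp) _
  have e : (hashProg n).exec m' =
      (CProg.seq (hashStep n) (hashStep n)).exec^[q] m₀ := by
    have h0 : m' 0 = q := (h.same 0 (by simp)).trans hr.queries
    simp [hashProg, CProg.exec, Exp.eval, h0, m₀]
  rw [e]
  have key : ∀ k ≤ q, Loaded m b ((CProg.seq (hashStep n) (hashStep n)).exec^[k] m₀) ∧
      (CProg.seq (hashStep n) (hashStep n)).exec^[k] m₀ 19 =
        hornerNat (d.chal * M) l (encode b.2.1) (2 * k) ∧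
      (CProg.seq (hashStep n) (hashStep n)).exec^[k] m₀ 20 = 2 * k := by
    intro k
    induction k with
    | zero => exact fun _ => ⟨hm₀, by simp [m₀, hornerNat], by simp [m₀]⟩
    | succ k ih =>
      intro hk
      obtain ⟨h1, h2, h3⟩ := ih (by omega)
      obtain ⟨h4, h5, h6⟩ := hashStep_exec hq hr h1 (by omega) h2 h3
      rw [Function.iterate_succ_apply']
      exact hashStep_exec (i := 2 * k + 1) hq hr h4 (by omega) h5 h6
  exact ⟨(key q le_rfl).1, (key q le_rfl).2.1⟩

lemma kindExp_eval (i : ℕ) : (kindExp i).eval m = if i = 0 then 0 else 1 := rfl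

lemma linkExp_eval (hr : Ready n d q M l x a c hm hc j m) {i : Fin n} (h1 : i.val < hm)
    (h2 : i.val ≤ hc) : (linkExp i).eval m =
      if i.val = 0 then x.val else (c ⟨i.val - 1, by omega⟩).val := by
  unfold linkExp
  split_ifs with hi
  · exact hr.inst (by omega)
  · exact hr.chals ⟨i.val - 1, by omega⟩ (by simp; omega)

/-- `i ≤ hc` suffices, because the location of the point `i` involves only the preceding challenge.
-/
lemma matchExp_eval (hr : Ready n d q M l x a c hm hc j m) {b : Basis n d} {m' : Mem}
    (h : Loaded m b m') {i : Fin n} (h1 : i.val < hm) (h2 : i.val ≤ hc) :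
    (matchExp i).eval m' = if b.2.1 = pt x a c i then 1 else 0 := by
  have hr' := hr.congr h.same
  simp only [matchExp, Exp.eval, Op.eval, eqExp_eval, cell_eval, kindExp_eval,
    linkExp_eval hr' h1 h2, hr'.msgs i h1, h.index, h.kind, h.link, h.msg, eq_pt_iff]
  split_ifs <;> simp_all

lemma reprog_below_succ {h : ℕ} (hh : h < n) (G : Hash n d) (v : Dom n d) :
    reprog x a c (below n (h + 1)) G v =
      if v = pt x a c ⟨h, hh⟩ then c ⟨h, hh⟩ else reprog x a c (below n h) G v := by
  rw [reprog_update x a c hh]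
  split_ifs with e
  · subst e; simp [reprog, pt]
  · simp only [reprog, Function.update_of_ne e]

lemma tableExp_eval [NeZero (d.chal * M)] (hr : Ready n d q M l x a c hm hc j m) {b : Basis n d}
    {m' : Mem} (h : Loaded m b m')
    (h19 : m' 19 = hornerNat (d.chal * M) l (encode b.2.1) (2 * q)) (k : ℕ) (h1 : k ≤ hm)
    (h2 : k ≤ hc) (h3 : k ≤ n) :
    (tableExp k).eval m' = (reprog x a c (below n k) (listHash n d q M l) b.2.1).val := by
  have hr' := hr.congr h.same
  induction k with
  | zero =>
    have : reprog x a c (below n 0) (listHash n d q M l) = listHash n d q M l :=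
      funext fun w => by simp [reprog]
    rw [this, listHash_val, ← h19]
    simp [tableExp, Exp.eval, Op.eval, hr'.divisor]
  | succ k ih =>
    have hk : k < n := h3
    rw [reprog_below_succ hk]
    have hmatch := matchExp_eval hr h (i := ⟨k, hk⟩) (by simp; omega) (by simp; omega)
    have hchal : m' (31 + 2 * k) = c ⟨k, hk⟩ := hr'.chals ⟨k, hk⟩ h2
    simp only [tableExp, Exp.eval, Op.eval, hmatch, ih (by omega) (by omega) (by omega), cell_eval,
      hchal]
    split_ifs <;> simp

lemma answer_eval [NeZero (d.chal * M)] (hq : 2 * q < d.chal * M)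
    (hr : Ready n d q M l x a c hm hc j m) {k : ℕ} (h1 : k ≤ hm) (h2 : k ≤ hc) (h3 : k ≤ n)
    (o : ℕ →₀ ℕ) (b : Basis n d) :
    (coherentEval m queryLoads (answerProg n k) (.const 21) .resp (o, b)).1 =
      if b.1 then (reprog x a c (below n k) (listHash n d q M l) b.2.1).val else 0 := by
  have hM : 0 < M := Nat.pos_of_ne_zero fun h => NeZero.ne (d.chal * M) (by simp [h])
  rw [coherentEval_fst]
  obtain ⟨h4, h5⟩ := hashProg_exec hq hr (loaded_queryLoads m o b .resp)
  simp only [answerProg, CProg.exec, Exp.eval, Function.update_self, reduced_eval, Op.eval,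
    tableExp_eval hr h4 h5 k h1 h2 h3, cell_eval, h4.ctrl, (h4.same 10 (by simp)).trans hr.modulus]
  have hlt := (reprog x a c (below n k) (listHash n d q M l) b.2.1).isLt
  cases b.1
  · simp
  · simp only [Bool.toNat_true, one_mul, if_true]
    exact Nat.mod_eq_of_lt (hlt.trans_le (Nat.le_mul_of_pos_right _ hM))

variable {A : Adversary n d q} {f : Conf n d → ℝ} {o : ℕ →₀ ℕ} {ψ : Basis n d → ℂ} {r : ℝ}

lemma above_queryProg [NeZero (d.chal * M)] (hq : 2 * q < d.chal * M)
    (hr : Ready n d q M l x a c hm hc j m) {k : ℕ} (h1 : k ≤ hm) (h2 : k ≤ hc) (h3 : k ≤ n)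
    (h : Above f m o (query (reprog x a c (below n k) (listHash n d q M l)) ψ) r) :
    Above (wp A (queryProg n k) f) m o ψ r :=
  Above.coherent_resp (answer_eval hq hr h1 h2 h3 o) h

end MultiRoundFS
end

noncomputable section
namespace MultiRoundFS
variable {n : ℕ} {d : Sizes} {q : ℕ}

/-! ## Correctness of the measurements -/

variable {M : ℕ} {l : ℕ → ℕ} {x : Fin d.inst} {a : Fin n → Fin d.msg} {c : Fin n → Fin d.chal}
  {hm hc j : ℕ} {m : Mem}

lemma linkOf_lt (v : Dom n d) : linkOf v < d.inst + d.chal := by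
  obtain ⟨k, s, y⟩ := v
  rcases s with s | s
  · exact s.isLt.trans_le (Nat.le_add_right _ _)
  · exact s.isLt.trans_le (Nat.le_add_left _ _)

lemma pack_lt {L y X N : ℕ} {K : ℕ} (hL : L < X) (hy : y < N) (hK : X * N < K) :
    1 + (L * N + y) < K := by
  have : (L + 1) * N ≤ X * N := Nat.mul_le_mul_right _ hL
  nlinarith

variable {A : Adversary n d q} {f : Conf n d → ℝ} {o : ℕ →₀ ℕ} {ψ : Basis n d → ℂ} {r : ℝ}

/-- The outcome of the measurement of a query at the `h`-th point. -/
def hitCode (x : Fin d.inst) (a : Fin n → Fin d.msg) (c : Fin n → Fin d.chal) (h : Fin n) : ℕ :=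
  1 + ((if h.val = 0 then x.val else (c ⟨h.val - 1, by omega⟩).val) * d.msg + (a h).val)

/-- By `hN` the packed value is below the modulus, so its reduction is injective and the outcome
identifies the point. Only the outcome that belongs to the fixed `x`, `a`, `c` is followed. -/
lemma above_measureQuery (hN : (d.inst + d.chal) * d.msg < d.chal * M)
    (hr : Ready n d q M l x a c hm hc j m) (h : Fin n) (hf : ∀ s, 0 ≤ f s) (ho : o h = 0)
    (hz : (atPt (pt x a c h)).indicator ψ = 0 → r ≤ 0)
    (hK : Above f (Function.update m 22 (hitCode x a c h)) (o.update h (hitCode x a c h))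
      ((atPt (pt x a c h)).indicator ψ) r) :
    Above (wp A (measureQuery h) f) m o ψ r := by
  set val : Basis n d → ℕ := fun b => b.1.toNat * ((if b.2.1.1.val = h then 1 else 0) *
    ((if kindOf b.2.1 = if h.val = 0 then 0 else 1 then 1 else 0) *
      (1 + (linkOf b.2.1 * d.msg + b.2.1.2.2.val)))) % (d.chal * M) with hval
  have hev : ∀ b, (coherentEval m queryLoads (.assign (.const 21) (reduced (hitExp h)))
      (.const 21) (.own (.const h)) (o, b)).1 = val b := by
    intro b
    have hl := loaded_queryLoads m o b (.own (.const h))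
    rw [coherentEval_fst]
    simp only [CProg.exec, Exp.eval, Function.update_self, reduced_eval, hitExp, Op.eval,
      eqExp_eval, kindExp_eval, packExp, cell_eval, hl.ctrl, hl.index, hl.kind, hl.link, hl.msg,
      (hl.same 10 (by simp)).trans hr.modulus, (hl.same 2 (by simp)).trans hr.msg, hval]
  have hset : {b | val b = hitCode x a c h} = atPt (pt x a c h) := by
    ext b
    have hlt := pack_lt (linkOf_lt b.2.1) b.2.1.2.2.isLt hN
    simp only [Set.mem_ofPred_eq, hval, atPt, eq_pt_iff, hitCode]
    constructor
    · intro e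
      -- Otherwise some test factor vanishes and the code is `0`, whereas `hitCode` is at least `1`.
      have : b.1 = true ∧ b.2.1.1.val = h ∧ kindOf b.2.1 = if h.val = 0 then 0 else 1 := by
        by_contra hne
        rw [show b.1.toNat * ((if b.2.1.1.val = h then 1 else 0) *
          ((if kindOf b.2.1 = if h.val = 0 then 0 else 1 then 1 else 0) *
            (1 + (linkOf b.2.1 * d.msg + b.2.1.2.2.val)))) = 0 by
          by_cases h1 : b.1 = true
          · by_cases h2 : b.2.1.1.val = h
            · rw [if_neg fun h3 => hne ⟨h1, h2, h3⟩]; simp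
            · rw [if_neg h2]; simp
          · simp [h1]] at e
        simp at e; omega
      obtain ⟨h1, h2, h3⟩ := this
      simp only [h1, h2, h3, if_true, Bool.toNat_true, one_mul, Nat.mod_eq_of_lt hlt] at e
      obtain ⟨h4, h5⟩ := mul_add_inj b.2.1.2.2.isLt (a h).isLt (Nat.add_left_cancel e)
      exact ⟨h1, h2, h3, h4, h5⟩
    · rintro ⟨h1, h2, h3, h4, h5⟩
      simp only [h1, h2, h3, if_true, Bool.toNat_true, one_mul, Nat.mod_eq_of_lt hlt]
      rw [h4, h5]
  refine Above.measure (K := hitCode x a c h) hf ho hev ?_ ?_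
  · rw [hset]; exact hz
  · rw [hset]; exact hK

/-- The instance is measured together with the message for every `h`. This loses nothing, as only
outputs with instance `x` count in the end. -/
lemma above_measureOutput (hN : (d.inst + d.chal) * d.msg < d.chal * M)
    (hr : Ready n d q M l x a c hm hc j m) (h : Fin n) (hf : ∀ s, 0 ≤ f s) (ho : o h = 0)
    (hz : {b : Basis n d | b.2.2.2.1 = x ∧ b.2.2.2.2.1 h = a h}.indicator ψ = 0 → r ≤ 0)
    (hK : Above f (Function.update m 22 (1 + (x.val * d.msg + (a h).val)))
      (o.update h (1 + (x.val * d.msg + (a h).val)))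
      ({b : Basis n d | b.2.2.2.1 = x ∧ b.2.2.2.2.1 h = a h}.indicator ψ) r) :
    Above (wp A (measureOutput h) f) m o ψ r := by
  set val : Basis n d → ℕ := fun b =>
    (1 + (b.2.2.2.1.val * d.msg + (b.2.2.2.2.1 h).val)) % (d.chal * M) with hval
  have hev : ∀ b, (coherentEval m [(.outInst, .const 17), (.outMsg (.const h), .const 18)]
      (.assign (.const 21) (reduced packExp)) (.const 21) (.own (.const h)) (o, b)).1 = val b := by
    intro b
    rw [coherentEval_fst]
    simp [CProg.exec, Exp.eval, reduced_eval, packExp, Op.eval, loadAll,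
      QReg.read, Target.clear, hval, hr.modulus, hr.msg, Function.update_apply]
  have hX : ∀ y : Fin d.inst, y.val < d.inst + d.chal := fun y => by omega
  have hset : {b | val b = 1 + (x.val * d.msg + (a h).val)} =
      {b : Basis n d | b.2.2.2.1 = x ∧ b.2.2.2.2.1 h = a h} := by
    ext b
    simp only [Set.mem_ofPred_eq, hval,
      Nat.mod_eq_of_lt (pack_lt (hX b.2.2.2.1) (b.2.2.2.2.1 h).isLt hN)]
    constructor
    · intro e
      obtain ⟨h4, h5⟩ := mul_add_inj (b.2.2.2.2.1 h).isLt (a h).isLt (Nat.add_left_cancel e)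
      exact ⟨Fin.ext h4, Fin.ext h5⟩
    · rintro ⟨h4, h5⟩
      rw [h4, h5]
  refine Above.measure (K := 1 + (x.val * d.msg + (a h).val)) hf ho hev ?_ ?_
  · rw [hset]; exact hz
  · rw [hset]; exact hK

/-! ## Correctness of the stages -/

lemma recordProg_exec (hN : (d.inst + d.chal) * d.msg < d.chal * M) (h : Fin n)
    (hr : Ready n d q M l x a c h hc j m) {L : ℕ} (hL : L < d.inst + d.chal)
    (hx : h.val = 0 → L = x)
    (h22 : m 22 = 1 + (L * d.msg + (a h).val)) :
    Ready n d q M l x a c (h + 1) hc j ((recordProg h).exec m) ∧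
    (recordProg h).exec m 5 = a h ∧ ∀ k, 6 ≤ k → k < 30 → (recordProg h).exec m k = m k := by
  have hpos : 0 < d.msg := (Nat.zero_le _).trans_lt (a h).isLt
  have e1 : (L * d.msg + (a h).val) % d.msg % (d.chal * M) = a h := by
    rw [Nat.mul_comm, Nat.mul_add_mod, Nat.mod_eq_of_lt (a h).isLt, Nat.mod_eq_of_lt]
    have := pack_lt hL (a h).isLt hN
    omega
  have e2 : (L * d.msg + (a h).val) / d.msg % (d.chal * M) = L := by
    rw [Nat.mul_comm, Nat.mul_add_div hpos, Nat.div_eq_of_lt (a h).isLt, add_zero, Nat.mod_eq_of_lt]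
    have := pack_lt hL (a h).isLt hN
    nlinarith
  have key : ∀ m' : Mem, m' (30 + 2 * h) = a h → (h.val = 0 → m' 4 = x) →
      (∀ k : ℕ, k ≠ 30 + 2 * h.val → k ≠ 5 → (h.val = 0 → k ≠ 4) → m' k = m k) →
      Ready n d q M l x a c (h + 1) hc j m' := by
    intro m' h1 h2 h3
    have hlt := h.isLt
    exact
    { queries := (h3 _ (by omega) (by omega) (by omega)).trans hr.queries
      msg := (h3 _ (by omega) (by omega) (by omega)).trans hr.msg
      modulus := (h3 _ (by omega) (by omega) (by omega)).trans hr.modulus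
      divisor := (h3 _ (by omega) (by omega) (by omega)).trans hr.divisor
      next := (h3 _ (by omega) (by omega) (by omega)).trans hr.next
      seeds := fun i hi => (h3 _ (by omega) (by omega) (by omega)).trans (hr.seeds i hi)
      inst := fun _ => by
        rcases Nat.eq_zero_or_pos h.val with e | e
        · exact h2 e
        · exact (h3 _ (by omega) (by omega) (by omega)).trans (hr.inst e)
      msgs := fun i hi => by
        rcases Nat.lt_succ_iff_lt_or_eq.1 hi with hi | hi
        · exact (h3 _ (by omega) (by omega) (by omega)).trans (hr.msgs i hi)
        · rw [Fin.ext hi]; exact h1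
      chals := fun i hi => (h3 _ (by omega) (by omega) (by omega)).trans (hr.chals i hi) }
  have h10 := hr.modulus
  have h2 := hr.msg
  have s1 : (m 22 - 1) % m 2 % m 10 = a h := by rw [h22, h10, h2, Nat.add_sub_cancel_left, e1]
  have s2 : (m 22 - 1) / m 2 % m 10 = L := by rw [h22, h10, h2, Nat.add_sub_cancel_left, e2]
  by_cases h0 : h.val = 0
  · have ex : (recordProg h).exec m = Function.update (Function.update (Function.update m
        (30 + 2 * h) (a h)) 5 (a h)) 4 x := by
      simp [recordProg, CProg.exec, Exp.eval, Op.eval, h0, s1, s2, hx]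
    rw [ex]
    refine ⟨key _ ?_ ?_ ?_, ?_, ?_⟩
    · simp [h0]
    · simp
    · intro k h1 h2 h3
      simp [h1, h2, h3 h0]
    · simp
    · intro k h1 h2
      simp only [Function.update_apply]
      rw [if_neg (by omega), if_neg (by omega), if_neg (by omega)]
  · have ex : (recordProg h).exec m = Function.update (Function.update m
        (30 + 2 * h) (a h)) 5 (a h) := by
      simp only [recordProg, h0, if_false, CProg.exec, Exp.eval, Op.eval, reduced_eval, cell_eval,
        s1, nop, Function.update_self]
      rw [Function.update_eq_self_iff]
    rw [ex]
    refine ⟨key _ ?_ ?_ ?_, ?_, ?_⟩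
    · simp only [Function.update_apply]
      rw [if_neg (by omega)]
      simp
    · exact fun e => absurd e h0
    · intro k h1 h2 h3
      simp [h1, h2]
    · simp
    · intro k h1 h2
      simp only [Function.update_apply]
      rw [if_neg (by omega), if_neg (by omega)]

lemma ops_drop {j : ℕ} (hj : j < q) :
    A.ops.drop j = A.op ⟨j, hj⟩ :: A.ops.drop (j + 1) := by
  have h : j < A.ops.length := by rw [Adversary.length_ops]; exact hj
  rw [List.drop_eq_getElem_cons h]
  simp [Adversary.ops]

/-- The probability with which the program guesses the events of a given run. -/
def guessProb (n r k : ℕ) : ℝ := (k.factorial : ℝ) / (2 * r + n : ℝ) ^ k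

lemma guessProb_nonneg (r k : ℕ) : 0 ≤ guessProb n r k := by unfold guessProb; positivity

/-- Once no queries are left, a missing message is read off the output without any guess, so `k` may
drop by one for free. This uses `k + 1 ≤ n`, with `n` the base of the power. -/
lemma guessProb_zero_mono {k : ℕ} (hk : k + 1 ≤ n) : guessProb n 0 (k + 1) ≤ guessProb n 0 k := by
  have hn : (0 : ℝ) < n := by exact_mod_cast (by omega : 0 < n)
  have hk' : ((k + 1 : ℕ) : ℝ) ≤ n := by exact_mod_cast hk
  unfold guessProb
  simp only [CharP.cast_eq_zero, mul_zero, zero_add]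
  rw [div_le_div_iff₀ (by positivity) (by positivity), Nat.factorial_succ, pow_succ]
  push_cast at hk' ⊢
  have : 0 ≤ (k.factorial : ℝ) * (n : ℝ) ^ k := by positivity
  nlinarith

lemma sum_range_mod_two (g : ℕ → ℝ) (t : ℕ) :
    ∑ u ∈ Finset.range (2 * t), g (u % 2) = t * (g 0 + g 1) := by
  induction t with
  | zero => simp
  | succ t ih =>
    rw [show 2 * (t + 1) = 2 * t + 1 + 1 by ring, Finset.sum_range_succ, Finset.sum_range_succ, ih]
    have h0 : 2 * t % 2 = 0 := by omega
    have h1 : (2 * t + 1) % 2 = 1 := by omega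
    rw [h0, h1]; push_cast; ring

/-- `g` stands for the runs without a hit at this query, `g₁` and `g₀` for those with a hit answered
after and before reprogramming. The number of samples given to each alternative makes the
probability of reaching it, times the later guessing probability, at least the common value
`guessProb n (r + 1) (k + 1)`. -/
lemma guessProb_step (hn : 0 < n) (r k : ℕ) {g₀ g₁ g : ℝ} (hg : 0 ≤ g) :
    guessProb n (r + 1) (k + 1) * (g + (g₁ + g₀)) ≤
      ∑ u ∈ Finset.range ((2 * (r + 1) + n) ^ (k + 1)),
        if u < 2 * (k + 1) * (2 * r + n) ^ k then
          1 / ((2 * (r + 1) + n) ^ (k + 1) : ℕ) * (guessProb n r k * if u % 2 = 1 then g₁ else g₀)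
        else 1 / ((2 * (r + 1) + n) ^ (k + 1) : ℕ) * (guessProb n r (k + 1) * g) := by
  set y := 2 * r + n with hy
  set E := (2 * (r + 1) + n) ^ (k + 1) with hE
  set t := (k + 1) * y ^ k with ht
  have hy0 : (0 : ℝ) < y := by exact_mod_cast (by omega : 0 < y)
  -- The binomial inequality: besides the `2t` samples for hits at least `y^(k + 1)` samples are
  -- left for going on without one.
  have hle : y ^ (k + 1) + 2 * t ≤ E := by
    have := pow_add_two_mul_le y (k + 1)
    rw [hE, show 2 * (r + 1) + n = y + 2 by omega, ht]
    simpa [mul_assoc] using this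
  obtain ⟨s, hs⟩ := Nat.exists_eq_add_of_le (show 2 * t ≤ E by omega)
  have hE0 : (0 : ℝ) < E := by
    have : 0 < E := by rw [hE]; positivity
    exact_mod_cast this
  have h2t : 2 * (k + 1) * y ^ k = 2 * t := by rw [ht]; ring
  rw [h2t, show Finset.range E = Finset.range (2 * t + s) by rw [← hs], Finset.sum_range_add]
  have e1 : ∑ u ∈ Finset.range (2 * t), (if u < 2 * t then
      1 / (E : ℝ) * (guessProb n r k * if u % 2 = 1 then g₁ else g₀) else
      1 / (E : ℝ) * (guessProb n r (k + 1) * g)) =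
      1 / (E : ℝ) * ((k + 1).factorial * (g₁ + g₀)) := by
    rw [Finset.sum_congr rfl fun u hu => if_pos (Finset.mem_range.1 hu),
      sum_range_mod_two (fun i => 1 / (E : ℝ) * (guessProb n r k * if i = 1 then g₁ else g₀)) t]
    have hyy : (2 * r + n : ℝ) = y := by rw [hy]; push_cast; ring
    simp only [guessProb, hyy, ht, Nat.factorial_succ]
    push_cast
    field_simp
    ring_nf
  have e2 : ∑ u ∈ Finset.range s, (if 2 * t + u < 2 * t then
      1 / (E : ℝ) * (guessProb n r k * if (2 * t + u) % 2 = 1 then g₁ else g₀) else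
      1 / (E : ℝ) * (guessProb n r (k + 1) * g)) =
      s * (1 / (E : ℝ) * (guessProb n r (k + 1) * g)) := by
    rw [Finset.sum_congr rfl fun u _ => if_neg (by omega)]
    simp
  rw [e1, e2]
  -- For hits the required factor is attained exactly; here, without a hit, there may be a surplus.
  have h3 : ((k + 1).factorial : ℝ) ≤ s * guessProb n r (k + 1) := by
    have : (y : ℝ) ^ (k + 1) ≤ s := by exact_mod_cast (by omega : y ^ (k + 1) ≤ s)
    have hyy : (2 * r + n : ℝ) = y := by rw [hy]; push_cast; ring
    rw [guessProb, hyy, mul_div_assoc', le_div_iff₀ (by positivity), mul_comm]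
    exact mul_le_mul_of_nonneg_right this (by positivity)
  have h4 : guessProb n (r + 1) (k + 1) = 1 / (E : ℝ) * (k + 1).factorial := by
    rw [guessProb, hE]; push_cast; ring
  rw [h4]
  have h5 := mul_le_mul_of_nonneg_right h3 hg
  have h6 := mul_le_mul_of_nonneg_left h5 (by positivity : 0 ≤ 1 / (E : ℝ))
  nlinarith

end MultiRoundFS
end

/-! ### What the search, resume and finishing programs achieve -/

noncomputable section
namespace MultiRoundFS
variable {n : ℕ} {d : Sizes} {q : ℕ}

variable {M : ℕ} {l : ℕ → ℕ} {x : Fin d.inst} {a : Fin n → Fin d.msg} {c : Fin n → Fin d.chal}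
  {hm hc j : ℕ} {m : Mem} {A : Adversary n d q} {f : Conf n d → ℝ} {o : ℕ →₀ ℕ}
  {ψ : Basis n d → ℂ} {r : ℝ} {F : (Basis n d → ℂ) → ℝ}

lemma Ready.advance (hr : Ready n d q M l x a c hm hc j m) :
    Ready n d q M l x a c hm hc (j + 1) (Function.update m 7 (j + 1)) := by
  have e : ∀ k, k ≠ 7 → Function.update m 7 (j + 1) k = m k := fun k hk =>
    Function.update_of_ne hk _ _
  exact
  { queries := (e _ (by omega)).trans hr.queries
    msg := (e _ (by omega)).trans hr.msg
    modulus := (e _ (by omega)).trans hr.modulus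
    divisor := (e _ (by omega)).trans hr.divisor
    next := Function.update_self _ _ _
    seeds := fun i hi => (e _ (by omega)).trans (hr.seeds i hi)
    inst := fun h => (e _ (by omega)).trans (hr.inst h)
    msgs := fun i hi => (e _ (by omega)).trans (hr.msgs i hi)
    chals := fun i hi => (e _ (by omega)).trans (hr.chals i hi) }

lemma Ready.update_chal {h : Fin n} (hr : Ready n d q M l x a c (h + 1) h j m) :
    Ready n d q M l x a c (h + 1) (h + 1) j (Function.update m (31 + 2 * h) (c h)) := by
  have hlt := h.isLt
  have e : ∀ k, k ≠ 31 + 2 * h.val → Function.update m (31 + 2 * h) (c h).val k = m k :=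
    fun k hk => Function.update_of_ne hk _ _
  exact
  { queries := (e _ (by omega)).trans hr.queries
    msg := (e _ (by omega)).trans hr.msg
    modulus := (e _ (by omega)).trans hr.modulus
    divisor := (e _ (by omega)).trans hr.divisor
    next := (e _ (by omega)).trans hr.next
    seeds := fun i hi => (e _ (by omega)).trans (hr.seeds i hi)
    inst := fun h => (e _ (by omega)).trans (hr.inst h)
    msgs := fun i hi => (e _ (by omega)).trans (hr.msgs i hi)
    chals := fun i hi => by
      rcases Nat.lt_succ_iff_lt_or_eq.1 hi with hi | hi
      · exact (e _ (by omega)).trans (hr.chals i hi)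
      · rw [Fin.ext hi]; exact Function.update_self _ _ _ }

lemma above_applyNext (hq : 2 * q < d.chal * M) (hr : Ready n d q M l x a c hm hc j m) (hj : j < q)
    (h : Above f (Function.update m 7 (j + 1)) o (A.op ⟨j, hj⟩ *ᵥ ψ) r) :
    Above (wp A applyNext f) m o ψ r := by
  refine Above.seq (Above.call (by simpa [hr.next] using hj) (Above.cl ?_))
  have e : (setTo 7 (.op .add (cell 7) (.const 1))).exec m = Function.update m 7 (j + 1) := by
    simp only [setTo, CProg.exec, Exp.eval, Op.eval, reduced_eval, cell_eval, hr.next, hr.modulus]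
    rw [Nat.mod_eq_of_lt (by omega)]
  rw [e]
  simpa only [cell_eval, hr.next] using h

lemma above_advance [NeZero (d.chal * M)] (hq : 2 * q < d.chal * M)
    (hr : Ready n d q M l x a c hm hc j m) (hj : j < q) {k : ℕ} (h1 : k ≤ hm) (h2 : k ≤ hc)
    (h3 : k ≤ n) (h : Above f (Function.update m 7 (j + 1)) o
      (A.op ⟨j, hj⟩ *ᵥ query (reprog x a c (below n k) (listHash n d q M l)) ψ) r) :
    Above (wp A (advance n k) f) m o ψ r :=
  Above.seq (above_queryProg hq hr h1 h2 h3 (above_applyNext hq hr hj h))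

/-- The configurations from which the search for the `h`-th message starts or goes on. -/
structure Waiting [NeZero (d.chal * M)] (A : Adversary n d q) (F : (Basis n d → ℂ) → ℝ)
    (l : ℕ → ℕ) (x : Fin d.inst) (a : Fin n → Fin d.msg) (c : Fin n → Fin d.chal) (h j : ℕ)
    (m : Mem) (o : ℕ →₀ ℕ) (ψ : Basis n d → ℂ) (r : ℝ) : Prop where
  ready : Ready n d q M l x a c h h j m
  le : j ≤ q
  flag : m 8 = 0
  own : ∀ k, h ≤ k → o k = 0
  bound : r ≤ guessProb n (q - j) (n - h) *
    goodSum F x a c (listHash n d q M l) (A.ops.drop j) h ψ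

/-- The configurations in which a query has been measured as the `h`-th point. -/
structure Pending [NeZero (d.chal * M)] (A : Adversary n d q) (F : (Basis n d → ℂ) → ℝ)
    (l : ℕ → ℕ) (x : Fin d.inst) (a : Fin n → Fin d.msg) (c : Fin n → Fin d.chal) (h : Fin n)
    (j : ℕ) (hj : j < q) (m : Mem) (o : ℕ →₀ ℕ) (ψ : Basis n d → ℂ) (r : ℝ) : Prop where
  ready : Ready n d q M l x a c (h + 1) h j m
  flag : m 8 = 1
  message : m 5 = a h
  own : ∀ k, h.val + 1 ≤ k → o k = 0
  bound : r ≤ guessProb n (q - j - 1) (n - h - 1) *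
    goodSum F x a c (listHash n d q M l) (A.ops.drop (j + 1)) (h + 1) (A.op ⟨j, hj⟩ *ᵥ
      query (reprog x a c (below n (if m 9 = 0 then h else h + 1)) (listHash n d q M l)) ψ)

/-- The configurations in which the output has been measured. -/
structure Ended [NeZero (d.chal * M)] (F : (Basis n d → ℂ) → ℝ)
    (l : ℕ → ℕ) (x : Fin d.inst) (a : Fin n → Fin d.msg) (c : Fin n → Fin d.chal) (h : Fin n)
    (m : Mem) (o : ℕ →₀ ℕ) (ψ : Basis n d → ℂ) (r : ℝ) : Prop where
  ready : Ready n d q M l x a c (h + 1) h q m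
  flag : m 8 = 0
  message : m 5 = a h
  own : ∀ k, h.val + 1 ≤ k → o k = 0
  bound : r ≤ guessProb n 0 (n - h - 1) * F ψ

lemma remExp_eval (hr : Ready n d q M l x a c hm hc j m) : remExp.eval m = q - j := by
  simp [remExp, Exp.eval, Op.eval, hr.queries, hr.next]

lemma hitQuery_smul (G : Hash n d) (I : Finset (Fin n)) (i : Fin n) (z : ℂ) (ψ : Basis n d → ℂ) :
    hitQuery x a c G I i (z • ψ) = z • hitQuery x a c G I i ψ := by
  have : (atPt (pt x a c i)).indicator (z • ψ) = z • (atPt (pt x a c i)).indicator ψ :=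
    Set.indicator_const_smul _ z ψ
  rw [hitQuery, this, query_smul, hitQuery]

lemma rangeExp_eval (hr : Ready n d q M l x a c hm hc j m) (k : ℕ) :
    (rangeExp n k).eval m = (2 * (q - j) + n) ^ k := by
  simp [rangeExp, Exp.eval, Op.eval, remExp_eval hr]

lemma hitRangeExp_eval (hr : Ready n d q M l x a c hm hc j m) (k : ℕ) :
    (hitRangeExp n k).eval m = 2 * k * (2 * (q - j - 1) + n) ^ (k - 1) := by
  simp [hitRangeExp, Exp.eval, Op.eval, remExp_eval hr]

variable [NeZero (d.chal * M)]

/-- Both outcomes of a search lead to the start of the next one: a pending query is answered with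
the oracle chosen earlier and followed by the adversary's operator, while after a measured output
there is nothing to answer. -/
lemma above_resumeProg (hq : 2 * q < d.chal * M) (h : Fin n)
    (hf : ∀ j m o ψ r, Waiting (M := M) A F l x a c (h + 1) j m o ψ r → Above f m o ψ r)
    (hs : (∃ j hj, Pending (M := M) A F l x a c h j hj m o ψ r) ∨
      Ended (q := q) (M := M) F l x a c h m o ψ r) :
    Above (wp A (resumeProg n h) f) (Function.update m 6 (c h)) o ψ r := by
  have hlt := h.isLt
  refine Above.seq (Above.cl ?_)
  set m' := (CProg.assign (.const (31 + 2 * h.val)) (cell 6)).exec (Function.update m 6 (c h))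
  have hm' : ∀ k, k ≠ 6 → k ≠ 31 + 2 * h.val → m' k = m k := by
    intro k h1 h2
    simp [m', CProg.exec, Exp.eval, h1, h2]
  have hready : ∀ j, Ready n d q M l x a c (h + 1) h j m →
      Ready n d q M l x a c (h + 1) (h + 1) j m' := by
    intro j hr
    have : m' = Function.update (Function.update m 6 (c h)) (31 + 2 * h) (c h) := by
      simp [m', CProg.exec, Exp.eval]
    rw [this]
    exact (hr.congr (sameData_update (by omega) (by omega) (by omega) (by omega) (by omega)
      (by omega) (by omega) _)).update_chal
  rcases hs with ⟨j, hj, hs⟩ | hs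
  · have hr := hready j hs.ready
    have h8 : m' 8 = 1 := (hm' _ (by omega) (by omega)).trans hs.flag
    have h9 : m' 9 = m 9 := hm' _ (by omega) (by omega)
    refine Above.ite_true (by simp [h8]) (Above.seq ?_)
    have key : Above (wp A (.seq applyNext (.cl (setTo 8 (.const 0)))) f) m' o
        (query (reprog x a c (below n (if m 9 = 0 then h else h + 1)) (listHash n d q M l)) ψ)
        r := by
      refine Above.seq (above_applyNext hq hr hj (Above.cl (hf (j + 1) _ _ _ _ ?_)))
      have e : (setTo 8 (.const 0)).exec (Function.update m' 7 (j + 1)) =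
          Function.update (Function.update m' 7 (j + 1)) 8 0 := by
        simp [setTo, CProg.exec, Exp.eval]
      rw [e]
      exact
      { ready := hr.advance.congr (sameData_update (by omega) (by omega) (by omega) (by omega)
          (by omega) (by omega) (by omega) _)
        le := hj
        flag := Function.update_self _ _ _
        own := hs.own
        bound := by
          have := hs.bound
          rwa [show q - j - 1 = q - (j + 1) by omega, show n - h.val - 1 = n - (h + 1) by omega]
            at this }
    by_cases h0 : m 9 = 0
    · refine Above.ite_false (by simp [h9, h0])
        (above_queryProg hq hr (k := h) (by omega) (by omega) (by omega) ?_)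
      simpa [h0] using key
    · refine Above.ite_true (by simp [h9, h0])
        (above_queryProg hq hr (k := h + 1) (by omega) (by omega) (by omega) ?_)
      simpa [h0] using key
  · have h8 : m' 8 = 0 := (hm' _ (by omega) (by omega)).trans hs.flag
    refine Above.ite_false (by simp [h8]) (Above.cl (hf q _ _ _ _ ?_))
    have e : nop.exec m' = m' := by simp [nop, CProg.exec, Exp.eval]
    rw [e]
    exact
    { ready := hready q hs.ready
      le := le_rfl
      flag := h8
      own := hs.own
      bound := by
        have := hs.bound
        rw [List.drop_eq_nil_of_le (by rw [Adversary.length_ops]), Nat.sub_self]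
        rwa [show n - h.val - 1 = n - (h + 1) by omega] at this }

/-- All points are known and `guessProb n r 0 = 1`, so the remaining queries are answered with full
reprogramming at no loss. The loop invariant allows idle iterations, since the loop always runs `q`
times. -/
lemma above_finishProg (hq : 2 * q < d.chal * M) (hf0 : ∀ s, 0 ≤ f s)
    (hf : ∀ m o ψ r, r ≤ F ψ → Above f m o ψ r) (hs : Waiting (M := M) A F l x a c n j m o ψ r) :
    Above (wp A (finishProg n) f) m o ψ r := by
  refine Above.loop hf0 (fun i m o ψ r => ∃ j, q - j ≤ i ∧
    Waiting (M := M) A F l x a c n j m o ψ r) ?_ ?_ ?_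
  · rintro m o ψ r ⟨j, hj, hs⟩
    obtain rfl : j = q := le_antisymm hs.le (by omega)
    refine hf _ _ _ _ (hs.bound.trans ?_)
    rw [List.drop_eq_nil_of_le (by rw [Adversary.length_ops])]
    simp [guessProb, goodSum]
  · rintro i g hg hR m o ψ r ⟨j, hj, hs⟩
    rcases hs.le.lt_or_eq with hjq | rfl
    · refine Above.ite_true (by rw [remExp_eval hs.ready]; omega)
        (above_advance hq hs.ready hjq le_rfl le_rfl le_rfl (hR _ _ _ _ ⟨j + 1, by omega, ?_⟩))
      exact
      { ready := hs.ready.advance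
        le := hjq
        flag := by rw [Function.update_of_ne (by omega)]; exact hs.flag
        own := hs.own
        bound := by
          have := hs.bound
          rw [ops_drop hjq] at this
          simpa [guessProb, goodSum] using this }
    · refine Above.ite_false (by rw [remExp_eval hs.ready]; omega)
        (Above.cl (hR _ _ _ _ ⟨j, by omega, ?_⟩))
      have e : nop.exec m = m := by simp [nop, CProg.exec, Exp.eval]
      rw [e]
      exact hs
  · exact ⟨j, by rw [cell_eval, hs.ready.queries]; omega, hs⟩

/-- Measuring now and querying later together apply `hitQuery`. If the projected state vanishes
there is no branch to follow, but then the claimed amount is at most zero by `goodSum_zero`. -/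
lemma above_hitProg (hN : (d.inst + d.chal) * d.msg < d.chal * M)
    (hN2 : 2 ≤ d.chal * M) (h : Fin n) (hf0 : ∀ s, 0 ≤ f s) (hj : j < q)
    (hf : ∀ m o ψ r, Pending (M := M) A F l x a c h j hj m o ψ r → Above f m o ψ r)
    (hF0 : F 0 = 0)
    (hr : Ready n d q M l x a c h h j m) (ho : ∀ k, h.val ≤ k → o k = 0)
    (hb : r ≤ guessProb n (q - j - 1) (n - h - 1) *
      goodSum F x a c (listHash n d q M l) (A.ops.drop (j + 1)) (h + 1) (A.op ⟨j, hj⟩ *ᵥ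
        hitQuery x a c (listHash n d q M l) (below n (if m 12 % 2 = 0 then h else h + 1)) h ψ)) :
    Above (wp A (hitProg h) f) m o ψ r := by
  have hlt := h.isLt
  refine Above.seq (above_measureQuery hN hr h (wp_nonneg hf0 _) (ho _ le_rfl) ?_ ?_)
  · intro e
    simpa [hitQuery, e, query_zero, goodSum_zero x a c (listHash n d q M l) hF0] using hb
  · have hr' : Ready n d q M l x a c h h j (Function.update m 22 (hitCode x a c h)) :=
      hr.congr (sameData_update (by omega) (by omega) (by omega) (by omega) (by omega)
        (by omega) (by omega) _)
    have hL : (if h.val = 0 then x.val else (c ⟨h.val - 1, by omega⟩).val) < d.inst + d.chal := by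
      split_ifs
      · omega
      · exact (c _).isLt.trans_le (Nat.le_add_left _ _)
    obtain ⟨h1, h2, h3⟩ := recordProg_exec hN h hr' hL (fun e => if_pos e)
      (Function.update_self _ _ _)
    set m' := (recordProg h).exec (Function.update m 22 (hitCode x a c h))
    refine Above.seq (Above.cl (Above.seq (Above.cl (Above.cl (hf _ _ _ _ ?_)))))
    have h12 : m' 12 = m 12 := (h3 12 (by omega) (by omega)).trans (by simp)
    have e : (setTo 8 (.const 1)).exec ((setTo 9 (.op .mod (cell 12) (.const 2))).exec m') =
        Function.update (Function.update m' 9 (m 12 % 2)) 8 1 := by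
      simp only [setTo, CProg.exec, Exp.eval, reduced_eval, Op.eval, cell_eval, h1.modulus, h12,
        Function.update_of_ne (show (10 : ℕ) ≠ 9 by omega)]
      rw [Nat.mod_eq_of_lt (show m 12 % 2 < d.chal * M by omega),
        Nat.mod_eq_of_lt (show 1 < d.chal * M by omega)]
    rw [e]
    exact
    { ready := (h1.congr (sameData_update (by omega) (by omega) (by omega) (by omega) (by omega)
        (by omega) (by omega) _)).congr (sameData_update (by omega) (by omega) (by omega)
          (by omega) (by omega) (by omega) (by omega) _)
      flag := Function.update_self _ _ _
      message := by simpa using h2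
      own := fun k hk => by
        rw [Finsupp.coe_update, Function.update_of_ne (by omega)]
        exact ho k (by omega)
      bound := by simpa [hitQuery] using hb }

lemma norm_sq_inv_sqrt (E : ℕ) : ‖(1 / (Real.sqrt E : ℂ))‖ ^ 2 = 1 / (E : ℝ) := by
  rw [norm_div, norm_one, Complex.norm_real, div_pow, one_pow, Real.norm_eq_abs, sq_abs,
    Real.sq_sqrt (Nat.cast_nonneg _)]

/-- The recursion of `goodSum` at the next query meets `guessProb_step`, with `k + 1 = n - h`
missing points and `s + 1 = q - j` remaining queries. `hN2` ensures that the range of the sample is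
not changed by the reduction. -/
lemma above_stepProg (hq : 2 * q < d.chal * M) (hN : (d.inst + d.chal) * d.msg < d.chal * M)
    (hN2 : (2 * q + n + 2) ^ n < d.chal * M) (h : Fin n) (hf0 : ∀ s, 0 ≤ f s) (hj : j < q)
    (hf : ∀ m o ψ r, Pending (M := M) A F l x a c h j hj m o ψ r → Above f m o ψ r)
    (hf' : ∀ m o ψ r, Waiting (M := M) A F l x a c h (j + 1) m o ψ r → Above f m o ψ r)
    (hF : ∀ φ, 0 ≤ F φ) (hFs : ∀ (z : ℂ) φ, F (z • φ) = ‖z‖ ^ 2 * F φ)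
    (hs : Waiting (M := M) A F l x a c h j m o ψ r) :
    Above (wp A (stepProg n h) f) m o ψ r := by
  have hlt := h.isLt
  set G := listHash n d q M l
  obtain ⟨k, hk⟩ : ∃ k, n - h.val = k + 1 := ⟨n - h - 1, by omega⟩
  obtain ⟨s, hs'⟩ : ∃ s, q - j = s + 1 := ⟨q - j - 1, by omega⟩
  have hF0 : F 0 = 0 := by simpa using hFs 0 0
  set B := A.op ⟨j, hj⟩ with hB
  set g := goodSum F x a c G (A.ops.drop (j + 1)) h (B *ᵥ query (reprog x a c (below n h) G) ψ)
  set g₁ := goodSum F x a c G (A.ops.drop (j + 1)) (h + 1)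
    (B *ᵥ hitQuery x a c G (below n (h + 1)) h ψ)
  set g₀ := goodSum F x a c G (A.ops.drop (j + 1)) (h + 1) (B *ᵥ hitQuery x a c G (below n h) h ψ)
  set E := (2 * (s + 1) + n) ^ (k + 1) with hE
  have hbound : r ≤ guessProb n (s + 1) (k + 1) * (g + (g₁ + g₀)) := by
    have := hs.bound
    rw [ops_drop hj, goodSum, hk, hs', dif_pos h.isLt] at this
    exact this
  have hE0 : 0 < E := by rw [hE]; positivity
  have hEN : E < d.chal * M := by
    refine lt_of_le_of_lt ?_ hN2
    calc E ≤ (2 * q + n + 2) ^ (k + 1) := Nat.pow_le_pow_left (by omega) _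
      _ ≤ _ := Nat.pow_le_pow_right (by omega) (by omega)
  have hNg : 2 ≤ d.chal * M := by omega
  refine Above.seq (Above.mono (Above.sample (E := E) ?_ hE0 _ ?_)
    (hbound.trans (guessProb_step (by omega) s k
      (goodSum_nonneg x a c G hF (A.ops.drop (j + 1)) h _))))
  · rw [reduced_eval, hs.ready.modulus, hk, rangeExp_eval hs.ready, hs', Nat.mod_eq_of_lt hEN]
  · intro u hu
    have hr : Ready n d q M l x a c h h j (Function.update m 12 u) :=
      hs.ready.congr (sameData_update (by omega) (by omega) (by omega) (by omega) (by omega)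
        (by omega) (by omega) _)
    have ht : (hitRangeExp n (n - h)).eval (Function.update m 12 u) =
        2 * (k + 1) * (2 * s + n) ^ k := by
      rw [hitRangeExp_eval hr, hk, hs']; simp
    simp only [Exp.eval]
    split_ifs with hu' hmod
    · refine Above.ite_true (by
        simp only [Exp.eval, Op.eval, ht, cell_eval, Function.update_self]; omega)
        (above_hitProg hN hNg h hf0 hj hf hF0 hr hs.own ?_)
      rw [Function.update_self, if_neg (by omega), hitQuery_smul,
        Matrix.mulVec_smul, goodSum_smul x a c G hFs, norm_sq_inv_sqrt, show q - j - 1 = s by omega,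
        show n - h.val - 1 = k by omega]
      exact le_of_eq (by simp only [g₁, hE, hB]; push_cast; ring)
    · refine Above.ite_true (by
        simp only [Exp.eval, Op.eval, ht, cell_eval, Function.update_self]; omega)
        (above_hitProg hN hNg h hf0 hj hf hF0 hr hs.own ?_)
      rw [Function.update_self, if_pos (by omega), hitQuery_smul,
        Matrix.mulVec_smul, goodSum_smul x a c G hFs, norm_sq_inv_sqrt, show q - j - 1 = s by omega,
        show n - h.val - 1 = k by omega]
      exact le_of_eq (by simp only [g₀, hE, hB]; push_cast; ring)
    · refine Above.ite_false (by
        simp only [Exp.eval, Op.eval, ht, cell_eval, Function.update_self]; omega)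
        (above_advance hq hr hj le_rfl le_rfl hlt.le (hf' _ _ _ _ ?_))
      exact
      { ready := hr.advance
        le := hj
        flag := by simpa using hs.flag
        own := hs.own
        bound := by
          rw [query_smul, Matrix.mulVec_smul, goodSum_smul x a c G hFs, norm_sq_inv_sqrt,
            show q - (j + 1) = s by omega, hk]
          exact le_of_eq (by simp only [g, hE, hB]; push_cast; ring) }

/-- Each iteration either makes a step or is idle because of a pending query or for want of further
queries. If the queries run out without a hit, the message is taken from the output; `hFo` says that
this measurement does not reduce what is accepted. -/
lemma above_searchProg (hq : 2 * q < d.chal * M) (hN : (d.inst + d.chal) * d.msg < d.chal * M)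
    (hN2 : (2 * q + n + 2) ^ n < d.chal * M) (h : Fin n) (hf0 : ∀ s, 0 ≤ f s)
    (hf : ∀ m o ψ r, ((∃ j hj, Pending (M := M) A F l x a c h j hj m o ψ r) ∨
      Ended (q := q) (M := M) F l x a c h m o ψ r) → Above f m o ψ r)
    (hF : ∀ φ, 0 ≤ F φ) (hFs : ∀ (z : ℂ) φ, F (z • φ) = ‖z‖ ^ 2 * F φ)
    (hFo : ∀ φ, F φ ≤ F ({b : Basis n d | b.2.2.2.1 = x ∧ b.2.2.2.2.1 h = a h}.indicator φ))
    (hs : Waiting (M := M) A F l x a c h j m o ψ r) :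
    Above (wp A (searchProg n h) f) m o ψ r := by
  have hlt := h.isLt
  have enop : ∀ m, nop.exec m = m := fun m => by simp [nop, CProg.exec, Exp.eval]
  refine Above.seq (Above.loop (wp_nonneg hf0 _) (fun i m o ψ r =>
    (∃ j, q - j ≤ i ∧ Waiting (M := M) A F l x a c h j m o ψ r) ∨
    ∃ j hj, Pending (M := M) A F l x a c h j hj m o ψ r) ?_ ?_ (Or.inl ⟨j, ?_, hs⟩))
  · rintro m o ψ r (⟨j, hj, hs⟩ | ⟨j, hj, hs⟩)
    · obtain rfl : j = q := le_antisymm hs.le (by omega)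
      have hb := hs.bound
      rw [List.drop_eq_nil_of_le (by rw [Adversary.length_ops]), Nat.sub_self, goodSum] at hb
      have hb' := hb.trans (mul_le_mul_of_nonneg_left (hFo ψ) (guessProb_nonneg _ _))
      refine Above.ite_false (by simp [hs.flag]) (Above.seq (above_measureOutput hN hs.ready h
        (wp_nonneg hf0 _) (hs.own _ le_rfl) ?_ (Above.cl (hf _ _ _ _ (Or.inr ?_)))))
      · intro e
        have hF0 : F 0 = 0 := by simpa using hFs 0 0
        rw [e, hF0, mul_zero] at hb'
        exact hb'
      · have hr' := hs.ready.congr (m' := Function.update m 22 (1 + (x.val * d.msg + (a h).val)))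
          (sameData_update (by omega) (by omega) (by omega) (by omega) (by omega)
            (by omega) (by omega) _)
        obtain ⟨h1, h2, h3⟩ := recordProg_exec hN h hr' (L := x) (by omega) (fun _ => rfl)
          (Function.update_self _ _ _)
        exact
        { ready := h1
          flag := (h3 8 (by omega) (by omega)).trans (by simpa using hs.flag)
          message := h2
          own := fun k hk => by
            rw [Finsupp.coe_update, Function.update_of_ne (by omega)]
            exact hs.own k (by omega)
          bound := by
            refine hb'.trans (mul_le_mul_of_nonneg_right ?_ (hF _))
            rw [show n - h.val = n - h - 1 + 1 by omega]
            exact guessProb_zero_mono (by omega) }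
    · refine Above.ite_true (by simp [hs.flag]) (Above.cl (hf _ _ _ _ (Or.inl ⟨j, hj, ?_⟩)))
      rw [enop]; exact hs
  · rintro i g hg hR m o ψ r (⟨j, hj, hs⟩ | ⟨j, hj, hs⟩)
    · rcases hs.le.lt_or_eq with hjq | rfl
      · refine Above.ite_true (by
          simp only [Exp.eval, Op.eval, remExp_eval hs.ready, cell_eval, hs.flag]; omega)
          (above_stepProg hq hN hN2 h hg hjq (fun m o ψ r hs => hR _ _ _ _ (Or.inr ⟨j, hjq, hs⟩))
            (fun m o ψ r hs => hR _ _ _ _ (Or.inl ⟨j + 1, by omega, hs⟩)) hF hFs hs)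
      · refine Above.ite_false (by
          simp only [Exp.eval, Op.eval, remExp_eval hs.ready]; simp)
          (Above.cl (hR _ _ _ _ (Or.inl ⟨j, by omega, ?_⟩)))
        rw [enop]; exact hs
    · refine Above.ite_false (by
          simp only [Exp.eval, Op.eval, cell_eval, hs.flag]; simp)
          (Above.cl (hR _ _ _ _ (Or.inr ⟨j, hj, ?_⟩)))
      rw [enop]; exact hs
  · rw [cell_eval, hs.ready.queries]; omega

end MultiRoundFS
end

noncomputable section
namespace MultiRoundFS
variable {n : ℕ} {d : Sizes} {q : ℕ}

/-! ## The complete interaction -/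

variable {M : ℕ} {x : Fin d.inst} {a : Fin n → Fin d.msg} {c : Fin n → Fin d.chal}
  {A : Adversary n d q}

/-- The contribution of a branch to the event that `x` and `a` are sent and accepted. -/
def payoff (prot : PCIP n d) (x : Fin d.inst) (a : Fin n → Fin d.msg) (c : Fin n → Fin d.chal)
    (v : View n d) : ℝ :=
  if v.inst = x.val ∧ ∀ i : Fin n, v.msgs i.val = (a i).val then
    normSq (applyMatrix (onZ (prot.V x a c)) v.conf.vec) else 0

lemma payoff_nonneg (prot : PCIP n d) (v : View n d) : 0 ≤ payoff prot x a c v := by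
  unfold payoff
  split_ifs
  · exact Finset.sum_nonneg fun _ _ => by positivity
  · exact le_rfl

lemma list_sum_finset_sum {α ι : Type*} (l : List α) (s : Finset ι) (f : α → ι → ℝ) :
    (l.map fun v => ∑ i ∈ s, f v i).sum = ∑ i ∈ s, (l.map fun v => f v i).sum := by
  induction l with
  | nil => simp
  | cons v l ih => simp [ih, Finset.sum_add_distrib]

/-- For fixed `a` and `c` the branches can then be bounded separately from the other values. -/
lemma interactProb_eq (A : Adversary n d q) (S : Fin (n + 1) → Prog) (prot : PCIP n d)
    (x : Fin d.inst) : interactProb A S prot x =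
      (∑ a, ∑ c, ((finalViews A S c).map (payoff prot x a c)).sum) / (d.chal : ℝ) ^ n := by
  rw [interactProb, Finset.sum_comm]
  congr 1
  refine Finset.sum_congr rfl fun c _ => ?_
  rw [list_sum_finset_sum]
  rfl

/-- The squared norm of the accepted part of a state. -/
def accNorm (prot : PCIP n d) (x : Fin d.inst) (a : Fin n → Fin d.msg) (c : Fin n → Fin d.chal)
    (φ : Basis n d → ℂ) : ℝ := nsq (accMatrix prot x a c *ᵥ φ)

lemma accNorm_nonneg (prot : PCIP n d) (φ : Basis n d → ℂ) : 0 ≤ accNorm prot x a c φ :=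
  nsq_nonneg _

lemma accNorm_smul (prot : PCIP n d) (z : ℂ) (φ : Basis n d → ℂ) :
    accNorm prot x a c (z • φ) = ‖z‖ ^ 2 * accNorm prot x a c φ := by
  rw [accNorm, Matrix.mulVec_smul, nsq_smul]; rfl

/-- The acceptance projection already contains the projection onto the full output, so measuring a
part of that output beforehand has no effect. -/
lemma accNorm_le_output (prot : PCIP n d) (h : Fin n) (φ : Basis n d → ℂ) :
    accNorm prot x a c φ ≤ accNorm prot x a c
      ({b : Basis n d | b.2.2.2.1 = x ∧ b.2.2.2.2.1 h = a h}.indicator φ) := by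
  have : (outEvent x a : Set (Basis n d)).indicator φ = (outEvent x a).indicator
      ({b : Basis n d | b.2.2.2.1 = x ∧ b.2.2.2.2.1 h = a h}.indicator φ) := by
    rw [Set.indicator_indicator]
    congr 1
    ext b
    simp only [outEvent, Set.mem_inter_iff, Set.mem_ofPred_eq]
    constructor
    · rintro ⟨h1, h2⟩; exact ⟨⟨h1, h2⟩, h1, by rw [h2]⟩
    · rintro ⟨h1, _⟩; exact h1
  simp only [accNorm, accMatrix_mulVec, ← onZ_indicator_outEvent]
  rw [← this]

lemma accNorm_le_normSq (prot : PCIP n d) (o : ℕ →₀ ℕ) (ψ : Basis n d → ℂ) :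
    accNorm prot x a c ψ ≤ normSq (applyMatrix (onZ (prot.V x a c)) (lift o ψ)) := by
  rw [applyMatrix_lift, normSq_lift, accNorm, accMatrix_mulVec]
  exact nsq_indicator_le _ _

/-- The continuation after stage `t` of the simulator. -/
lemma exists_continuation [NeZero (d.chal * M)] (hq : 2 * q < d.chal * M)
    (hN : (d.inst + d.chal) * d.msg < d.chal * M) (hN2 : (2 * q + n + 2) ^ n < d.chal * M)
    (A : Adversary n d q) (prot : PCIP n d) (x : Fin d.inst) (a : Fin n → Fin d.msg)
    (c : Fin n → Fin d.chal) (s t : ℕ) (ht : t + s + 1 = n) :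
    ∃ g : View n d → ℝ, (∀ v, 0 ≤ g v) ∧
      ((views A (simulator n) c t (by omega)).map g).sum =
        ((finalViews A (simulator n) c).map (payoff prot x a c)).sum ∧
      ∀ (l : ℕ → ℕ) (m : Mem) (o : ℕ →₀ ℕ) (ψ : Basis n d → ℂ) (r : ℝ) (msgs : ℕ → ℕ),
        (∀ i : Fin n, i.val ≤ t → msgs i = a i) →
        ((∃ j hj, Pending (M := M) A (accNorm prot x a c) l x a c ⟨t, by omega⟩ j hj m o ψ r) ∨
          Ended (q := q) (M := M) (accNorm prot x a c) l x a c ⟨t, by omega⟩ m o ψ r) →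
        ∀ time, r ≤ g ⟨⟨m, time, lift o ψ⟩, x, msgs⟩ := by
  -- Backward induction: `s` counts the searches that are still to come after stage `t`.
  induction s generalizing t with
  | zero =>
    have htn : t < n := by omega
    have e : n = t + 1 := by omega
    refine ⟨fun v => wp A (simulator n ⟨t + 1, by omega⟩)
      (fun s => payoff prot x a c ⟨s, v.inst, Function.update v.msgs (t + 1) (s.mem 5)⟩)
      { v.conf with mem := Function.update v.conf.mem 6 (c ⟨t, htn⟩) },
      fun v => wp_nonneg (fun s => payoff_nonneg _ _) _ _, ?_, ?_⟩
    · have : finalViews A (simulator n) c = views A (simulator n) c (t + 1) (by omega) := by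
        unfold finalViews; congr 1
      rw [this, views, sum_map_flatMap]
      simp only [wp, List.map_map, Function.comp_def]
    · intro l m o ψ r msgs hmsgs hs time
      have hsim : simulator n ⟨t + 1, by omega⟩ = .seq (resumeProg n t) (finishProg n) := by
        simp [simulator, e]
      rw [hsim]
      refine (Above.seq (above_resumeProg (F := accNorm prot x a c) (l := l) (x := x) (a := a)
        hq ⟨t, htn⟩ ?_ hs) :
        Above (wp A _ (fun s => payoff prot x a c
          ⟨s, x, Function.update msgs (t + 1) (s.mem 5)⟩)) _ _ _ _) time
      intro j m o ψ r hw
      have hn : (⟨t, htn⟩ : Fin n).val + 1 = n := e.symm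
      rw [hn] at hw
      refine above_finishProg hq (fun s => payoff_nonneg _ _) ?_ hw
      intro m o ψ r hr time
      refine (hr.trans (accNorm_le_normSq prot o ψ)).trans_eq (if_pos ⟨rfl, fun i => ?_⟩).symm
      -- The last stage records a message at index `t + 1 = n`, which lies beyond the `n` messages
      -- that count.
      exact (Function.update_of_ne (show i.val ≠ t + 1 by omega) _ _).trans (hmsgs i (by omega))
  | succ s ih =>
    have htn : t < n := by omega
    obtain ⟨g, hg, hsum, hb⟩ := ih (t + 1) (by omega)
    refine ⟨fun v => wp A (simulator n ⟨t + 1, by omega⟩)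
      (fun s => g ⟨s, v.inst, Function.update v.msgs (t + 1) (s.mem 5)⟩)
      { v.conf with mem := Function.update v.conf.mem 6 (c ⟨t, htn⟩) },
      fun v => wp_nonneg (fun s => hg _) _ _, ?_, ?_⟩
    · rw [← hsum, views, sum_map_flatMap]
      simp only [wp, List.map_map, Function.comp_def]
    · intro l m o ψ r msgs hmsgs hs time
      have hsim : simulator n ⟨t + 1, by omega⟩ = .seq (resumeProg n t) (searchProg n (t + 1)) := by
        simp only [simulator, Nat.add_sub_cancel]
        rw [if_neg (by omega), if_pos (by omega)]
      rw [hsim]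
      refine (Above.seq (above_resumeProg (F := accNorm prot x a c) (l := l) (x := x) (a := a)
        hq ⟨t, htn⟩ ?_ hs) :
        Above (wp A _ (fun s => g ⟨s, x, Function.update msgs (t + 1) (s.mem 5)⟩)) _ _ _ _) time
      intro j m o ψ r hw
      refine above_searchProg hq hN hN2 ⟨t + 1, by omega⟩ (fun s => hg _) ?_
        (accNorm_nonneg prot) (accNorm_smul prot) (accNorm_le_output prot _) hw
      intro m o ψ r hs time
      refine hb l m o ψ r _ (fun i hi => ?_) hs time
      have h5 : m 5 = a ⟨t + 1, by omega⟩ := by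
        rcases hs with ⟨j, hj, hs⟩ | hs
        · exact hs.message
        · exact hs.message
      rcases hi.lt_or_eq with hi' | hi'
      · rw [Function.update_of_ne (by omega)]
        exact hmsgs i (by omega)
      · have : i = ⟨t + 1, by omega⟩ := Fin.ext hi'
        rw [this, Function.update_self]
        exact h5

/-! ## The initialization -/

/-- The value of `baseExp`. -/
def baseVal (n : ℕ) (d : Sizes) (q : ℕ) : ℕ :=
  (d.inst + d.chal) * d.msg * 2 * n + (2 * q + (n + 2))

/-- The quotient of the modulus and the number of challenges. -/
def quotVal (n : ℕ) (d : Sizes) (q : ℕ) : ℕ :=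
  baseVal n d q ^ (2 * n + 8) * (baseVal n d q ^ 4) ^ q

lemma initProg_exec {m : Mem} (h0 : m 0 = q) (h1 : m 1 = d.inst) (h2 : m 2 = d.msg)
    (h3 : m 3 = d.chal) : (initProg n).exec m = Function.update (Function.update
      (Function.update m 13 (baseVal n d q)) 11 (quotVal n d q)) 10 (d.chal * quotVal n d q) := by
  set m₁ := Function.update m 13 (baseVal n d q) with hm₁
  have e1 : (baseExp n).eval m = baseVal n d q := by
    simp [baseExp, Exp.eval, Op.eval, h0, h1, h2, h3, baseVal]
  have key : ∀ k v, (CProg.assign (.const 11) (.op .mul (cell 11) (powExp (cell 13) 4))).exec^[k]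
      (Function.update m₁ 11 v) = Function.update m₁ 11 (v * (baseVal n d q ^ 4) ^ k) := by
    intro k
    induction k with
    | zero => simp
    | succ k ih =>
      intro v
      rw [Function.iterate_succ_apply]
      have : (CProg.assign (.const 11) (.op .mul (cell 11) (powExp (cell 13) 4))).exec
          (Function.update m₁ 11 v) = Function.update m₁ 11 (v * baseVal n d q ^ 4) := by
        simp [CProg.exec, Exp.eval, Op.eval, hm₁]
      rw [this, ih, pow_succ]
      congr 1
      ring
  have e0 : (Function.update m₁ 11 (baseVal n d q ^ (2 * n + 8))) 0 = q := by simp [hm₁, h0]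
  simp only [CProg.exec, Exp.eval, powExp_eval, cell_eval, Op.eval] at key
  simp only [initProg, CProg.exec, Exp.eval, e1, ← hm₁, powExp_eval, cell_eval, Op.eval]
  rw [show m₁ 13 = baseVal n d q by simp [hm₁], e0, key]
  congr 1
  simp [hm₁, h3, quotVal]

/-- The state of the memory after `k` seeds have been sampled. -/
structure Seeding (n : ℕ) (d : Sizes) (q M : ℕ) (l : ℕ → ℕ) (k : ℕ) (m : Mem) : Prop where
  queries : m 0 = q
  msg : m 2 = d.msg
  modulus : m 10 = d.chal * M
  divisor : m 11 = M
  next : m 7 = 0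
  flag : m 8 = 0
  count : m 20 = k
  seeds : ∀ i < k, m (30 + 2 * n + i) = l i

lemma Seeding.ready {l : ℕ → ℕ} {m : Mem} (h : Seeding n d q M l (2 * q) m) :
    Ready n d q M l x a c 0 0 0 m where
  queries := h.queries
  msg := h.msg
  modulus := h.modulus
  divisor := h.divisor
  next := h.next
  seeds := h.seeds
  inst h := absurd h (lt_irrefl _)
  msgs _ h := absurd h (Nat.not_lt_zero _)
  chals _ h := absurd h (Nat.not_lt_zero _)

/-- The modulus itself is the range of the sample, so the coefficient is exactly uniform; `hk` keeps
the counter in cell `20` from wrapping around. -/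
lemma above_seedStep {f : Conf n d → ℝ} {l : ℕ → ℕ} {k : ℕ} {m : Mem} {o : ℕ →₀ ℕ}
    {ψ : Basis n d → ℂ} {ρ : ℕ → ℝ} (hk : k + 1 < d.chal * M) (hs : Seeding n d q M l k m)
    (h : ∀ u m', Seeding n d q M (Function.update l k u) (k + 1) m' →
      Above f m' o ((1 / (Real.sqrt (d.chal * M : ℕ) : ℂ)) • ψ) (ρ u)) :
    Above (wp A (seedStep n) f) m o ψ (∑ u ∈ Finset.range (d.chal * M), ρ u) := by
  refine Above.seq (Above.sample (e := cell 10) hs.modulus (by omega) ρ fun u _ => Above.cl (h u _ ?_))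
  have e : (setTo 20 (.op .add (cell 20) (.const 1))).exec (Function.update m
      ((Exp.op .add (.const (30 + 2 * n)) (cell 20)).eval m) u) =
      Function.update (Function.update m (30 + 2 * n + k) u) 20 (k + 1) := by
    simp only [setTo, CProg.exec, Exp.eval, Op.eval, reduced_eval, cell_eval, hs.count]
    rw [Function.update_of_ne (show (20 : ℕ) ≠ 30 + 2 * n + k by omega), hs.count,
      Function.update_of_ne (show (10 : ℕ) ≠ 30 + 2 * n + k by omega), hs.modulus,
      Nat.mod_eq_of_lt hk]
  rw [e]
  have h' : ∀ i, i ≠ 20 → i ≠ 30 + 2 * n + k →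
      Function.update (Function.update m (30 + 2 * n + k) u) 20 (k + 1) i = m i := by
    intro i h1 h2
    simp [h1, h2]
  exact
  { queries := (h' _ (by omega) (by omega)).trans hs.queries
    msg := (h' _ (by omega) (by omega)).trans hs.msg
    modulus := (h' _ (by omega) (by omega)).trans hs.modulus
    divisor := (h' _ (by omega) (by omega)).trans hs.divisor
    next := (h' _ (by omega) (by omega)).trans hs.next
    flag := (h' _ (by omega) (by omega)).trans hs.flag
    count := Function.update_self _ _ _
    seeds := fun i hi => by
      rcases Nat.lt_succ_iff_lt_or_eq.1 hi with hi | rfl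
      · rw [h' _ (by omega) (by omega), Function.update_of_ne (by omega)]
        exact hs.seeds i hi
      · rw [Function.update_of_ne (by omega)]; simp }

section Seeds

variable [NeZero (d.chal * M)]

/-- The average over the coefficients from the `k`-th on. -/
def partialAvg {K : ℕ} (Φ : (Fin K → ZMod (d.chal * M)) → ℝ) (k : ℕ) (l : ℕ → ℕ) : ℝ :=
  avg fun s : Fin K → ZMod (d.chal * M) => Φ fun i => if i.val < k then (l i : ZMod (d.chal * M)) else s i

lemma sum_range_cast_zmod (N : ℕ) [NeZero N] (g : ZMod N → ℝ) :
    ∑ u ∈ Finset.range N, g u = ∑ z, g z := by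
  refine Finset.sum_nbij' (fun u => (u : ZMod N)) ZMod.val (by simp) ?_ ?_ (by simp) (by simp)
  · intro z _; simpa using ZMod.val_lt z
  · intro u hu; exact ZMod.val_cast_of_lt (Finset.mem_range.1 hu)

lemma partialAvg_succ {K : ℕ} (Φ : (Fin K → ZMod (d.chal * M)) → ℝ) {k : ℕ} (hk : k < K)
    (l : ℕ → ℕ) : partialAvg Φ k l =
      ∑ u ∈ Finset.range (d.chal * M), 1 / ((d.chal * M : ℕ) : ℝ) *
        partialAvg Φ (k + 1) (Function.update l k u) := by
  classical
  have hN : ((d.chal * M : ℕ) : ℝ) ≠ 0 := by exact_mod_cast NeZero.ne _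
  set g : (Fin K → ZMod (d.chal * M)) → ℝ := fun s =>
    Φ fun i => if i.val < k then (l i : ZMod (d.chal * M)) else s i with hg
  have h1 : ∀ u : ℕ, partialAvg Φ (k + 1) (Function.update l k u) =
      avg fun s => g (Function.update s ⟨k, hk⟩ (u : ZMod (d.chal * M))) := by
    intro u
    unfold partialAvg
    congr 1
    funext s
    rw [hg]
    congr 1
    funext i
    rcases lt_trichotomy i.val k with h | h | h
    · rw [if_pos (by omega), if_pos h, Function.update_of_ne (by omega)]
    · have : i = ⟨k, hk⟩ := Fin.ext h
      subst this
      simp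
    · rw [if_neg (by omega), if_neg (by omega), Function.update_of_ne (by
        intro e; rw [e] at h; exact lt_irrefl _ h)]
  simp only [h1]
  rw [← Finset.mul_sum, sum_range_cast_zmod (d.chal * M) fun z => avg fun s =>
    g (Function.update s ⟨k, hk⟩ z)]
  simp only [avg, ← Finset.sum_div]
  rw [Finset.sum_comm, sum_update ⟨k, hk⟩ g, ZMod.card, partialAvg, avg]
  field_simp
  rfl

/-- The invariant is the average over the coefficients not yet sampled, as a function of those
already sampled; sampling one of them splits this average by `partialAvg_succ`. Each iteration
samples two. -/
lemma above_seedProg (hq : 2 * q < d.chal * M) {f : Conf n d → ℝ} (hf0 : ∀ s, 0 ≤ f s)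
    {m : Mem} {o : ℕ →₀ ℕ} {ψ : Basis n d → ℂ} {l : ℕ → ℕ}
    (Φ : (Fin (2 * q) → ZMod (d.chal * M)) → (Basis n d → ℂ) → ℝ)
    (hΦ : ∀ s (z : ℂ) ψ, Φ s (z • ψ) = ‖z‖ ^ 2 * Φ s ψ)
    (hs : Seeding n d q M l 0 m)
    (h : ∀ l m ψ, Seeding n d q M l (2 * q) m →
      Above f m o ψ (Φ (fun i => (l i : ZMod (d.chal * M))) ψ)) :
    Above (wp A (seedProg n) f) m o ψ (avg fun s => Φ s ψ) := by
  have hsmul : ∀ k l ψ, partialAvg (fun s => Φ s ((1 / (Real.sqrt (d.chal * M : ℕ) : ℂ)) • ψ)) k l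
      = 1 / ((d.chal * M : ℕ) : ℝ) * partialAvg (fun s => Φ s ψ) k l := by
    intro k l ψ
    simp only [partialAvg, avg, hΦ, norm_sq_inv_sqrt, ← Finset.mul_sum, mul_div_assoc]
  refine Above.loop hf0 (fun i m o' ψ r => o' = o ∧ ∃ k l, k + 2 * i = 2 * q ∧
    Seeding n d q M l k m ∧ r = partialAvg (fun s => Φ s ψ) k l) ?_ ?_ ?_
  · rintro m _ ψ r ⟨rfl, k, l, hk, hs, rfl⟩
    obtain rfl : k = 2 * q := by omega
    refine (h l m ψ hs).mono (le_of_eq ?_)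
    rw [partialAvg, avg]
    simp only [Fin.is_lt, if_true, Finset.sum_const, Finset.card_univ, nsmul_eq_mul]
    rw [mul_div_cancel_left₀]
    exact_mod_cast Fintype.card_ne_zero
  · rintro i g hg hR m _ ψ r ⟨rfl, k, l, hk, hs, rfl⟩
    rw [partialAvg_succ _ (by omega)]
    refine Above.seq (above_seedStep (by omega) hs fun u m' hs' => ?_)
    rw [← hsmul, partialAvg_succ _ (by omega)]
    refine above_seedStep (by omega) hs' fun v m'' hs'' => ?_
    rw [← hsmul]
    exact hR _ _ _ _ ⟨rfl, k + 2, _, by omega, hs'', rfl⟩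
  · refine ⟨rfl, 0, l, by simp [hs.queries], hs, ?_⟩
    simp [partialAvg]

end Seeds

lemma two_le_baseVal (n : ℕ) (d : Sizes) (q : ℕ) : 2 * q + n + 2 ≤ baseVal n d q := by
  unfold baseVal; omega

lemma pow_lt_quotVal (n : ℕ) (d : Sizes) (q : ℕ) {k : ℕ} (hk : k < 2 * n + 8) :
    baseVal n d q ^ k < quotVal n d q := by
  have hb := two_le_baseVal n d q
  have h1 : baseVal n d q ^ k < baseVal n d q ^ (2 * n + 8) := Nat.pow_lt_pow_right (by omega) hk
  have h2 : 1 ≤ (baseVal n d q ^ 4) ^ q := Nat.one_le_pow _ _ (pow_pos (by omega) 4)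
  exact h1.trans_le (Nat.le_mul_of_pos_right _ h2)

lemma quotVal_pos (n : ℕ) (d : Sizes) (q : ℕ) : 0 < quotVal n d q :=
  (Nat.zero_le _).trans_lt (pow_lt_quotVal n d q (k := 0) (by omega))

/-- The simulator succeeds at least as often as the runs with events in the right order do. -/
lemma avg_goodSum_le (hn : 0 < n) (hC : 0 < d.chal) (A : Adversary n d q) (prot : PCIP n d)
    (x : Fin d.inst) (a : Fin n → Fin d.msg) (c : Fin n → Fin d.chal)
    [NeZero (d.chal * quotVal n d q)] :
    guessProb n q n * avg (fun s : Fin (2 * q) → ZMod (d.chal * quotVal n d q) =>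
      goodSum (accNorm prot x a c) x a c (seedHash s) A.ops 0 A.start) ≤
    ((finalViews A (simulator n) c).map (payoff prot x a c)).sum := by
  have hb := two_le_baseVal n d q
  have hle : ∀ v, v < quotVal n d q → v < d.chal * quotVal n d q := fun v hv =>
    hv.trans_le (Nat.le_mul_of_pos_left _ hC)
  have hq : 2 * q < d.chal * quotVal n d q := by
    refine hle _ (lt_of_le_of_lt ?_ (pow_lt_quotVal n d q (k := 1) (by omega)))
    rw [pow_one]; omega
  have hN : (d.inst + d.chal) * d.msg < d.chal * quotVal n d q := by
    refine hle _ (lt_of_le_of_lt ?_ (pow_lt_quotVal n d q (k := 1) (by omega)))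
    rw [pow_one, baseVal]
    have : (d.inst + d.chal) * d.msg * 1 ≤ (d.inst + d.chal) * d.msg * (2 * n) :=
      Nat.mul_le_mul_left _ (by omega)
    rw [mul_one, ← mul_assoc] at this
    omega
  have hN2 : (2 * q + n + 2) ^ n < d.chal * quotVal n d q :=
    hle _ (lt_of_le_of_lt (Nat.pow_le_pow_left hb n) (pow_lt_quotVal n d q (by omega)))
  obtain ⟨g, hg, hsum, hgood⟩ := exists_continuation (M := quotVal n d q) hq hN hN2 A prot x a c
    (n - 1) 0 (by omega)
  rw [← hsum, views]
  simp only [List.map_map]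
  set f : Conf n d → ℝ := fun s => g ⟨s, s.mem 4, fun _ => s.mem 5⟩ with hf
  have hsim : simulator n ⟨0, by omega⟩ =
      .seq (.seq (.cl (initProg n)) (seedProg n)) (searchProg n 0) := by
    simp [simulator, hn]
  have habove : Above (wp A (simulator n ⟨0, by omega⟩) f) (startConf A).mem 0 A.start
      (avg fun s : Fin (2 * q) → ZMod (d.chal * quotVal n d q) => guessProb n q n *
        goodSum (accNorm prot x a c) x a c (seedHash s) A.ops 0 A.start) := by
    rw [hsim]
    refine Above.seq (Above.seq (Above.cl ?_))
    rw [initProg_exec (q := q) (d := d) (by rfl) (by rfl) (by rfl) (by rfl)]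
    refine above_seedProg (l := fun _ => 0) hq (wp_nonneg (fun s => hg _) _)
      (fun s ψ => guessProb n q n *
        goodSum (accNorm prot x a c) x a c (seedHash s) A.ops 0 ψ) ?_ ?_ ?_
    · intro s z ψ
      simp only [goodSum_smul x a c (seedHash s) (accNorm_smul prot)]
      ring
    · constructor <;> first | rfl | (intro i hi; omega)
    · intro l m ψ hs
      refine above_searchProg hq hN hN2 ⟨0, hn⟩ (fun s => hg _) ?_ (accNorm_nonneg prot)
        (accNorm_smul prot) (accNorm_le_output prot _) (j := 0) (l := l)
        { ready := hs.ready
          le := Nat.zero_le _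
          flag := hs.flag
          own := fun _ _ => rfl
          bound := le_rfl }
      intro m o ψ r hs time
      have h : m 4 = x ∧ m 5 = a ⟨0, hn⟩ := by
        rcases hs with ⟨j, hj, hs⟩ | hs
        · exact ⟨hs.ready.inst (by simp), hs.message⟩
        · exact ⟨hs.ready.inst (by simp), hs.message⟩
      have := hgood l m o ψ r (fun _ => m 5) (fun i hi => by
        have : i = ⟨0, hn⟩ := Fin.ext (by simpa using hi)
        rw [this]; exact h.2) hs time
      rw [← h.1] at this
      exact this
  refine le_trans (le_of_eq ?_) (habove 0)
  simp only [avg, ← Finset.mul_sum, mul_div_assoc]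

end MultiRoundFS
end

noncomputable section
namespace MultiRoundFS
variable {n : ℕ} {d : Sizes} {q : ℕ}

/-! ## The security loss -/

/-- The weight of the runs of `A` with output `x` in which the order of the events is wrong. -/
def badWeight (A : Adversary n d q) (x : Fin d.inst) : ℝ :=
  (∑ G : Hash n d, ∑ a, ∑ c, badSum (fun φ => nsq ((outEvent x a).indicator φ)) x a c G
    A.ops 0 A.start) / d.chal ^ n / Fintype.card (Hash n d)

lemma badWeight_nonneg (A : Adversary n d q) (x : Fin d.inst) : 0 ≤ badWeight A x := by
  refine div_nonneg (div_nonneg (Finset.sum_nonneg fun G _ => Finset.sum_nonneg fun a _ =>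
    Finset.sum_nonneg fun c _ => ?_) (by positivity)) (by positivity)
  exact badSum_nonneg x a c G (fun _ => nsq_nonneg _) _ _ _

lemma nsq_start (A : Adversary n d q) : nsq A.start = 1 := A.start_norm

/-- The product is the inverse number of pairs of an instance and messages, so guessing all of them
cancels the sum over transcripts in `sum_badWeight_le`. -/
lemma prod_msgWeight (hn : 0 < n) (hX : 0 < d.inst) :
    ∏ i : Fin n, msgWeight d i = 1 / (d.inst * (d.msg : ℝ) ^ n) := by
  obtain ⟨k, rfl⟩ : ∃ k, n = k + 1 := ⟨n - 1, by omega⟩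
  have hX' : (d.inst : ℝ) ≠ 0 := by exact_mod_cast hX.ne'
  rw [Fin.prod_univ_succ]
  simp only [msgWeight, Fin.val_zero, if_true, Fin.val_succ, Nat.add_eq_zero_iff, one_ne_zero,
    and_false, if_false, Finset.prod_const, Finset.card_univ, Fintype.card_fin]
  rw [div_mul_cancel_left₀ hX']
  push_cast
  ring

lemma sum_badWeight_le (hn : 0 < n) (hX : 0 < d.inst) (hM : 0 < d.msg) (hC : 0 < d.chal)
    (A : Adversary n d q) : ∑ x, badWeight A x ≤ runs q n / d.chal := by
  have hX' : (0 : ℝ) < d.inst := by exact_mod_cast hX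
  have hM' : (0 : ℝ) < d.msg := by exact_mod_cast hM
  have hC' : (0 : ℝ) < d.chal := by exact_mod_cast hC
  have : Nonempty (Hash n d) := ⟨fun _ => ⟨0, hC⟩⟩
  have hcard : (0 : ℝ) < Fintype.card (Hash n d) := by exact_mod_cast Fintype.card_pos
  unfold badWeight
  rw [← Finset.sum_div, ← Finset.sum_div, div_le_iff₀ hcard, div_le_iff₀ (by positivity),
    Finset.sum_comm]
  have key : ∀ G : Hash n d, ∑ x, ∑ a, ∑ c, badSum (fun φ => nsq ((outEvent x a).indicator φ))
      x a c G A.ops 0 A.start ≤ runs q n / d.chal * d.chal ^ n := by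
    intro G
    have h := sum_badSum_le hX hM G hC A.ops A.contracts_ops 0 (fun _ => A.start)
      (fun _ _ _ _ => rfl) (fun _ _ _ _ => rfl)
    simp only [Fintype.sum_prod_type] at h
    refine h.trans (le_of_eq ?_)
    rw [below_zero, Finset.compl_empty, prod_msgWeight hn hX, A.length_ops, nsq_start]
    simp
    field_simp
  refine (Finset.sum_le_sum fun G _ => key G).trans (le_of_eq ?_)
  rw [Finset.sum_const, Finset.card_univ, nsmul_eq_mul]
  ring

/-- The loss due to the limited independence of the hash functions. -/
def seedLoss (n : ℕ) (d : Sizes) (q : ℕ) : ℝ :=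
  runs q n * ((((Fintype.card (Dom n d) + 1) ^ q : ℕ) : ℝ) ^ 2 *
    gapUnit n d (quotVal n d q) (2 * q))

lemma seedLoss_nonneg (n : ℕ) (d : Sizes) (q : ℕ) : 0 ≤ seedLoss n d q := by
  have := gapUnit_nonneg (n := n) (d := d) (M := quotVal n d q) (2 * q)
  unfold seedLoss; positivity

/-- The exponent in `quotVal` is chosen for this estimate: each factor on the left, apart from `runs
q n`, is bounded by a power of `baseVal`. The factor `2q + n` prepares the absorption of the loss in
`sum_rawError_le`. -/
lemma seedLoss_le (hn : 0 < n) (hX : 0 < d.inst) (hC : 0 < d.chal) (hM : 0 < d.msg) :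
    (d.inst * d.chal * d.msg ^ n : ℝ) * seedLoss n d q * (2 * q + n) ≤ runs q n := by
  set β := baseVal n d q with hβ
  have hpos : (0 : ℝ) < quotVal n d q := by exact_mod_cast quotVal_pos n d q
  have hu : (d.inst + d.chal) * d.msg * 2 * n + (2 * q + (n + 2)) = β := rfl
  have h1 : (d.inst + d.chal) * d.msg ≤ (d.inst + d.chal) * d.msg * n :=
    Nat.le_mul_of_pos_right _ hn
  have h1' : (d.inst + d.chal) * d.msg * 2 * n = 2 * ((d.inst + d.chal) * d.msg * n) := by ring
  have h2 : d.inst + d.chal ≤ (d.inst + d.chal) * d.msg := Nat.le_mul_of_pos_right _ hM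
  have h3 : d.msg ≤ (d.inst + d.chal) * d.msg := Nat.le_mul_of_pos_left _ (by omega)
  have hcard : Fintype.card (Dom n d) + 1 ≤ β := by
    have : Fintype.card (Dom n d) = (d.inst + d.chal) * d.msg * n := by
      simp [Dom, Fintype.card_prod, Fintype.card_sum]; ring
    omega
  have henc : encodeBound n d ≤ β := by unfold encodeBound; omega
  have key : d.inst * d.chal * d.msg ^ n * ((Fintype.card (Dom n d) + 1) ^ q) ^ 2 *
      ((2 * q) * (2 * encodeBound n d ^ (2 * q))) * (2 * q + n) ≤ quotVal n d q := by
    calc _ ≤ β * β * β ^ n * (β ^ q) ^ 2 * (β * (β * β ^ (2 * q))) * β := by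
          gcongr <;> omega
      _ = β ^ (4 * q + (n + 5)) := by ring
      _ ≤ β ^ (4 * q + (2 * n + 8)) := Nat.pow_le_pow_right (by omega) (by omega)
      _ = quotVal n d q := by rw [quotVal, ← hβ]; ring
  have key' : (d.inst * d.chal * d.msg ^ n * ((Fintype.card (Dom n d) + 1) ^ q) ^ 2 *
      ((2 * q) * (2 * encodeBound n d ^ (2 * q))) * (2 * q + n) : ℝ) ≤ quotVal n d q := by
    exact_mod_cast key
  have hr : (0 : ℝ) ≤ runs q n := Nat.cast_nonneg _
  calc _ = runs q n * ((d.inst * d.chal * d.msg ^ n * ((Fintype.card (Dom n d) + 1) ^ q) ^ 2 *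
      ((2 * q) * (2 * encodeBound n d ^ (2 * q))) * (2 * q + n) : ℝ) / quotVal n d q) := by
        unfold seedLoss gapUnit; push_cast; ring
    _ ≤ runs q n * 1 := mul_le_mul_of_nonneg_left ((div_le_one hpos).2 key') hr
    _ = _ := mul_one _

/-- The factor in the security bound. -/
def lossFactor (n q : ℕ) : ℝ := (n.factorial : ℝ) / (2 * q + n + 1 : ℝ) ^ (2 * n)

lemma lossFactor_nonneg (n q : ℕ) : 0 ≤ lossFactor n q := by unfold lossFactor; positivity

/-- One factor `(2q + n)^n` pays for Cauchy–Schwarz, the other for the guesses of the simulator. -/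
lemma lossFactor_mul_runs_le (hn : 0 < n) (q : ℕ) : lossFactor n q * runs q n ≤ guessProb n q n := by
  have hn' : (0 : ℝ) < n := by exact_mod_cast hn
  have h1 : (runs q n : ℝ) ≤ (2 * q + n : ℝ) ^ n := by exact_mod_cast runs_le hn q n
  unfold lossFactor guessProb
  rw [div_mul_eq_mul_div, div_le_div_iff₀ (by positivity) (by positivity), mul_assoc]
  refine mul_le_mul_of_nonneg_left ?_ (by positivity)
  calc (runs q n : ℝ) * (2 * q + n : ℝ) ^ n ≤ (2 * q + n : ℝ) ^ n * (2 * q + n : ℝ) ^ n := by gcongr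
    _ = (2 * q + n : ℝ) ^ (2 * n) := by ring
    _ ≤ _ := pow_le_pow_left₀ (by positivity) (by linarith) _

/-- The error term before normalization. -/
def rawError (A : Adversary n d q) (x : Fin d.inst) : ℝ :=
  lossFactor n q * runs q n * (badWeight A x + d.msg ^ n * seedLoss n d q)

lemma rawError_nonneg (A : Adversary n d q) (x : Fin d.inst) : 0 ≤ rawError A x := by
  have := lossFactor_nonneg n q
  have := badWeight_nonneg A x
  have := seedLoss_nonneg n d q
  unfold rawError; positivity

/-- The bad runs alone would give `n!/|𝒞|` already with denominator `(2q + n)^(2n)`. The `+ 1` in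
the denominator of `lossFactor` leaves room for the loss from the seeds. -/
lemma sum_rawError_le (hn : 0 < n) (hX : 0 < d.inst) (hM : 0 < d.msg) (hC : 0 < d.chal)
    (A : Adversary n d q) : ∑ x, rawError A x ≤ (n.factorial : ℝ) / d.chal := by
  have hn' : (0 : ℝ) < n := by exact_mod_cast hn
  have hn1 : (1 : ℝ) ≤ n := by exact_mod_cast hn
  have hC' : (0 : ℝ) < d.chal := by exact_mod_cast hC
  have hbad := sum_badWeight_le hn hX hM hC A
  have hloss := seedLoss_le (q := q) hn hX hC hM
  set y : ℝ := 2 * q + n with hy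
  have hy0 : 0 < y := by positivity
  set N := ((runs q n : ℕ) : ℝ) with hN
  have hN0 : 0 ≤ N := Nat.cast_nonneg _
  have h1 : N ≤ y ^ n := by rw [hN, hy]; exact_mod_cast runs_le hn q n
  have hfac := lossFactor_nonneg n q
  have h2 : ∑ x, rawError A x = lossFactor n q * N *
      (∑ x, badWeight A x + d.inst * (d.msg ^ n * seedLoss n d q)) := by
    simp only [rawError, ← Finset.mul_sum, Finset.sum_add_distrib, Finset.sum_const,
      Finset.card_univ, Fintype.card_fin, nsmul_eq_mul, hN]
    ring
  -- By `seedLoss_le` the loss from the seeds is at most the share `1/y` of the bound for the bad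
  -- runs.
  have h3 : ∑ x, badWeight A x + d.inst * (d.msg ^ n * seedLoss n d q) ≤
      N * (1 + 1 / y) / d.chal := by
    rw [le_div_iff₀ hC', mul_add, mul_one, mul_one_div, add_mul]
    refine add_le_add ((le_div_iff₀ hC').1 hbad) ((le_div_iff₀ hy0).2 ?_)
    exact le_trans (le_of_eq (by ring)) hloss
  -- One of the `2n ≥ 1` factors `y` is enlarged to `y + 1`, which absorbs `1 + 1/y`.
  have h4 : y ^ (2 * n) * (1 + 1 / y) ≤ (y + 1) ^ (2 * n) := by
    obtain ⟨k, hk⟩ : ∃ k, 2 * n = k + 1 := ⟨2 * n - 1, by omega⟩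
    rw [hk, pow_succ (y + 1), show y ^ (k + 1) * (1 + 1 / y) = y ^ k * (y + 1) by
      field_simp; ring]
    gcongr
    linarith
  calc _ = lossFactor n q * N * (∑ x, badWeight A x + d.inst * (d.msg ^ n * seedLoss n d q)) := h2
    _ ≤ lossFactor n q * N * (N * (1 + 1 / y) / d.chal) := by gcongr
    _ = lossFactor n q * (N * N * (1 + 1 / y)) / d.chal := by ring
    _ ≤ lossFactor n q * (y ^ n * y ^ n * (1 + 1 / y)) / d.chal := by gcongr
    _ = lossFactor n q * (y ^ (2 * n) * (1 + 1 / y)) / d.chal := by rw [two_mul n, pow_add]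
    _ ≤ lossFactor n q * (y + 1) ^ (2 * n) / d.chal := by gcongr
    _ = n.factorial / d.chal := by
      rw [lossFactor, ← hy, div_mul_cancel₀]
      positivity

lemma avg_nsq_evol_le (A : Adversary n d q) (prot : PCIP n d) (x : Fin d.inst)
    (a : Fin n → Fin d.msg) (c : Fin n → Fin d.chal) (G : Hash n d) :
    nsq (accMatrix prot x a c *ᵥ evol (reprog x a c Finset.univ G) A.ops A.start) ≤
      runs q n * (goodSum (accNorm prot x a c) x a c G A.ops 0 A.start +
        badSum (fun φ => nsq ((outEvent x a).indicator φ)) x a c G A.ops 0 A.start) := by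
  have h := nsq_evol_le_goodSum_add_badSum (accMatrix prot x a c) x a c G A.ops 0 A.start
  rw [A.length_ops, Nat.sub_zero] at h
  refine h.trans (mul_le_mul_of_nonneg_left (add_le_add le_rfl ?_) (Nat.cast_nonneg _))
  exact badSum_mono x a c G (fun φ => nsq_accMatrix_le prot x a c φ) _ _ _

lemma avg_goodSum_le_seed (A : Adversary n d q) (prot : PCIP n d)
    (x : Fin d.inst) (a : Fin n → Fin d.msg) (c : Fin n → Fin d.chal)
    [NeZero (d.chal * quotVal n d q)] :
    avg (fun G : Hash n d => goodSum (accNorm prot x a c) x a c G A.ops 0 A.start) ≤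
      avg (fun s : Fin (2 * q) → ZMod (d.chal * quotVal n d q) =>
        goodSum (accNorm prot x a c) x a c (seedHash s) A.ops 0 A.start) + seedLoss n d q := by
  have h := abs_seedGap_goodSum_le (M := quotVal n d q) (k := 2 * q)
    (contracts_accMatrix prot x a c) x a c A.ops A.contracts_ops 0
    (juntaSum_const (nsq_start A).le) (by rw [A.length_ops]; omega)
  rw [A.length_ops, Nat.sub_zero, one_mul] at h
  have h' := (abs_le.1 h).1
  unfold seedGap at h'
  have : -seedLoss n d q ≤ avg (fun s : Fin (2 * q) → ZMod (d.chal * quotVal n d q) =>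
        goodSum (accNorm prot x a c) x a c (seedHash s) A.ops 0 A.start) -
      avg (fun G : Hash n d => goodSum (accNorm prot x a c) x a c G A.ops 0 A.start) := h'
  linarith

/-- Cauchy–Schwarz bounds forging by good plus bad runs, the good part is transferred to seeded hash
functions, and the simulator dominates the latter. The factor `d.msg ^ n` in `rawError` arises
because the loss occurs once for each `a`, whereas `c` is averaged. -/
lemma lossFactor_mul_forgeProb_le (hn : 0 < n) (hC : 0 < d.chal) (A : Adversary n d q)
    (prot : PCIP n d) (x : Fin d.inst) :
    lossFactor n q * forgeProb A prot x - rawError A x ≤ interactProb A (simulator n) prot x := by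
  have : NeZero (d.chal * quotVal n d q) := ⟨(Nat.mul_pos hC (quotVal_pos n d q)).ne'⟩
  have hC' : (0 : ℝ) < d.chal := by exact_mod_cast hC
  have : Nonempty (Hash n d) := ⟨fun _ => ⟨0, hC⟩⟩
  have hcard : (0 : ℝ) < Fintype.card (Hash n d) := by exact_mod_cast Fintype.card_pos
  have hfac := lossFactor_nonneg n q
  have hN : (0 : ℝ) ≤ runs q n := Nat.cast_nonneg _
  set good : (Fin n → Fin d.msg) → (Fin n → Fin d.chal) → ℝ := fun a c =>
    avg (fun G : Hash n d => goodSum (accNorm prot x a c) x a c G A.ops 0 A.start) with hgood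
  set seed : (Fin n → Fin d.msg) → (Fin n → Fin d.chal) → ℝ := fun a c =>
    avg (fun s : Fin (2 * q) → ZMod (d.chal * quotVal n d q) =>
        goodSum (accNorm prot x a c) x a c (seedHash s) A.ops 0 A.start) with hseed
  have hseed0 : ∀ a c, 0 ≤ seed a c := fun a c => div_nonneg (Finset.sum_nonneg fun s _ =>
    goodSum_nonneg x a c _ (accNorm_nonneg prot) _ _ _) (by positivity)
  have h1 : forgeProb A prot x ≤
      runs q n * ((∑ a, ∑ c, good a c) / d.chal ^ n + badWeight A x) := by
    rw [forgeProb_eq A prot x hC]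
    calc _ ≤ (∑ G : Hash n d, ∑ a, ∑ c, runs q n *
          (goodSum (accNorm prot x a c) x a c G A.ops 0 A.start +
          badSum (fun φ => nsq ((outEvent x a).indicator φ)) x a c G A.ops 0 A.start)) /
          d.chal ^ n / Fintype.card (Hash n d) := by
          gcongr with G _ a _ c _
          exact avg_nsq_evol_le A prot x a c G
      _ = _ := by
        have e : ∑ a, ∑ c, good a c = (∑ G : Hash n d, ∑ a, ∑ c,
            goodSum (accNorm prot x a c) x a c G A.ops 0 A.start) / Fintype.card (Hash n d) := by
          simp only [hgood, avg, ← Finset.sum_div]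
          congr 1
          exact (Finset.sum_congr rfl fun a _ => Finset.sum_comm).trans Finset.sum_comm
        rw [e, badWeight]
        simp only [← Finset.mul_sum, Finset.sum_add_distrib]
        ring
  have h2 : ∀ a c, good a c ≤ seed a c + seedLoss n d q := fun a c =>
    avg_goodSum_le_seed A prot x a c
  have h3 : guessProb n q n * (∑ a, ∑ c, seed a c) / d.chal ^ n ≤
      interactProb A (simulator n) prot x := by
    rw [interactProb_eq]
    simp only [Finset.mul_sum]
    gcongr with a _ c _
    exact avg_goodSum_le hn hC A prot x a c
  have h4 : (∑ a, ∑ c, good a c) / d.chal ^ n ≤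
      (∑ a, ∑ c, seed a c) / d.chal ^ n + d.msg ^ n * seedLoss n d q := by
    rw [div_le_iff₀ (by positivity), add_mul, div_mul_cancel₀ _ (by positivity)]
    refine (Finset.sum_le_sum fun a _ => Finset.sum_le_sum fun c _ => h2 a c).trans
      (le_of_eq ?_)
    simp only [Finset.sum_add_distrib, Finset.sum_const, Finset.card_univ, Fintype.card_fun,
      Fintype.card_fin, nsmul_eq_mul]
    push_cast; ring
  have h5 : lossFactor n q * runs q n * ((∑ a, ∑ c, seed a c) / d.chal ^ n) ≤
      guessProb n q n * ((∑ a, ∑ c, seed a c) / d.chal ^ n) := by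
    have := Finset.sum_nonneg fun a (_ : a ∈ Finset.univ) =>
      Finset.sum_nonneg fun c (_ : c ∈ Finset.univ) => hseed0 a c
    exact mul_le_mul_of_nonneg_right (lossFactor_mul_runs_le hn q) (by positivity)
  have h6 := mul_le_mul_of_nonneg_left h1 hfac
  have h7 := mul_le_mul_of_nonneg_left h4 (mul_nonneg hfac hN)
  rw [mul_div_assoc] at h3
  unfold rawError
  nlinarith

/-- The error terms with the prescribed sum. -/
lemma exists_error (hn : 0 < n) (hX : 0 < d.inst) (hM : 0 < d.msg) (hC : 0 < d.chal)
    (A : Adversary n d q) : ∃ ε : Fin d.inst → ℝ, (∀ x, 0 ≤ ε x) ∧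
      ∑ x, ε x = (n.factorial : ℝ) / d.chal ∧ ∀ (prot : PCIP n d) (x : Fin d.inst),
        lossFactor n q * forgeProb A prot x - ε x ≤ interactProb A (simulator n) prot x := by
  have hX' : (d.inst : ℝ) ≠ 0 := by exact_mod_cast hX.ne'
  -- The total is prescribed exactly, so what is missing from it is distributed evenly over the
  -- instances.
  have hpad : 0 ≤ ((n.factorial : ℝ) / d.chal - ∑ x, rawError A x) / d.inst :=
    div_nonneg (sub_nonneg.2 (sum_rawError_le hn hX hM hC A)) (Nat.cast_nonneg _)
  refine ⟨fun x => rawError A x + ((n.factorial : ℝ) / d.chal - ∑ x, rawError A x) / d.inst,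
    fun x => add_nonneg (rawError_nonneg A x) hpad, ?_, fun prot x => ?_⟩
  · rw [Finset.sum_add_distrib, Finset.sum_const, Finset.card_univ, Fintype.card_fin,
      nsmul_eq_mul, mul_div_cancel₀ _ hX']
    ring
  · have := lossFactor_mul_forgeProb_le hn hC A prot x
    linarith

end MultiRoundFS
end

noncomputable section
namespace MultiRoundFS
variable {n : ℕ} {d : Sizes} {q : ℕ}

/-! ## Running time -/

lemma Op.size_eval_le (o : Op) (k l : ℕ) : (o.eval k l).size ≤ k.size + l.size + 1 := by
  have hk : k < 2 ^ k.size := Nat.lt_size_self k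
  have hl : l < 2 ^ l.size := Nat.lt_size_self l
  have hk1 : k < 2 ^ (k.size + l.size + 1) :=
    hk.trans_le (Nat.pow_le_pow_right (by omega) (by omega))
  rw [Nat.size_le]
  cases o with
  | add =>
    have h1 : 2 ^ k.size ≤ 2 ^ (k.size + l.size) := Nat.pow_le_pow_right (by omega) (by omega)
    have h2 : 2 ^ l.size ≤ 2 ^ (k.size + l.size) := Nat.pow_le_pow_right (by omega) (by omega)
    rw [pow_succ]
    simp only [Op.eval]
    omega
  | sub => exact (Nat.sub_le k l).trans_lt hk1
  | mul =>
    have : k * l ≤ 2 ^ k.size * 2 ^ l.size := Nat.mul_le_mul hk.le hl.le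
    rw [← pow_add] at this
    have h2 : 2 ^ (k.size + l.size) < 2 ^ (k.size + l.size + 1) :=
      Nat.pow_lt_pow_right (by omega) (by omega)
    exact this.trans_lt h2
  | div => exact (Nat.div_le_self k l).trans_lt hk1
  | mod => exact (Nat.mod_le k l).trans_lt hk1
  | xor =>
    exact Nat.xor_lt_two_pow hk1 (hl.trans_le (Nat.pow_le_pow_right (by omega) (by omega)))

/-- An expression is a fixed tree and each operation adds the lengths up to one bit, so the
polynomials compose. -/
lemma Exp.exists_bound (e : Exp) : ∃ p : Polynomial ℕ, ∀ (B : ℕ) (m : Mem),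
    (∀ i, (m i).size ≤ B) → (e.eval m).size ≤ p.eval B ∧ e.cost m ≤ p.eval B := by
  induction e with
  | const k => exact ⟨Polynomial.C (1 + k.size), fun B m _ => by simp [Exp.eval, Exp.cost]⟩
  | mem e ih =>
    obtain ⟨p, hp⟩ := ih
    refine ⟨p + 1 + .X, fun B m hm => ?_⟩
    have h1 := hp B m hm
    have h2 := hm (e.eval m)
    simp only [Exp.eval, Exp.cost, Polynomial.eval_add, Polynomial.eval_one, Polynomial.eval_X]
    omega
  | op o e₁ e₂ ih₁ ih₂ =>
    obtain ⟨p₁, h₁⟩ := ih₁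
    obtain ⟨p₂, h₂⟩ := ih₂
    refine ⟨p₁ + p₂ + (1 + p₁) * (1 + p₂), fun B m hm => ?_⟩
    obtain ⟨h3, h4⟩ := h₁ B m hm
    obtain ⟨h5, h6⟩ := h₂ B m hm
    have h7 := Op.size_eval_le o (e₁.eval m) (e₂.eval m)
    have h8 := Nat.mul_le_mul (Nat.add_le_add_left h3 1) (Nat.add_le_add_left h5 1)
    simp only [Exp.eval, Exp.cost, Polynomial.eval_add, Polynomial.eval_mul, Polynomial.eval_one]
    refine ⟨?_, by omega⟩
    have : 1 ≤ (1 + p₁.eval B) * (1 + p₂.eval B) := Nat.one_le_iff_ne_zero.2 (by positivity)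
    omega

/-- The address is neither `0` nor `10`. -/
def Exp.Safe (e : Exp) : Prop := ∀ m, e.eval m ≠ 0 ∧ e.eval m ≠ 10

/-- The value is never longer than the longest content of a cell. -/
def Exp.Short (e : Exp) : Prop := (∃ e', e = reduced e') ∨ ∃ e', e = .mem e'

/-- Programs that leave the cells `0` and `10` alone and iterate over the content of cell `0`. -/
inductive CProg.Tame : CProg → Prop
  | assign {a e : Exp} : a.Safe → e.Short → Tame (.assign a e)
  | seq {P Q : CProg} : Tame P → Tame Q → Tame (.seq P Q)
  | ite {e : Exp} {P Q : CProg} : Tame P → Tame Q → Tame (.ite e P Q)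
  | loop {P : CProg} : Tame P → Tame (.loop (cell 0) P)

/-- All numbers in the memory are short. -/
structure Mem.Bounded (B : ℕ) (m : Mem) : Prop where
  count : m 0 ≤ B
  pos : 0 < m 10
  size : ∀ i, (m i).size ≤ B

lemma Mem.Bounded.update {B : ℕ} {m : Mem} (h : Mem.Bounded B m) {k v : ℕ} (h0 : k ≠ 0)
    (h10 : k ≠ 10) (hv : v.size ≤ B) : Mem.Bounded B (Function.update m k v) where
  count := by rw [Function.update_of_ne h0.symm]; exact h.count
  pos := by rw [Function.update_of_ne h10.symm]; exact h.pos
  size i := by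
    rw [Function.update_apply]
    split_ifs
    · exact hv
    · exact h.size i

lemma Exp.Short.size_le {e : Exp} (he : e.Short) {B : ℕ} {m : Mem} (h : Mem.Bounded B m) :
    (e.eval m).size ≤ B := by
  rcases he with ⟨e', rfl⟩ | ⟨e', rfl⟩
  · exact (Nat.size_le_size (Nat.mod_lt _ h.pos).le).trans (h.size 10)
  · exact h.size _

/-- The same `B` bounds the memory before and after: assigned values never exceed the longest cell,
and the loop count and the modulus are never overwritten. Hence a loop multiplies the time by at
most `B`, and nesting does no harm. -/
lemma CProg.Tame.exists_bound {P : CProg} (hP : P.Tame) : ∃ p : Polynomial ℕ, ∀ (B : ℕ) (m : Mem)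
    (t : ℕ), Mem.Bounded B m → Mem.Bounded B (P.run (m, t)).1 ∧ (P.run (m, t)).2 ≤ t + p.eval B := by
  induction hP with
  | @assign a e ha he =>
    obtain ⟨p₁, h₁⟩ := a.exists_bound
    obtain ⟨p₂, h₂⟩ := e.exists_bound
    refine ⟨1 + p₁ + p₂, fun B m t h => ⟨h.update (ha m).1 (ha m).2 (he.size_le h), ?_⟩⟩
    have h3 := (h₁ B m h.size).2
    have h4 := (h₂ B m h.size).2
    simp only [CProg.run, Polynomial.eval_add, Polynomial.eval_one]
    omega
  | seq _ _ ih₁ ih₂ =>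
    obtain ⟨p₁, h₁⟩ := ih₁
    obtain ⟨p₂, h₂⟩ := ih₂
    refine ⟨p₁ + p₂, fun B m t h => ?_⟩
    obtain ⟨h3, h4⟩ := h₁ B m t h
    obtain ⟨h5, h6⟩ := h₂ B _ (CProg.run _ (m, t)).2 h3
    refine ⟨h5, ?_⟩
    simp only [CProg.run, Polynomial.eval_add, Prod.mk.eta] at h6 ⊢
    omega
  | @ite e P Q _ _ ih₁ ih₂ =>
    obtain ⟨p₀, h₀⟩ := e.exists_bound
    obtain ⟨p₁, h₁⟩ := ih₁
    obtain ⟨p₂, h₂⟩ := ih₂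
    refine ⟨1 + p₀ + p₁ + p₂, fun B m t h => ?_⟩
    have h0 := (h₀ B m h.size).2
    simp only [CProg.run, Polynomial.eval_add, Polynomial.eval_one]
    split_ifs
    · obtain ⟨h3, h4⟩ := h₁ B m (t + 1 + e.cost m) h
      exact ⟨h3, by omega⟩
    · obtain ⟨h3, h4⟩ := h₂ B m (t + 1 + e.cost m) h
      exact ⟨h3, by omega⟩
  | @loop P _ ih =>
    obtain ⟨p₀, h₀⟩ := (cell 0).exists_bound
    obtain ⟨p, hp⟩ := ih
    refine ⟨1 + p₀ + .X * (1 + p), fun B m t h => ?_⟩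
    have key : ∀ k t, Mem.Bounded B (((fun t : Mem × ℕ => P.run (t.1, t.2 + 1))^[k] (m, t)).1) ∧
        ((fun t : Mem × ℕ => P.run (t.1, t.2 + 1))^[k] (m, t)).2 ≤ t + k * (1 + p.eval B) := by
      intro k t
      induction k with
      | zero => exact ⟨h, by simp⟩
      | succ k ihk =>
        rw [Function.iterate_succ_apply']
        obtain ⟨h3, h4⟩ := hp B _ (((fun t : Mem × ℕ => P.run (t.1, t.2 + 1))^[k] (m, t)).2 + 1)
          ihk.1
        refine ⟨h3, h4.trans ?_⟩
        have := ihk.2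
        linarith
    have h0 := (h₀ B m h.size).2
    obtain ⟨h3, h4⟩ := key (m 0) (t + 1 + (cell 0).cost m)
    refine ⟨h3, h4.trans ?_⟩
    have := Nat.mul_le_mul_right (1 + p.eval B) h.count
    simp only [Polynomial.eval_add, Polynomial.eval_one, Polynomial.eval_mul, Polynomial.eval_X]
    omega

/-- The programs for which the running time is estimated. -/
inductive Prog.Tame : Prog → Prop
  | cl {P : CProg} : P.Tame → Tame (.cl P)
  | seq {P Q : Prog} : Tame P → Tame Q → Tame (.seq P Q)
  | ite {e : Exp} {P Q : Prog} : Tame P → Tame Q → Tame (.ite e P Q)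
  | loop {P : Prog} : Tame P → Tame (.loop (cell 0) P)
  | sample {a e : Exp} : a.Safe → e.Short → Tame (.sample a e)
  | measure {a r : Exp} : a.Safe → Tame (.measure a r)
  | coherent {loads : List (QReg × Exp)} {P : CProg} {res : Exp} {t : Target} :
      (∀ l ∈ loads, l.2.Safe) → P.Tame → Tame (.coherent loads P res t)
  | call {e : Exp} : Tame (.call e)

/-- All numbers in the program's own registers are short. -/
def OwnBounded (B : ℕ) (ψ : Full n d →₀ ℂ) : Prop :=
  ∀ b ∈ ψ.support, ∀ r, (b.1 r).size ≤ B

lemma exists_of_mem_support_applyLin {g : Full n d → (Full n d →₀ ℂ)} {ψ : Full n d →₀ ℂ}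
    {s : Full n d} (hs : s ∈ (applyLin g ψ).support) : ∃ b ∈ ψ.support, s ∈ (g b).support := by
  by_contra! h
  rw [Finsupp.mem_support_iff] at hs
  apply hs
  rw [applyLin, Finsupp.linearCombination_apply, Finsupp.sum, Finsupp.finsetSum_apply]
  refine Finset.sum_eq_zero fun b hb => ?_
  have := h b hb
  rw [Finsupp.notMem_support_iff] at this
  rw [Finsupp.smul_apply, this, smul_zero]

lemma OwnBounded.applyMatrix {B : ℕ} {ψ : Full n d →₀ ℂ} (h : OwnBounded B ψ) (M : AOp n d) :
    OwnBounded B (applyMatrix M ψ) := by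
  classical
  intro s hs r
  obtain ⟨b, hb, hs⟩ := exists_of_mem_support_applyLin hs
  obtain ⟨b', hb'⟩ : ∃ b', s = (b.1, b') := by
    by_contra! hne
    rw [Finsupp.mem_support_iff] at hs
    apply hs
    rw [Finsupp.finsetSum_apply]
    exact Finset.sum_eq_zero fun b' _ => Finsupp.single_eq_of_ne (hne b')
  rw [hb']
  exact h b hb r

/-- The sizes of the sets are short. -/
structure Sizes.Bounded (n : ℕ) (d : Sizes) (B : ℕ) : Prop where
  one : 1 ≤ B
  rounds : n ≤ B
  inst : d.inst.size ≤ B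
  msg : d.msg.size ≤ B
  chal : d.chal.size ≤ B

lemma size_le_of_lt {k N B : ℕ} (h : k < N) (hN : N.size ≤ B) : k.size ≤ B :=
  (Nat.size_le_size h.le).trans hN

lemma QReg.size_read_le {B : ℕ} (hd : d.Bounded n B) {m : Mem} {s : Full n d}
    (hs : ∀ r, (s.1 r).size ≤ B) (R : QReg) : (R.read m s).size ≤ B := by
  cases R with
  | own r => exact hs _
  | ctrl =>
    refine le_trans ?_ hd.one
    simp only [QReg.read]
    cases s.2.1 <;> simp
  | index =>
    exact (Nat.size_le.2 (s.2.2.1.1.isLt.trans n.lt_two_pow_self)).trans hd.rounds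
  | kind =>
    refine le_trans ?_ hd.one
    simp only [QReg.read]
    rcases s.2.2.1.2.1 with y | y <;> simp
  | link =>
    simp only [QReg.read]
    rcases s.2.2.1.2.1 with y | y
    · exact size_le_of_lt y.isLt hd.inst
    · exact size_le_of_lt y.isLt hd.chal
  | msg => exact size_le_of_lt s.2.2.1.2.2.isLt hd.msg
  | resp =>
    -- The response register has `Nat.clog 2 d.chal` qubits, which is at most the bit length of
    -- `d.chal`.
    refine le_trans (Nat.size_le.2 s.2.2.2.1.isLt) (le_trans ?_ hd.chal)
    exact Nat.clog_le_of_le_pow (Nat.lt_size_self _).le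
  | outInst => exact size_le_of_lt s.2.2.2.2.1.isLt hd.inst
  | outMsg j =>
    simp only [QReg.read]
    split_ifs
    · exact size_le_of_lt (Fin.isLt _) hd.msg
    · simp

lemma QReg.exists_bound (R : QReg) : ∃ p : Polynomial ℕ, ∀ (B : ℕ) (m : Mem),
    (∀ i, (m i).size ≤ B) → R.cost m ≤ p.eval B := by
  cases R with
  | own r => obtain ⟨p, hp⟩ := r.exists_bound; exact ⟨p, fun B m h => (hp B m h).2⟩
  | outMsg r => obtain ⟨p, hp⟩ := r.exists_bound; exact ⟨p, fun B m h => (hp B m h).2⟩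
  | _ => exact ⟨1, fun B m h => by simp [QReg.cost]⟩

lemma Target.exists_bound (t : Target) : ∃ p : Polynomial ℕ, ∀ (B : ℕ) (m : Mem),
    (∀ i, (m i).size ≤ B) → t.cost m ≤ p.eval B := by
  cases t with
  | own r => obtain ⟨p, hp⟩ := r.exists_bound; exact ⟨p, fun B m h => (hp B m h).2⟩
  | resp => exact ⟨1, fun B m h => by simp [Target.cost]⟩

lemma Target.own_clear_le {B : ℕ} {m : Mem} {s : Full n d} (hs : ∀ r, (s.1 r).size ≤ B)
    (t : Target) (r : ℕ) : ((t.clear m s).1 r).size ≤ B := by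
  classical
  cases t with
  | own e =>
    simp only [Target.clear, Finsupp.coe_update, Function.update_apply]
    split_ifs
    · simp
    · exact hs r
  | resp => exact hs r

lemma Target.own_xor_le {B : ℕ} {m : Mem} {s : Full n d} (hs : ∀ r, (s.1 r).size ≤ B)
    {v : ℕ} (hv : v.size ≤ B) (t : Target) (r : ℕ) : ((t.xor m s v).1 r).size ≤ B := by
  classical
  cases t with
  | own e =>
    simp only [Target.xor, Finsupp.coe_update, Function.update_apply]
    split_ifs
    · exact Nat.size_le.2 (Nat.xor_lt_two_pow (Nat.size_le.1 (hs _)) (Nat.size_le.1 hv))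
    · exact hs r
  | resp => exact hs r

lemma exists_bound_loadAll (loads : List (QReg × Exp)) (hl : ∀ l ∈ loads, l.2.Safe) :
    ∃ p : Polynomial ℕ, ∀ {n : ℕ} {d : Sizes} (B : ℕ), d.Bounded n B → ∀ (m : Mem) (s : Full n d),
      Mem.Bounded B m → (∀ r, (s.1 r).size ≤ B) →
      Mem.Bounded B (loadAll m s loads).1 ∧ (loadAll m s loads).2 ≤ p.eval B := by
  suffices h : ∃ p : Polynomial ℕ, ∀ {n : ℕ} {d : Sizes} (B : ℕ), d.Bounded n B →
      ∀ (m : Mem) (s : Full n d), Mem.Bounded B m → (∀ r, (s.1 r).size ≤ B) →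
      ∀ t : Mem × ℕ, Mem.Bounded B t.1 →
      Mem.Bounded B (loads.foldl (fun t l => (Function.update t.1 (l.2.eval m) (l.1.read m s),
        t.2 + 1 + l.1.cost m + l.2.cost m + (l.1.read m s).size)) t).1 ∧
      (loads.foldl (fun t l => (Function.update t.1 (l.2.eval m) (l.1.read m s),
        t.2 + 1 + l.1.cost m + l.2.cost m + (l.1.read m s).size)) t).2 ≤ t.2 + p.eval B by
    obtain ⟨p, hp⟩ := h
    refine ⟨p, fun B hd m s hm hs => ?_⟩
    have := hp B hd m s hm hs (m, 0) hm
    rwa [Nat.zero_add] at this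
  induction loads with
  | nil => exact ⟨0, fun B _ m s _ _ t ht => ⟨ht, by simp⟩⟩
  | cons l loads ih =>
    obtain ⟨p, hp⟩ := ih fun l' h => hl l' (List.mem_cons_of_mem _ h)
    obtain ⟨p₁, h₁⟩ := l.1.exists_bound
    obtain ⟨p₂, h₂⟩ := l.2.exists_bound
    refine ⟨1 + p₁ + p₂ + .X + p, fun B hd m s hm hs t ht => ?_⟩
    have hsafe := hl l (List.mem_cons_self ..) m
    have hread := QReg.size_read_le hd (m := m) hs l.1
    obtain ⟨h3, h4⟩ := hp B hd m s hm hs (Function.update t.1 (l.2.eval m) (l.1.read m s),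
        t.2 + 1 + l.1.cost m + l.2.cost m + (l.1.read m s).size)
        (ht.update hsafe.1 hsafe.2 hread)
    refine ⟨h3, h4.trans ?_⟩
    have h5 := h₁ B m hm.size
    have h6 := (h₂ B m hm.size).2
    simp only [Polynomial.eval_add, Polynomial.eval_one, Polynomial.eval_X]
    omega

/-- All numbers in the configuration are short. -/
structure Conf.Bounded (B : ℕ) (s : Conf n d) : Prop where
  mem : Mem.Bounded B s.mem
  own : OwnBounded B s.vec

/-- As for classical programs, with the program's own quantum registers included in the invariant: a
coherent evaluation combines two numbers of at most `B` bits by exclusive or, and the adversary's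
operators do not touch these registers. -/
lemma Prog.Tame.exists_bound {P : Prog} (hP : P.Tame) : ∃ p : Polynomial ℕ,
    ∀ {n : ℕ} {d : Sizes} {q : ℕ} (A : Adversary n d q) (B : ℕ), d.Bounded n B →
    ∀ s : Conf n d, s.Bounded B → ∀ s' ∈ P.run A s,
      s'.Bounded B ∧ s'.time ≤ s.time + p.eval B := by
  classical
  induction hP with
  | @cl P hP =>
    obtain ⟨p, hp⟩ := hP.exists_bound
    refine ⟨p, fun {n d q} A B hd s hs s' hs' => ?_⟩
    obtain ⟨h1, h2⟩ := hp B s.mem s.time hs.mem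
    simp only [Prog.run, List.mem_singleton] at hs'
    subst hs'
    exact ⟨⟨h1, hs.own⟩, h2⟩
  | seq _ _ ih₁ ih₂ =>
    obtain ⟨p₁, h₁⟩ := ih₁
    obtain ⟨p₂, h₂⟩ := ih₂
    refine ⟨p₁ + p₂, fun {n d q} A B hd s hs s' hs' => ?_⟩
    simp only [Prog.run, List.mem_flatMap] at hs'
    obtain ⟨s₁, hs₁, hs'⟩ := hs'
    obtain ⟨h3, h4⟩ := h₁ A B hd s hs s₁ hs₁
    obtain ⟨h5, h6⟩ := h₂ A B hd s₁ h3 s' hs'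
    refine ⟨h5, ?_⟩
    rw [Polynomial.eval_add]
    omega
  | @ite e P Q _ _ ih₁ ih₂ =>
    obtain ⟨p₀, h₀⟩ := e.exists_bound
    obtain ⟨p₁, h₁⟩ := ih₁
    obtain ⟨p₂, h₂⟩ := ih₂
    refine ⟨1 + p₀ + p₁ + p₂, fun {n d q} A B hd s hs s' hs' => ?_⟩
    have h0 := (h₀ B s.mem hs.mem.size).2
    have htick : (s.tick (1 + e.cost s.mem)).Bounded B := ⟨hs.mem, hs.own⟩
    simp only [Polynomial.eval_add, Polynomial.eval_one]
    simp only [Prog.run] at hs'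
    split_ifs at hs'
    · obtain ⟨h3, h4⟩ := h₁ A B hd _ htick s' hs'
      refine ⟨h3, h4.trans ?_⟩
      simp only [Conf.tick]; omega
    · obtain ⟨h3, h4⟩ := h₂ A B hd _ htick s' hs'
      refine ⟨h3, h4.trans ?_⟩
      simp only [Conf.tick]; omega
  | @loop P _ ih =>
    obtain ⟨p₀, h₀⟩ := (cell 0).exists_bound
    obtain ⟨p, hp⟩ := ih
    refine ⟨1 + p₀ + .X * (1 + p), fun {n d q} A B hd s hs s' hs' => ?_⟩
    have h0 := (h₀ B s.mem hs.mem.size).2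
    simp only [Prog.run, cell_eval] at hs'
    have key : ∀ k, ∀ s' ∈ (fun l : List (Conf n d) => l.flatMap fun t => P.run A (t.tick 1))^[k]
        [s.tick (1 + (cell 0).cost s.mem)], s'.Bounded B ∧
          s'.time ≤ s.time + (1 + (cell 0).cost s.mem) + k * (1 + p.eval B) := by
      intro k
      induction k with
      | zero =>
        intro s' h
        simp only [Function.iterate_zero, id_eq, List.mem_singleton] at h
        subst h
        exact ⟨⟨hs.mem, hs.own⟩, by simp [Conf.tick]⟩
      | succ k ihk =>
        intro s' h
        rw [Function.iterate_succ_apply', List.mem_flatMap] at h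
        obtain ⟨s₁, hs₁, h⟩ := h
        obtain ⟨h3, h4⟩ := ihk s₁ hs₁
        obtain ⟨h5, h6⟩ := hp A B hd (s₁.tick 1) ⟨h3.mem, h3.own⟩ s' h
        refine ⟨h5, h6.trans ?_⟩
        simp only [Conf.tick]
        linarith
    obtain ⟨h3, h4⟩ := key _ s' hs'
    refine ⟨h3, h4.trans ?_⟩
    have := Nat.mul_le_mul_right (1 + p.eval B) hs.mem.count
    simp only [Polynomial.eval_add, Polynomial.eval_one, Polynomial.eval_mul, Polynomial.eval_X]
    omega
  | @sample a e ha he =>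
    obtain ⟨p₁, h₁⟩ := a.exists_bound
    obtain ⟨p₂, h₂⟩ := e.exists_bound
    refine ⟨1 + p₁ + p₂, fun {n d q} A B hd s hs s' hs' => ?_⟩
    simp only [Prog.run, List.mem_map, List.mem_range] at hs'
    obtain ⟨k, hk, rfl⟩ := hs'
    have hk' : k.size ≤ B := by
      -- Not a strict inequality: for the value `0` the sample is `0`.
      refine (Nat.size_le_size (?_ : k ≤ e.eval s.mem)).trans (he.size_le hs.mem)
      omega
    refine ⟨⟨hs.mem.update (ha _).1 (ha _).2 hk', fun b hb => hs.own b ?_⟩, ?_⟩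
    · exact Finsupp.support_smul hb
    · have h3 := (h₁ B s.mem hs.mem.size).2
      have h4 := (h₂ B s.mem hs.mem.size).2
      simp only [Polynomial.eval_add, Polynomial.eval_one]
      omega
  | @measure a r ha =>
    obtain ⟨p₁, h₁⟩ := a.exists_bound
    obtain ⟨p₂, h₂⟩ := r.exists_bound
    refine ⟨1 + p₁ + p₂ + .X, fun {n d q} A B hd s hs s' hs' => ?_⟩
    simp only [Prog.run, List.mem_map, Finset.mem_toList, Finset.mem_image] at hs'
    obtain ⟨k, ⟨b, hb, hk⟩, rfl⟩ := hs'
    have hk' : k.size ≤ B := hk ▸ hs.own b hb _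
    refine ⟨⟨hs.mem.update (ha _).1 (ha _).2 hk', fun b hb => hs.own b ?_⟩, ?_⟩
    · rw [Finsupp.support_filter] at hb
      exact (Finset.mem_filter.1 hb).1
    · have h3 := (h₁ B s.mem hs.mem.size).2
      have h4 := (h₂ B s.mem hs.mem.size).2
      simp only [Polynomial.eval_add, Polynomial.eval_one, Polynomial.eval_X]
      omega
  | @coherent loads P res t hl hP =>
    obtain ⟨p₀, h₀⟩ := exists_bound_loadAll loads hl
    obtain ⟨p₁, h₁⟩ := hP.exists_bound
    obtain ⟨p₂, h₂⟩ := res.exists_bound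
    obtain ⟨p₃, h₃⟩ := t.exists_bound
    refine ⟨1 + p₃ + (p₀ + p₁ + p₂ + .X), fun {n d q} A B hd s hs s' hs' => ?_⟩
    have key : ∀ b ∈ s.vec.support, (coherentEval s.mem loads P res t b).1.size ≤ B ∧
        (coherentEval s.mem loads P res t b).2 ≤ p₀.eval B + p₁.eval B + p₂.eval B + B := by
      intro b hb
      obtain ⟨h4, h5⟩ := h₀ B hd s.mem (t.clear s.mem b) hs.mem
        (fun r => Target.own_clear_le (hs.own b hb) t r)
      obtain ⟨h6, h7⟩ := h₁ B _ (loadAll s.mem (t.clear s.mem b) loads).2 h4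
      rw [Prod.mk.eta] at h6 h7
      have h8 := (h₂ B s.mem hs.mem.size).2
      have h9 := h6.size (res.eval s.mem)
      refine ⟨h9, ?_⟩
      simp only [coherentEval]
      omega
    simp only [Prog.run, List.mem_singleton] at hs'
    subst hs'
    refine ⟨⟨hs.mem, ?_⟩, ?_⟩
    · intro b' hb'
      obtain ⟨b, hb, hb'⟩ := exists_of_mem_support_applyLin hb'
      have := Finset.mem_singleton.1 (Finsupp.support_single_subset hb')
      subst this
      exact fun r => Target.own_xor_le (hs.own b hb) (key b hb).1 t r
    · have h4 := h₃ B s.mem hs.mem.size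
      have h5 : (s.vec.support.sup fun b => (coherentEval s.mem loads P res t b).2) ≤
          p₀.eval B + p₁.eval B + p₂.eval B + B := Finset.sup_le fun b hb => (key b hb).2
      simp only [Polynomial.eval_add, Polynomial.eval_one, Polynomial.eval_X]
      omega
  | @call e =>
    obtain ⟨p, hp⟩ := e.exists_bound
    refine ⟨1 + p, fun {n d q} A B hd s hs s' hs' => ?_⟩
    simp only [Prog.run, List.mem_singleton] at hs'
    subst hs'
    refine ⟨⟨hs.mem, ?_⟩, ?_⟩
    · simp only
      split_ifs
      · exact hs.own.applyMatrix _
      · exact hs.own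
    · have := (hp B s.mem hs.mem.size).2
      simp only [Polynomial.eval_add, Polynomial.eval_one]
      omega

end MultiRoundFS
end

noncomputable section
namespace MultiRoundFS
variable {n : ℕ} {d : Sizes} {q : ℕ}

/-! ## The running time of the simulator -/

lemma safe_const {k : ℕ} (h0 : k ≠ 0) (h10 : k ≠ 10) : (Exp.const k).Safe := fun _ => ⟨h0, h10⟩

lemma short_reduced (e : Exp) : (reduced e).Short := Or.inl ⟨e, rfl⟩

lemma short_cell (k : ℕ) : (cell k).Short := Or.inr ⟨_, rfl⟩

lemma tame_setTo {k : ℕ} (h0 : k ≠ 0) (h10 : k ≠ 10) (e : Exp) : (setTo k e).Tame :=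
  .assign (safe_const h0 h10) (short_reduced e)

lemma tame_nop : nop.Tame := .assign (safe_const (by omega) (by omega)) (short_cell _)

lemma tame_hashProg (n : ℕ) : (hashProg n).Tame :=
  have h : (hashStep n).Tame := .seq (tame_setTo (by omega) (by omega) _)
    (tame_setTo (by omega) (by omega) _)
  .seq (tame_setTo (by omega) (by omega) _) (.seq (tame_setTo (by omega) (by omega) _)
    (.loop (.seq h h)))

lemma tame_queryProg (n h : ℕ) : (queryProg n h).Tame := by
  refine .coherent ?_ (.seq (tame_hashProg n) (tame_setTo (by omega) (by omega) _))
  simp only [queryLoads, List.forall_mem_cons]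
  exact ⟨safe_const (by omega) (by omega), safe_const (by omega) (by omega),
    safe_const (by omega) (by omega), safe_const (by omega) (by omega),
    safe_const (by omega) (by omega), by simp⟩

lemma tame_measureQuery (h : ℕ) : (measureQuery h).Tame := by
  refine .seq (.coherent ?_ (tame_setTo (by omega) (by omega) _))
    (.measure (safe_const (by omega) (by omega)))
  simp only [queryLoads, List.forall_mem_cons]
  exact ⟨safe_const (by omega) (by omega), safe_const (by omega) (by omega),
    safe_const (by omega) (by omega), safe_const (by omega) (by omega),
    safe_const (by omega) (by omega), by simp⟩

lemma tame_measureOutput (h : ℕ) : (measureOutput h).Tame := by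
  refine .seq (.coherent ?_ (tame_setTo (by omega) (by omega) _))
    (.measure (safe_const (by omega) (by omega)))
  simp only [List.forall_mem_cons]
  exact ⟨safe_const (by omega) (by omega), safe_const (by omega) (by omega), by simp⟩

lemma tame_recordProg (h : ℕ) : (recordProg h).Tame := by
  refine .seq (tame_setTo (by omega) (by omega) _)
    (.seq (.assign (safe_const (by omega) (by omega)) (short_cell _)) ?_)
  split_ifs
  · exact tame_setTo (by omega) (by omega) _
  · exact tame_nop

lemma tame_applyNext : applyNext.Tame := .seq .call (.cl (tame_setTo (by omega) (by omega) _))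

lemma tame_advance (n h : ℕ) : (advance n h).Tame := .seq (tame_queryProg n h) tame_applyNext

lemma tame_stepProg (n h : ℕ) : (stepProg n h).Tame :=
  .seq (.sample (safe_const (by omega) (by omega)) (short_reduced _))
    (.ite (.seq (tame_measureQuery h) (.seq (.cl (tame_recordProg h))
      (.seq (.cl (tame_setTo (by omega) (by omega) _))
        (.cl (tame_setTo (by omega) (by omega) _))))) (tame_advance n h))

lemma tame_searchProg (n h : ℕ) : (searchProg n h).Tame :=
  .seq (.loop (.ite (tame_stepProg n h) (.cl tame_nop)))
    (.ite (.cl tame_nop) (.seq (tame_measureOutput h) (.cl (tame_recordProg h))))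

lemma tame_resumeProg (n h : ℕ) : (resumeProg n h).Tame :=
  .seq (.cl (.assign (safe_const (by omega) (by omega)) (short_cell _)))
    (.ite (.seq (.ite (tame_queryProg n (h + 1)) (tame_queryProg n h))
      (.seq tame_applyNext (.cl (tame_setTo (by omega) (by omega) _)))) (.cl tame_nop))

lemma tame_finishProg (n : ℕ) : (finishProg n).Tame :=
  .loop (.ite (tame_advance n n) (.cl tame_nop))

lemma tame_seedProg (n : ℕ) : (seedProg n).Tame :=
  have h : (seedStep n).Tame := .seq
    (.sample (fun m => by simp only [Exp.eval, Op.eval]; omega) (short_cell _))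
    (.cl (tame_setTo (by omega) (by omega) _))
  .loop (.seq h h)

/-- The stage `0` is excluded because `initProg` writes the modulus and lets numbers grow; it is
treated by hand. -/
lemma tame_simulator {i : Fin (n + 1)} (hi : i.val ≠ 0) : (simulator n i).Tame := by
  unfold simulator
  rw [if_neg hi]
  refine .seq (tame_resumeProg n _) ?_
  split_ifs
  · exact tame_searchProg n _
  · exact tame_finishProg n

/-- The length of the input. -/
def inputLength (d : Sizes) (q : ℕ) : ℕ :=
  q + Nat.size d.inst + Nat.size d.msg + Nat.size d.chal

lemma size_pow_le (b k : ℕ) : (b ^ k).size ≤ k * b.size + 1 := by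
  rw [Nat.size_le, pow_succ, mul_comm k, pow_mul]
  have := Nat.pow_le_pow_left (Nat.lt_size_self b).le k
  have : 0 < (2 ^ b.size) ^ k := by positivity
  omega

lemma exists_bound_assign (a e : Exp) : ∃ p : Polynomial ℕ, ∀ (B : ℕ) (m : Mem),
    (∀ i, (m i).size ≤ B) → ∀ t, ((CProg.assign a e).run (m, t)).2 ≤ t + p.eval B := by
  obtain ⟨p₁, h₁⟩ := a.exists_bound
  obtain ⟨p₂, h₂⟩ := e.exists_bound
  refine ⟨1 + p₁ + p₂, fun B m hm t => ?_⟩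
  have h3 := (h₁ B m hm).2
  have h4 := (h₂ B m hm).2
  simp only [CProg.run, Polynomial.eval_add, Polynomial.eval_one]
  omega

lemma size_update_le {B : ℕ} {m : Mem} (h : ∀ i, (m i).size ≤ B) (k : ℕ) {v : ℕ}
    (hv : v.size ≤ B) (i : ℕ) : (Function.update m k v i).size ≤ B := by
  rw [Function.update_apply]
  split_ifs
  · exact hv
  · exact h i

lemma CProg.run_seq (P Q : CProg) (s : Mem × ℕ) : (CProg.seq P Q).run s = Q.run (P.run s) := rfl

lemma CProg.run_loop (e : Exp) (P : CProg) (s : Mem × ℕ) : (CProg.loop e P).run s =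
    (fun t : Mem × ℕ => P.run (t.1, t.2 + 1))^[e.eval s.1] (s.1, s.2 + 1 + e.cost s.1) := rfl

/-- Here the numbers do grow, but cell `11` holds the power of `baseVal` with exponent `4k + 2n + 8`
after `k ≤ q` iterations, so its length is at most about the exponent times the length of the base.
The resulting bound then serves as the invariant `B` of all later programs. -/
lemma exists_bound_initProg (n : ℕ) : ∃ b p : Polynomial ℕ, ∀ (d : Sizes) (q : ℕ)
    (A : Adversary n d q), 0 < d.chal →
    Mem.Bounded (b.eval (inputLength d q)) ((initProg n).run ((startConf A).mem, 0)).1 ∧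
    ((initProg n).run ((startConf A).mem, 0)).2 ≤ p.eval (inputLength d q) ∧
    d.Bounded n (b.eval (inputLength d q)) := by
  obtain ⟨s, hs⟩ := (baseExp n).exists_bound
  obtain ⟨p₁, h₁⟩ := exists_bound_assign (.const 13) (baseExp n)
  obtain ⟨p₂, h₂⟩ := exists_bound_assign (.const 11) (powExp (cell 13) (2 * n + 8))
  obtain ⟨p₃, h₃⟩ := exists_bound_assign (.const 11) (.op .mul (cell 11) (powExp (cell 13) 4))
  obtain ⟨p₄, h₄⟩ := exists_bound_assign (.const 10) (.op .mul (cell 3) (cell 11))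
  obtain ⟨p₅, h₅⟩ := (cell 0).exists_bound
  -- The product bounds exponent times length of the base, and `X` the lengths of the inputs. The
  -- remaining terms leave room for rounding, for the multiplication by `d.chal` and for the number
  -- of rounds.
  set b : Polynomial ℕ := .X + (4 * .X + .C (2 * n + 8)) * s + s + .C (n + 2) with hb
  refine ⟨b, (p₁ + p₂ + (1 + p₅ + .X * (1 + p₃)) + p₄).comp b, fun d q A hC => ?_⟩
  set L := inputLength d q with hL
  set B := b.eval L with hB
  have hBL : B = L + (4 * L + (2 * n + 8)) * s.eval L + s.eval L + (n + 2) := by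
    simp [hB, hb]
  set m₀ := (startConf A).mem with hm₀
  have hm₀L : ∀ i, (m₀ i).size ≤ L := by
    intro i
    have : q.size ≤ q := Nat.size_le.2 q.lt_two_pow_self
    simp only [hm₀, startConf, hL, inputLength]
    split_ifs <;> simp <;> omega
  set β := baseVal n d q with hβ
  have hβL : β.size ≤ s.eval L := by
    have := (hs L m₀ hm₀L).1
    have e : (baseExp n).eval m₀ = β := by
      simp [baseExp, Exp.eval, Op.eval, hm₀, startConf, baseVal, hβ]
    rwa [e] at this
  have hq : q ≤ L := by rw [hL, inputLength]; omega
  set Mk : ℕ → ℕ := fun k => β ^ (2 * n + 8) * (β ^ 4) ^ k with hMk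
  have hMkL : ∀ k ≤ q, (Mk k).size + L < B := by
    intro k hk
    have e : Mk k = β ^ (4 * k + (2 * n + 8)) := by simp only [hMk]; ring
    have h6 := size_pow_le β (4 * k + (2 * n + 8))
    have h7 : (4 * k + (2 * n + 8)) * β.size ≤ (4 * L + (2 * n + 8)) * s.eval L :=
      Nat.mul_le_mul (by omega) hβL
    rw [e]
    omega
  have hm₀B : ∀ i, (m₀ i).size ≤ B := fun i => (hm₀L i).trans (by omega)
  set m₁ := Function.update m₀ 13 β with hm₁
  have hm₁B : ∀ i, (m₁ i).size ≤ B := size_update_le hm₀B _ (by omega)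
  have hkB : ∀ k ≤ q, ∀ i, (Function.update m₁ 11 (Mk k) i).size ≤ B := fun k hk =>
    size_update_le hm₁B _ (by have := hMkL k hk; omega)
  have e1 : ((CProg.assign (.const 13) (baseExp n)).run (m₀, 0)).1 = m₁ := by
    simp [CProg.run, baseExp, Exp.eval, Op.eval, hm₀, startConf, baseVal, hβ, hm₁]
  set t₁ := ((CProg.assign (.const 13) (baseExp n)).run (m₀, 0)).2 with ht₁
  have e1' : (CProg.assign (.const 13) (baseExp n)).run (m₀, 0) = (m₁, t₁) := Prod.ext e1 rfl
  have ht₁' := h₁ B m₀ hm₀B 0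
  have e2 : ((CProg.assign (.const 11) (powExp (cell 13) (2 * n + 8))).run (m₁, t₁)).1 =
      Function.update m₁ 11 (Mk 0) := by
    simp [CProg.run, Exp.eval, hMk, hm₁]
  set t₂ := ((CProg.assign (.const 11) (powExp (cell 13) (2 * n + 8))).run (m₁, t₁)).2 with ht₂
  have e2' : (CProg.assign (.const 11) (powExp (cell 13) (2 * n + 8))).run (m₁, t₁) =
    (Function.update m₁ 11 (Mk 0), t₂) := Prod.ext e2 rfl
  have ht₂' := h₂ B m₁ hm₁B t₁
  set t₂' := t₂ + 1 + (cell 0).cost (Function.update m₁ 11 (Mk 0)) with ht₂''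
  have h6 := (h₅ B _ (hkB 0 (Nat.zero_le _))).2
  have key : ∀ k ≤ q, ((fun t : Mem × ℕ => (CProg.assign (.const 11)
      (.op .mul (cell 11) (powExp (cell 13) 4))).run (t.1, t.2 + 1))^[k]
      (Function.update m₁ 11 (Mk 0), t₂')).1 = Function.update m₁ 11 (Mk k) ∧
      ((fun t : Mem × ℕ => (CProg.assign (.const 11)
      (.op .mul (cell 11) (powExp (cell 13) 4))).run (t.1, t.2 + 1))^[k]
      (Function.update m₁ 11 (Mk 0), t₂')).2 ≤ t₂' + k * (1 + p₃.eval B) := by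
    intro k
    induction k with
    | zero => intro _; exact ⟨rfl, by simp⟩
    | succ k ih =>
      intro hk
      obtain ⟨h7, h8⟩ := ih (by omega)
      rw [Function.iterate_succ_apply']
      set st := (fun t : Mem × ℕ => (CProg.assign (.const 11)
        (.op .mul (cell 11) (powExp (cell 13) 4))).run (t.1, t.2 + 1))^[k]
        (Function.update m₁ 11 (Mk 0), t₂')
      rw [h7]
      refine ⟨?_, ?_⟩
      · simp [CProg.run, Exp.eval, Op.eval, hMk, hm₁]
        congr 1
        ring
      · have := h₃ B _ (hkB k (by omega)) (st.2 + 1)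
        linarith
  obtain ⟨h7, h8⟩ := key q le_rfl
  have e0 : (cell 0).eval (Function.update m₁ 11 (Mk 0)) = q := by
    simp [hm₁, hm₀, startConf]
  have hrun : (initProg n).run (m₀, 0) = (CProg.assign (.const 10)
      (.op .mul (cell 3) (cell 11))).run ((fun t : Mem × ℕ => (CProg.assign (.const 11)
      (.op .mul (cell 11) (powExp (cell 13) 4))).run (t.1, t.2 + 1))^[q]
      (Function.update m₁ 11 (Mk 0), t₂')) := by
    rw [initProg, CProg.run_seq, e1', CProg.run_seq, e2', CProg.run_seq, CProg.run_loop, e0]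
  set st := (fun t : Mem × ℕ => (CProg.assign (.const 11)
      (.op .mul (cell 11) (powExp (cell 13) 4))).run (t.1, t.2 + 1))^[q]
      (Function.update m₁ 11 (Mk 0), t₂')
  have hst : st = (Function.update m₁ 11 (Mk q), st.2) := Prod.ext h7 rfl
  rw [hst] at hrun
  have ht₄ := h₄ B _ (hkB q le_rfl) st.2
  have hsizes : d.inst.size ≤ L ∧ d.msg.size ≤ L ∧ d.chal.size ≤ L := by
    rw [hL, inputLength]; omega
  refine ⟨?_, ?_, ?_⟩
  · rw [hrun]
    have e : ((CProg.assign (.const 10) (.op .mul (cell 3) (cell 11))).run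
        (Function.update m₁ 11 (Mk q), st.2)).1 =
        Function.update (Function.update m₁ 11 (Mk q)) 10 (d.chal * Mk q) := by
      simp [CProg.run, Exp.eval, Op.eval, hm₁, hm₀, startConf]
    rw [e]
    refine ⟨?_, ?_, size_update_le (hkB q le_rfl) _ ?_⟩
    · have : (Function.update (Function.update m₁ 11 (Mk q)) 10 (d.chal * Mk q)) 0 = q := by
        simp [hm₁, hm₀, startConf]
      rw [this]; omega
    · rw [Function.update_self]
      exact Nat.mul_pos hC (quotVal_pos n d q)
    · have h9 := Op.size_eval_le .mul d.chal (Mk q)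
      have h10 := hMkL q le_rfl
      simp only [Op.eval] at h9
      omega
  · rw [hrun, Polynomial.eval_comp, ← hB]
    simp only [Polynomial.eval_add, Polynomial.eval_one, Polynomial.eval_mul, Polynomial.eval_X]
    have h9 : q * (1 + p₃.eval B) ≤ B * (1 + p₃.eval B) := Nat.mul_le_mul_right _ (by omega)
    omega
  · exact ⟨by omega, by omega, by omega, by omega, by omega⟩

lemma ownBounded_start (A : Adversary n d q) (B : ℕ) : OwnBounded B (startConf A).vec := by
  intro b hb r
  have e : (startConf A).vec = liftBy (fun _ => 0) A.start := rfl
  rw [e, Finsupp.mem_support_iff, liftBy_apply] at hb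
  have : b.1 = 0 := by
    by_contra h
    exact hb (if_neg h)
  simp [this]

/-- The simulator runs in polynomial time. -/
lemma exists_bound_simulator (n : ℕ) : ∃ p : Polynomial ℕ, ∀ (d : Sizes), 0 < d.chal →
    ∀ (q : ℕ) (A : Adversary n d q), RunsInTime A (simulator n) (p.eval (inputLength d q)) := by
  obtain ⟨b, p₀, h₀⟩ := exists_bound_initProg n
  have key : ∀ k (hk : k < n + 1), ∃ p : Polynomial ℕ, ∀ (d : Sizes), 0 < d.chal →
      ∀ (q : ℕ) (A : Adversary n d q) (c : Fin n → Fin d.chal),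
      ∀ v ∈ views A (simulator n) c k hk, v.conf.Bounded (b.eval (inputLength d q)) ∧
        v.conf.time ≤ p.eval (inputLength d q) := by
    intro k
    induction k with
    | zero =>
      intro hk
      have htame : (if (0 : ℕ) < n then searchProg n 0 else finishProg n).Tame := by
        split_ifs
        · exact tame_searchProg n 0
        · exact tame_finishProg n
      obtain ⟨p₁, h₁⟩ := (Prog.Tame.seq (tame_seedProg n) htame).exists_bound
      refine ⟨p₀ + p₁.comp b, fun d hC q A c v hv => ?_⟩
      obtain ⟨h2, h3, h4⟩ := h₀ d q A hC
      simp only [views, List.mem_map, simulator, if_true, Prog.run, List.mem_flatMap,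
        List.mem_singleton] at hv
      obtain ⟨s, ⟨s₁, ⟨s₂, rfl, hs₁⟩, hs⟩, rfl⟩ := hv
      obtain ⟨h5, h6⟩ := h₁ A _ h4 _ (⟨h2, ownBounded_start A _⟩ : Conf.Bounded _
        { (startConf A) with
          mem := ((initProg n).run ((startConf A).mem, 0)).1
          time := ((initProg n).run ((startConf A).mem, 0)).2 }) s
        (List.mem_flatMap.2 ⟨s₁, hs₁, hs⟩)
      refine ⟨h5, h6.trans ?_⟩
      rw [Polynomial.eval_add, Polynomial.eval_comp]
      exact Nat.add_le_add_right h3 _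
    | succ k ih =>
      intro hk
      obtain ⟨p, hp⟩ := ih (by omega)
      obtain ⟨p₁, h₁⟩ := (tame_simulator (n := n) (i := ⟨k + 1, hk⟩) (by simp)).exists_bound
      refine ⟨p + p₁.comp b, fun d hC q A c v hv => ?_⟩
      obtain ⟨-, -, h4⟩ := h₀ d q A hC
      simp only [views, List.mem_flatMap, List.mem_map] at hv
      obtain ⟨v₁, hv₁, s, hs, rfl⟩ := hv
      obtain ⟨h5, h6⟩ := hp d hC q A c v₁ hv₁
      obtain ⟨h7, h8⟩ := h₁ A _ h4 { v₁.conf with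
        mem := Function.update v₁.conf.mem 6 (c ⟨k, by omega⟩).val }
        (⟨h5.mem.update (by omega) (by omega) (size_le_of_lt (Fin.isLt _) h4.chal), h5.own⟩) s hs
      refine ⟨h7, h8.trans ?_⟩
      rw [Polynomial.eval_add, Polynomial.eval_comp]
      exact Nat.add_le_add_right h6 _
  obtain ⟨p, hp⟩ := key n (Nat.lt_succ_self n)
  exact ⟨p, fun d hC q A c v hv => (hp d hC q A c v hv).2⟩

end MultiRoundFS
end

theorem corollary1 (n : ℕ) (hn : 0 < n) :
    ∃ (S : Fin (n + 1) → MultiRoundFS.Prog) (p : Polynomial ℕ),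
      ∀ (d : MultiRoundFS.Sizes), 0 < d.inst → 0 < d.msg → 0 < d.chal →
      ∀ (q : ℕ) (A : MultiRoundFS.Adversary n d q),
        MultiRoundFS.RunsInTime A S
          (p.eval (q + Nat.size d.inst + Nat.size d.msg + Nat.size d.chal)) ∧
        ∃ ε : Fin d.inst → ℝ,
          (∀ x, 0 ≤ ε x) ∧ ∑ x, ε x = (n.factorial : ℝ) / d.chal ∧
          ∀ (prot : MultiRoundFS.PCIP n d) (x : Fin d.inst),
            (n.factorial : ℝ) / (2 * q + n + 1 : ℝ) ^ (2 * n) * MultiRoundFS.forgeProb A prot x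
                - ε x
              ≤ MultiRoundFS.interactProb A S prot x := by
  obtain ⟨p, hp⟩ := MultiRoundFS.exists_bound_simulator n
  exact ⟨MultiRoundFS.simulator n, p, fun d hX hM hC q A =>
    ⟨hp d hC q A, MultiRoundFS.exists_error hn hX hM hC A⟩⟩
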